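/- Identify $\mathbb R^2$ with $\mathbb C$. Let $n\ge 3$ be an integer, $0<r<1$, $\ell=\frac{1-r}{2}$, $\theta_n=\frac{2\pi}{n}$, $\alpha_n=\pi-\frac{2\pi}{n}$. Let $C_{n,r}$ be the unique nonempty compact set with $C_{n,r}=\varphi_L(C_{n,r})\cup\varphi_R(C_{n,r})\cup\bigcup_{k=1}^{n-1}\psi_k(C_{n,r})$, where $\varphi_L(z)=\ell z$, $\varphi_R(z)=\ell+r+\ell z$, $\psi_1(z)=\ell+re^{i\alpha_n}z$ and $\psi_{k}(z)=\psi_{k-1}(1)+re^{i(\alpha_n-(k-1)\theta_n)}z$ for $k>1$. An $(n,r)$-von Koch snowflake is a set isometric to $\bigcup_{k=1}^n U_k(\overline{C_{n,r}})$, where $\overline{C_{n,r}}=\{\bar z: z\in C_{n,r}\}$ is the mirror image of $C_{n,r}$ in the real axis, $U_1(z)=1+e^{i\theta_n}z$ and $U_k(z)=U_{k-1}(1)+e^{ik\theta_n}z$ for $k>1$ (that is, $n$ von Koch curves placed on the edges of a regular $n$-gon of side length one, with bumps pointing outwards). Let $K$ be an $(n,r)$-von Koch snowflake that is a simple closed curve,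 let $\Omega$ be the bounded component of $\mathbb C\setminus K$, and let $V(\varepsilon)=|\{z\in\Omega: d(z,K)<\varepsilon\}|$ (Lebesgue measure). For $\delta>0$ the relative tube zeta function $\tilde\zeta_{K,\Omega}(\cdot\,;\delta)$ is the meromorphic extension of $s\mapsto\int_0^\delta t^{s-3}V(t)\,dt$, which converges absolutely for $\operatorname{Re}s$ sufficiently large. For $\sigma\in\mathbb R$ let $\mathbb H_\sigma=\{s:\operatorname{Re}s>\sigma\}$; the complex dimensions $\mathcal D_{K}(\mathbb H_0)$ of $(K,\Omega)$ in $\mathbb H_0$ are the poles of $\tilde\zeta_{K,\Omega}$ in $\mathbb H_0$ (for any $\delta>0$; they do not depend on $\delta$). Put $V_K=\frac1nV$, let $R$ be defined by $$V_K(\varepsilon)=2\ell^2V_K(\varepsilon/\ell)+(n-1)r^2V_K(\varepsilon/r)+R(\varepsilon),$$ and put $$\tilde\zeta_R(s;\delta)=n\int_0^\delta t^{s-3}R(t)\,dt,\qquad E(s;\delta)=2\ell^s\int_\delta^{\delta/\ell}t^{s-3}V(t)\,dt+(n-1)r^s\int_\delta^{\delta/r}t^{s-3}V(t)\,dt .$$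 Let $\mathcal D_L=\{\omega\in\mathbb C: 1=2\ell^\omega+(n-1)r^\omega\}$, and let $D$ be the relative upper Minkowski dimension of $(K,\Omega)$, i.e. the infimum of all $d\in\mathbb R$ with $\limsup_{t\to0^+}V(t)/t^{2-d}=0$. Then for every $\delta>0$: 1. $E(\cdot\,;\delta)$ is entire, and the integral defining $\tilde\zeta_R(s;\delta)$ converges absolutely for every $s\in\mathbb H_0$ and is holomorphic in $\mathbb H_0$. 2. $\tilde\zeta_{K,\Omega}(\cdot\,;\delta)$ extends meromorphically to $\mathbb H_0$, its poles there are exactly the points of $\mathcal D_K(\mathbb H_0)$, and for all $s\in\mathbb H_0\setminus\mathcal D_L$ $$\tilde\zeta_{K,\Omega}(s;\delta)=\frac{1}{1-2\ell^s-(n-1)r^s}\bigl(E(s;\delta)+\tilde\zeta_R(s;\delta)\bigr).$$ 3. $\mathcal D_K(\mathbb H_0)\subseteq\mathcal D_L$. 4. $\tilde\zeta_{K,\Omega}(\cdot\,;\delta)$ is holomorphic in $\mathbb H_D$. -/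

import Mathlib

open Set Filter Topology MeasureTheory

/- The plane `ℝ²` is identified with `ℂ` (Euclidean norm, Lebesgue measure `volume`);
the rotation by an angle `θ` is multiplication by `exp (θ * I)`. -/

namespace VonKoch

noncomputable section

/-! ### Generalized von Koch curves and snowflakes -/

/-- The conjugate scaling ratio `ℓ = (1 - r) / 2`. -/
def conjRatio (r : ℝ) : ℝ := (1 - r) / 2

/-- The central angle `θ_n = 2π / n` of the regular `n`-gon. -/
def centralAngle (n : ℕ) : ℝ := 2 * Real.pi / n

/-- The interior angle `α_n = π - 2π / n` of the regular `n`-gon. -/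
def interiorAngle (n : ℕ) : ℝ := Real.pi - 2 * Real.pi / n

/-- The rotation of the plane about the origin by the angle `θ`. -/
def rot (θ : ℝ) (z : ℂ) : ℂ := Complex.exp (θ * Complex.I) * z

/-- `φ_L = S_ℓ`. -/
def phiL (r : ℝ) (z : ℂ) : ℂ := conjRatio r * z

/-- `φ_R = T_{(ℓ + r, 0)} ∘ S_ℓ`. -/
def phiR (r : ℝ) (z : ℂ) : ℂ := (conjRatio r + r) + conjRatio r * z

/-- `psi n r k` is the map `ψ_{k+1}` placing a copy of ratio `r` on the `(k+1)`-st of the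
`n - 1` polygon edges replacing the middle portion of the unit interval:
`ψ₁ = T_{(ℓ,0)} ∘ R_{α_n} ∘ S_r` and
`ψ_{k+1} = T_{ψ_k(1,0)} ∘ R_{α_n - k θ_n} ∘ S_r`. -/
def psi (n : ℕ) (r : ℝ) : ℕ → ℂ → ℂ
  | 0 => fun z => conjRatio r + rot (interiorAngle n) (r * z)
  | k + 1 => fun z =>
      psi n r k 1 + rot (interiorAngle n - (k + 1) * centralAngle n) (r * z)

/-- `C` is the standard `(n, r)`-von Koch curve `C_{n,r}`: the (unique) nonempty compact set with
`C = φ_L(C) ∪ φ_R(C) ∪ ψ₁(C) ∪ ⋯ ∪ ψ_{n-1}(C)`. Its end points are `0` and `1`, and its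
polygonal bumps lie above the unit interval. -/
structure IsStandardCurve (n : ℕ) (r : ℝ) (C : Set ℂ) : Prop where
  nonempty : C.Nonempty
  isCompact : IsCompact C
  fixed : C = phiL r '' C ∪ phiR r '' C ∪ ⋃ k ∈ Finset.range (n - 1), psi n r k '' C

/-- `edgeMap n k` is the isometry `U_{k+1}` carrying the unit interval onto the `(k+1)`-st edge of
a regular `n`-gon of side length one traversed counterclockwise:
`U₁ = T_{(1,0)} ∘ R_{θ_n}` and `U_{k+1} = T_{U_k(1,0)} ∘ R_{(k+1) θ_n}`. -/
def edgeMap (n : ℕ) : ℕ → ℂ → ℂ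
  | 0 => fun z => 1 + rot (centralAngle n) z
  | k + 1 => fun z => edgeMap n k 1 + rot ((k + 2) * centralAngle n) z

/-- `K` is an `(n, r)`-von Koch snowflake: it is isometric to the union of `n` von Koch curves
placed on the edges of the regular `n`-gon of side length one, with the bumps pointing away from
the `n`-gon. (The edges are traversed counterclockwise, so the outward pointing curve with end
points `0` and `1` is the mirror image of the standard one in the real axis.) -/
def IsSnowflake (n : ℕ) (r : ℝ) (K : Set ℂ) : Prop :=
  ∃ C : Set ℂ, IsStandardCurve n r C ∧
    ∃ F : ℂ ≃ᵢ ℂ,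
      K = F '' ⋃ k ∈ Finset.range n, edgeMap n k '' ((starRingEnd ℂ) '' C)

/-- `K` is a simple closed curve. -/
def IsSimpleClosedCurve (K : Set ℂ) : Prop :=
  ∃ γ : Circle → ℂ, Continuous γ ∧ Function.Injective γ ∧ range γ = K

/-- `Ω` is a bounded connected component of the complement of `K`. -/
def IsBoundedComponent (K Ω : Set ℂ) : Prop :=
  (∃ x ∈ Kᶜ, Ω = connectedComponentIn Kᶜ x) ∧ Bornology.IsBounded Ω

/-! ### Relative tube functions, tube zeta functions, complex dimensions -/

/-- The relative tube function `V_{X,Ω}(ε) = |X_ε ∩ Ω|`. -/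
def tubeFunction (X Ω : Set ℂ) (ε : ℝ) : ℝ :=
  (volume (Metric.thickening ε X ∩ Ω)).toReal

/-- The integral `∫_{a}^{b} t^{s - N - 1} f(t) dt` with `N = 2`. -/
def zetaIntegral (f : ℝ → ℝ) (a b : ℝ) (s : ℂ) : ℂ :=
  ∫ t in a..b, (t : ℂ) ^ (s - 2 - 1) * (f t : ℂ)

/-- Absolute convergence of `∫_{a}^{b} t^{s - N - 1} f(t) dt` with `N = 2`. -/
def ZetaConverges (f : ℝ → ℝ) (a b : ℝ) (s : ℂ) : Prop :=
  IntervalIntegrable (fun t : ℝ => (t : ℂ) ^ (s - 2 - 1) * (f t : ℂ)) volume a b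

/-- The open right half-plane `H_σ`. -/
def halfPlane (σ : ℝ) : Set ℂ := {s | σ < s.re}

/-- `Z` is (a representative of) the relative tube zeta function `s ↦ ζ̃_{X,Ω}(s; δ)`, extended
meromorphically to the half-plane `H_σ₀`: it is given by the absolutely convergent integral
`∫_0^δ t^{s-3} V_{X,Ω}(t) dt` when the real part of `s` is sufficiently large, and it is
meromorphic in `H_σ₀`. Normal form means that `Z` is analytic at each point of `H_σ₀` that is not
a pole; this makes the values of `Z` outside the poles unique. -/
def IsTubeZeta (X Ω : Set ℂ) (δ σ₀ : ℝ) (Z : ℂ → ℂ) : Prop :=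
  MeromorphicNFOn Z (halfPlane σ₀) ∧
    ∃ σ : ℝ, ∀ s : ℂ, σ < s.re →
      ZetaConverges (tubeFunction X Ω) 0 δ s ∧ Z s = zetaIntegral (tubeFunction X Ω) 0 δ s

/-- The poles in `H_σ₀` of a function meromorphic there. -/
def poles (σ₀ : ℝ) (Z : ℂ → ℂ) : Set ℂ := {ω ∈ halfPlane σ₀ | meromorphicOrderAt Z ω < 0}

/-- The complex dimensions of `X` relative to `Ω` in the window `H_σ₀`: the poles there of the
relative tube zeta function. -/
def complexDimensions (X Ω : Set ℂ) (σ₀ : ℝ) : Set ℂ :=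
  {ω | ∃ δ : ℝ, 0 < δ ∧ ∃ Z : ℂ → ℂ, IsTubeZeta X Ω δ σ₀ Z ∧ ω ∈ poles σ₀ Z}

/-- The `d`-dimensional relative upper Minkowski content
`limsup_{t → 0⁺} |X_t ∩ Ω| / t^{2 - d}`. -/
def upperMinkowskiContent (X Ω : Set ℂ) (d : ℝ) : ENNReal :=
  limsup (fun t : ℝ => volume (Metric.thickening t X ∩ Ω) / ENNReal.ofReal (t ^ (2 - d)))
    (𝓝[>] (0 : ℝ))

/-- The relative upper Minkowski dimension: the infimum of all real `d` for which the
`d`-dimensional relative upper Minkowski content vanishes. -/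
def upperMinkowskiDim (X Ω : Set ℂ) : EReal :=
  sInf ((fun d : ℝ => (d : EReal)) '' {d : ℝ | upperMinkowskiContent X Ω d = 0})

/-! ### The terms in the formula for the zeta function of a snowflake -/

/-- The function `1 - 2 ℓ^s - (n - 1) r^s`. -/
def moran (n : ℕ) (r : ℝ) (s : ℂ) : ℂ :=
  1 - 2 * (conjRatio r : ℂ) ^ s - ((n : ℂ) - 1) * (r : ℂ) ^ s

/-- The set `D_L` of complex roots of `1 = 2 ℓ^ω + (n - 1) r^ω`. -/
def scalingDimensions (n : ℕ) (r : ℝ) : Set ℂ :=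
  {ω | 1 = 2 * (conjRatio r : ℂ) ^ ω + ((n : ℂ) - 1) * (r : ℂ) ^ ω}

/-- `V_K = V_{K,Ω} / n`, the part of the tube function belonging to one of the `n` congruent
sectors of the snowflake. -/
def sectorTube (n : ℕ) (K Ω : Set ℂ) (ε : ℝ) : ℝ := tubeFunction K Ω ε / n

/-- The remainder `R` in the scaling functional equation
`V_K(ε) = 2 ℓ² V_K(ε / ℓ) + (n - 1) r² V_K(ε / r) + R(ε)`. -/
def remainder (n : ℕ) (r : ℝ) (K Ω : Set ℂ) (ε : ℝ) : ℝ :=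
  sectorTube n K Ω ε -
    (2 * conjRatio r ^ 2 * sectorTube n K Ω (ε / conjRatio r) +
      ((n : ℝ) - 1) * r ^ 2 * sectorTube n K Ω (ε / r))

/-- `ζ̃_R(s; δ) = n ∫_0^δ t^{s-3} R(t) dt`. -/
def zetaR (n : ℕ) (r : ℝ) (K Ω : Set ℂ) (δ : ℝ) (s : ℂ) : ℂ :=
  n * zetaIntegral (remainder n r K Ω) 0 δ s

/-- `E(s; δ) = 2 ℓ^s ∫_δ^{δ/ℓ} t^{s-3} V_{K,Ω}(t) dt + (n - 1) r^s ∫_δ^{δ/r} t^{s-3} V_{K,Ω}(t) dt`,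
a combination of partial tube zeta functions. -/
def entireE (n : ℕ) (r : ℝ) (K Ω : Set ℂ) (δ : ℝ) (s : ℂ) : ℂ :=
  2 * (conjRatio r : ℂ) ^ s * zetaIntegral (tubeFunction K Ω) δ (δ / conjRatio r) s +
    ((n : ℂ) - 1) * (r : ℂ) ^ s * zetaIntegral (tubeFunction K Ω) δ (δ / r) s

end

end VonKoch

namespace VonKoch
noncomputable section

/-! ### Continuous logarithms and the turn of a path -/

/-! The analytic half is short. For `Re s > 2`, substituting the scaling relation into the integral
of `V` gives `moran · ζ̃ = E + ζ̃_R` (`moran_mul_zetaIntegral`). If `R(t) = O(t²)`, then `ζ̃_R` is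
holomorphic in `Re s > 0`, the quotient `(E + ζ̃_R) / moran` is the meromorphic extension, and poles
can only sit at zeros of `moran`. So everything rests on the geometric estimate
`exists_remainder_le`.

To prove it, cut the snowflake into cells: `n` at level 0, each the union of `n + 1` cells of level
1, two of ratio `ℓ` and `n - 1` of ratio `r`. The tube of the snowflake is the union of the tubes of
the cells, and similarities relate the tubes of different cells. Two errors occur: overlaps of
tubes, and places where a similarity does not respect `Ω`. Both stay inside discs of radius `O(t)`
about the end points of the cells, hence have area `O(t²)`, because a cell moves away linearly from
the rest of the loop (`exists_separation`) and, where it is far from the rest, similarities match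
the sides of the cells (`mem_iff_cellMap_mem`).

Linear separation follows by compactness and the `ℓ`-self-similarity about grid points, once the
natural parametrization `loopCurve` is known to be injective modulo its period (`loop_inj`). This is
the heart of the matter, since the hypothesis only says that the set `K` is some simple closed
curve. The tool is the turn (winding number) of a path. The turn of a cell about a point is the
angle of its chord plus a defect; the defect is nonnegative, because the generating polygon exceeds
its chord by the angle sum of a regular polygon, which is nonnegative from every viewpoint. Hence a
closed subloop, which a priori turns equally often about all points of `Ω`, turns at least once
(`one_le_turn_loop`). Rotational symmetry shows that the whole loop turns exactly once
(`turn_period`); a double point would split it into two loops, each turning at least once.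

The planar topology needed (winding number `±1` on a bounded component, `0` elsewhere off the curve,
every point of the curve a limit of points of both kinds) comes from Borsuk's criterion `borsuk` and
Tietze extension. -/

theorem eq_of_isPreconnected_of_int {α : Type*} [TopologicalSpace α] {S : Set α}
    (hS : IsPreconnected S) {f : α → ℝ} (hf : ContinuousOn f S)
    (hint : ∀ x ∈ S, ∃ k : ℤ, f x = k) {x y : α} (hx : x ∈ S) (hy : y ∈ S) : f x = f y := by
  wlog hlt : f x < f y generalizing x y
  · rcases lt_trichotomy (f x) (f y) with h | h | h
    · exact absurd h hlt
    · exact h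
    · exact (this hy hx h).symm
  obtain ⟨k, hk⟩ := hint x hx
  obtain ⟨l, hl⟩ := hint y hy
  have hkl : k < l := by rw [hk, hl] at hlt; exact_mod_cast hlt
  have hkl' : (k : ℝ) + 1 ≤ l := by exact_mod_cast hkl
  obtain ⟨z, hz, hzv⟩ := hS.intermediate_value hx hy hf
    (show (k : ℝ) + 1 / 2 ∈ Icc (f x) (f y) by rw [hk, hl]; constructor <;> linarith)
  obtain ⟨j, hj⟩ := hint z hz
  rw [hj] at hzv
  have h2 : (2 * j : ℝ) = 2 * k + 1 := by linarith
  have h3 : 2 * j = 2 * k + 1 := by exact_mod_cast h2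
  omega

/-- The exponential is a covering of the punctured plane, so maps from a simply connected, locally
path connected space lift through it. -/
theorem exists_continuous_log {X : Type*} [TopologicalSpace X] [SimplyConnectedSpace X]
    [LocallyPathConnectedSpace X] {f : X → ℂ} (hf : Continuous f) (h0 : ∀ x, f x ≠ 0) :
    ∃ g : X → ℂ, Continuous g ∧ ∀ x, Complex.exp (g x) = f x := by
  obtain ⟨x₀⟩ : Nonempty X := inferInstance
  obtain ⟨F, ⟨-, hF⟩, -⟩ := Complex.isCoveringMapOn_exp.existsUnique_continuousMap_lifts
    ⟨f, hf⟩ (a₀ := x₀) (e₀ := Complex.log (f x₀)) (Complex.exp_log (h0 x₀)) (fun x => h0 x)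
  exact ⟨F, F.continuous, fun x => congrFun hF x⟩

theorem exists_log_Icc {f : ℝ → ℂ} {a b : ℝ} (hab : a ≤ b) (hf : ContinuousOn f (Icc a b))
    (h0 : ∀ x ∈ Icc a b, f x ≠ 0) :
    ∃ g : ℝ → ℂ, Continuous g ∧ ∀ x ∈ Icc a b, Complex.exp (g x) = f x := by
  obtain ⟨g, hg, hgf⟩ := exists_continuous_log (f := fun x => f (projIcc a b hab x))
    (hf.comp_continuous (continuous_subtype_val.comp continuous_projIcc)
      (fun x => (projIcc a b hab x).2)) (fun x => h0 _ (projIcc a b hab x).2)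
  refine ⟨g, hg, fun x hx => ?_⟩
  rw [hgf, projIcc_of_mem hab hx]

/-- The number of turns around the origin made by `f` along the interval from `a` to `b`. -/
def turn (f : ℝ → ℂ) (a b : ℝ) : ℝ :=
  open Classical in
  if h : ∃ g : ℝ → ℂ, ContinuousOn g (Icc a b) ∧ ∀ x ∈ Icc a b, Complex.exp (g x) = f x then
    (h.choose b - h.choose a).im / (2 * Real.pi) else 0

theorem exists_int_of_exp_eq {z w : ℂ} (h : Complex.exp z = Complex.exp w) :
    ∃ k : ℤ, z.im / (2 * Real.pi) = w.im / (2 * Real.pi) + k := by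
  obtain ⟨k, hk⟩ := Complex.exp_eq_exp_iff_exists_int.mp h
  refine ⟨k, ?_⟩
  have : z.im = w.im + k * (2 * Real.pi) := by
    rw [hk]; simp
  rw [this]
  field_simp

/-- Two continuous logarithms differ in imaginary part by `2π` times a locally constant integer, so
the choice made in `turn` is immaterial. -/
theorem turn_eq {f g : ℝ → ℂ} {a b : ℝ} (hab : a ≤ b) (hg : ContinuousOn g (Icc a b))
    (hgf : ∀ x ∈ Icc a b, Complex.exp (g x) = f x) :
    turn f a b = (g b - g a).im / (2 * Real.pi) := by
  have h : ∃ g : ℝ → ℂ, ContinuousOn g (Icc a b) ∧ ∀ x ∈ Icc a b, Complex.exp (g x) = f x :=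
    ⟨g, hg, hgf⟩
  rw [turn, dif_pos h]
  obtain ⟨h1, h2⟩ := h.choose_spec
  set g' := h.choose
  have key := eq_of_isPreconnected_of_int (S := Icc a b) isPreconnected_Icc
    (f := fun x => (g' x).im / (2 * Real.pi) - (g x).im / (2 * Real.pi))
    (by
      refine ContinuousOn.sub ?_ ?_
      · exact (Complex.continuous_im.comp_continuousOn h1).div_const _
      · exact (Complex.continuous_im.comp_continuousOn hg).div_const _)
    (fun x hx => by
      obtain ⟨k, hk⟩ := exists_int_of_exp_eq ((h2 x hx).trans (hgf x hx).symm)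
      exact ⟨k, by rw [hk]; ring⟩)
    (left_mem_Icc.mpr hab) (right_mem_Icc.mpr hab)
  simp only [Complex.sub_im, sub_div]
  linarith

theorem turn_congr {f g : ℝ → ℂ} {a b : ℝ} (hab : a ≤ b) (h : EqOn f g (Icc a b)) :
    turn f a b = turn g a b := by
  by_cases hf : ∃ k : ℝ → ℂ, ContinuousOn k (Icc a b) ∧ ∀ x ∈ Icc a b, Complex.exp (k x) = f x
  · obtain ⟨k, hk, hkf⟩ := hf
    rw [turn_eq hab hk hkf, turn_eq hab hk (fun x hx => (hkf x hx).trans (h hx))]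
  · have hg : ¬ ∃ k : ℝ → ℂ, ContinuousOn k (Icc a b) ∧
        ∀ x ∈ Icc a b, Complex.exp (k x) = g x := by
      rintro ⟨k, hk, hkg⟩
      exact hf ⟨k, hk, fun x hx => (hkg x hx).trans (h hx).symm⟩
    rw [turn, turn, dif_neg hf, dif_neg hg]

theorem turn_self (f : ℝ → ℂ) (a : ℝ) : turn f a a = 0 := by
  unfold turn
  split_ifs <;> simp

theorem turn_add {f : ℝ → ℂ} {a b c : ℝ} (hab : a ≤ b) (hbc : b ≤ c)
    (hf : ContinuousOn f (Icc a c)) (h0 : ∀ x ∈ Icc a c, f x ≠ 0) :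
    turn f a b + turn f b c = turn f a c := by
  obtain ⟨g, hg, hgf⟩ := exists_log_Icc (hab.trans hbc) hf h0
  rw [turn_eq hab hg.continuousOn (fun x hx => hgf x ⟨hx.1, hx.2.trans hbc⟩),
    turn_eq hbc hg.continuousOn (fun x hx => hgf x ⟨hab.trans hx.1, hx.2⟩),
    turn_eq (hab.trans hbc) hg.continuousOn hgf]
  simp only [Complex.sub_im]
  ring

theorem turn_sum {f : ℝ → ℂ} {a : ℕ → ℝ} (ha : Monotone a) (m : ℕ)
    (hf : ContinuousOn f (Icc (a 0) (a m))) (h0 : ∀ x ∈ Icc (a 0) (a m), f x ≠ 0) :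
    ∑ i ∈ Finset.range m, turn f (a i) (a (i + 1)) = turn f (a 0) (a m) := by
  induction m with
  | zero => simp [turn_self]
  | succ m ih =>
    have hs : Icc (a 0) (a m) ⊆ Icc (a 0) (a (m + 1)) :=
      Icc_subset_Icc_right (ha (Nat.le_succ m))
    rw [Finset.sum_range_succ, ih (hf.mono hs) (fun x hx => h0 x (hs hx)),
      turn_add (ha (Nat.zero_le m)) (ha (Nat.le_succ m)) hf h0]

theorem turn_mul {f g : ℝ → ℂ} {a b : ℝ} (hab : a ≤ b)
    (hf : ContinuousOn f (Icc a b)) (hf0 : ∀ x ∈ Icc a b, f x ≠ 0)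
    (hg : ContinuousOn g (Icc a b)) (hg0 : ∀ x ∈ Icc a b, g x ≠ 0) :
    turn (fun x => f x * g x) a b = turn f a b + turn g a b := by
  obtain ⟨F, hF, hFf⟩ := exists_log_Icc hab hf hf0
  obtain ⟨G, hG, hGg⟩ := exists_log_Icc hab hg hg0
  rw [turn_eq hab hF.continuousOn hFf, turn_eq hab hG.continuousOn hGg,
    turn_eq (g := fun x => F x + G x) hab (hF.add hG).continuousOn
      (fun x hx => by rw [Complex.exp_add, hFf x hx, hGg x hx])]
  simp only [Complex.sub_im, Complex.add_im]
  ring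

theorem turn_of_slitPlane {f : ℝ → ℂ} {a b : ℝ} (hab : a ≤ b) (hf : ContinuousOn f (Icc a b))
    (h : ∀ x ∈ Icc a b, f x ∈ Complex.slitPlane) :
    turn f a b = ((f b).arg - (f a).arg) / (2 * Real.pi) := by
  rw [turn_eq (g := fun x => Complex.log (f x)) hab
    (fun x hx => (hf x hx).clog (h x hx))
    (fun x hx => Complex.exp_log (Complex.slitPlane_ne_zero (h x hx)))]
  simp [Complex.log_im]

theorem turn_const {c : ℂ} (hc : c ≠ 0) {a b : ℝ} (hab : a ≤ b) :
    turn (fun _ => c) a b = 0 := by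
  rw [turn_eq (g := fun _ => Complex.log c) hab continuousOn_const
    (fun x _ => Complex.exp_log hc)]
  simp

theorem turn_const_mul {f : ℝ → ℂ} {c : ℂ} (hc : c ≠ 0) {a b : ℝ} (hab : a ≤ b)
    (hf : ContinuousOn f (Icc a b)) (hf0 : ∀ x ∈ Icc a b, f x ≠ 0) :
    turn (fun x => c * f x) a b = turn f a b := by
  rw [turn_mul hab continuousOn_const (fun _ _ => hc) hf hf0, turn_const hc hab, zero_add]

theorem turn_of_div_slitPlane {f : ℝ → ℂ} {a b : ℝ} {c : ℂ} (hc : c ≠ 0) (hab : a ≤ b)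
    (hf : ContinuousOn f (Icc a b)) (h : ∀ x ∈ Icc a b, c * f x ∈ Complex.slitPlane) :
    turn f a b = ((c * f b).arg - (c * f a).arg) / (2 * Real.pi) := by
  rw [← turn_const_mul hc hab hf (fun x hx => right_ne_zero_of_mul
    (Complex.slitPlane_ne_zero (h x hx))),
    turn_of_slitPlane (f := fun x => c * f x) hab (continuousOn_const.mul hf) h]

/-- The end points determine a turn up to an integer; in particular a closed path has an integral
turn. -/
theorem exists_turn_eq_arg_add {f : ℝ → ℂ} {a b : ℝ} (hab : a ≤ b) (hf : ContinuousOn f (Icc a b))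
    (h0 : ∀ x ∈ Icc a b, f x ≠ 0) :
    ∃ k : ℤ, turn f a b = (f b / f a).arg / (2 * Real.pi) + k := by
  obtain ⟨g, hg, hgf⟩ := exists_log_Icc hab hf h0
  have ha := left_mem_Icc.mpr hab
  have hb := right_mem_Icc.mpr hab
  rw [turn_eq hab hg.continuousOn hgf, ← Complex.log_im]
  apply exists_int_of_exp_eq
  rw [Complex.exp_sub, hgf _ ha, hgf _ hb, Complex.exp_log (div_ne_zero (h0 _ hb) (h0 _ ha))]

theorem exists_turn_eq_int {f : ℝ → ℂ} {a b : ℝ} (hab : a ≤ b) (hf : ContinuousOn f (Icc a b))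
    (h0 : ∀ x ∈ Icc a b, f x ≠ 0) (h : f a = f b) : ∃ k : ℤ, turn f a b = k := by
  obtain ⟨k, hk⟩ := exists_turn_eq_arg_add hab hf h0
  refine ⟨k, ?_⟩
  rw [hk, h, div_self (h0 _ (right_mem_Icc.mpr hab))]
  simp

theorem turn_comp_affine {f : ℝ → ℂ} {a b m k : ℝ} (hm : 0 < m) (hab : a ≤ b)
    (hf : ContinuousOn f (Icc (m * a + k) (m * b + k)))
    (h0 : ∀ x ∈ Icc (m * a + k) (m * b + k), f x ≠ 0) :
    turn (fun x => f (m * x + k)) a b = turn f (m * a + k) (m * b + k) := by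
  have hab' : m * a + k ≤ m * b + k := by gcongr
  obtain ⟨g, hg, hgf⟩ := exists_log_Icc hab' hf h0
  rw [turn_eq hab' hg.continuousOn hgf, turn_eq (g := fun x => g (m * x + k)) hab
    (by fun_prop) (fun x hx => hgf _ ⟨by have := hx.1; gcongr, by have := hx.2; gcongr⟩)]

/-- A path avoiding a ball around its base point does not see small displacements of that point. -/
theorem turn_sub_continuousOn {f : ℝ → ℂ} {a b : ℝ} (hab : a ≤ b) (hf : ContinuousOn f (Icc a b)) :
    ContinuousOn (fun z => turn (fun x => f x - z) a b) (f '' Icc a b)ᶜ := by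
  intro z hz
  apply ContinuousAt.continuousWithinAt
  have hcl : IsClosed (f '' Icc a b) := (isCompact_Icc.image_of_continuousOn hf).isClosed
  obtain ⟨ε, hε, hball⟩ := Metric.isOpen_iff.mp hcl.isOpen_compl z hz
  have hd : ∀ x ∈ Icc a b, ε ≤ ‖f x - z‖ := by
    intro x hx
    by_contra! hlt
    exact hball (mem_ball_iff_norm.mpr hlt) ⟨x, hx, rfl⟩
  have hne : ∀ x ∈ Icc a b, f x - z ≠ 0 := fun x hx => norm_pos_iff.mp (hε.trans_le (hd x hx))
  have ha := left_mem_Icc.mpr hab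
  have hb := right_mem_Icc.mpr hab
  -- Write `f x - w = (f x - z) (1 - (w - z) / (f x - z))`. For `w` in the ball the second factor
  -- has positive real part, so its turn is a difference of principal arguments, continuous in `w`.
  have hsl : ∀ w ∈ Metric.ball z ε, ∀ x ∈ Icc a b,
      1 - (w - z) / (f x - z) ∈ Complex.slitPlane := by
    intro w hw x hx
    left
    have h1 : ‖(w - z) / (f x - z)‖ < 1 := by
      rw [norm_div, div_lt_one (norm_pos_iff.mpr (hne x hx))]
      exact (mem_ball_iff_norm.mp hw).trans_le (hd x hx)
    have := (Complex.re_le_norm ((w - z) / (f x - z))).trans_lt h1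
    simpa using this
  have key : ∀ w ∈ Metric.ball z ε, turn (fun x => f x - w) a b =
      turn (fun x => f x - z) a b + ((1 - (w - z) / (f b - z)).arg -
        (1 - (w - z) / (f a - z)).arg) / (2 * Real.pi) := by
    intro w hw
    have hc : ContinuousOn (fun x => 1 - (w - z) / (f x - z)) (Icc a b) :=
      continuousOn_const.sub (continuousOn_const.div (hf.sub continuousOn_const) hne)
    rw [← turn_of_slitPlane hab hc (hsl w hw), ← turn_mul (f := fun x => f x - z) hab (hf.sub continuousOn_const) hne hc
      (fun x hx => Complex.slitPlane_ne_zero (hsl w hw x hx))]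
    apply turn_congr hab
    intro x hx
    have := hne x hx
    field_simp
    ring
  have hev : (fun z => turn (fun x => f x - z) a b) =ᶠ[𝓝 z] fun w =>
      turn (fun x => f x - z) a b + ((1 - (w - z) / (f b - z)).arg -
        (1 - (w - z) / (f a - z)).arg) / (2 * Real.pi) := by
    filter_upwards [Metric.ball_mem_nhds z hε] with w hw using key w hw
  refine ContinuousAt.congr ?_ hev.symm
  have harg : ∀ p : ℂ, ContinuousAt (fun w : ℂ => (1 - (w - z) / p).arg) z := by
    intro p
    refine ContinuousAt.comp (g := Complex.arg) ?_ (by fun_prop)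
    simp only [sub_self, zero_div, sub_zero]
    exact Complex.continuousAt_arg (by simp)
  exact continuousAt_const.add (((harg _).sub (harg _)).div_const _)

/-- The turn of a path around a point farther away from the origin than the path. -/
theorem turn_sub_of_norm_le {f : ℝ → ℂ} {a b : ℝ} (hab : a ≤ b) (hf : ContinuousOn f (Icc a b))
    {z : ℂ} (hz : ∀ x ∈ Icc a b, ‖f x‖ ≤ ‖z‖ ∧ f x ≠ z) :
    turn (fun x => f x - z) a b =
      ((1 - f b / z).arg - (1 - f a / z).arg) / (2 * Real.pi) := by
  have hz0 : z ≠ 0 := by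
    rintro rfl
    have := hz a (left_mem_Icc.mpr hab)
    simp_all
  -- After multiplication by `-1 / z` the path lies in the closed unit disc about `1`, which meets
  -- the slit only at `0`, and that value is excluded by `f x ≠ z`.
  have hmul : ∀ x, -z⁻¹ * (f x - z) = 1 - f x / z := by
    intro x; field_simp; ring
  rw [turn_of_div_slitPlane (f := fun x => f x - z) (c := -z⁻¹) (by simp [hz0]) hab (hf.sub continuousOn_const), hmul, hmul]
  intro x hx
  rw [hmul]
  obtain ⟨h1, h2⟩ := hz x hx
  have hle : ‖f x / z‖ ≤ 1 := by
    rw [norm_div]; exact div_le_one_of_le₀ h1 (norm_nonneg _)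
  have hre : (f x / z).re ≤ 1 := (Complex.re_le_norm _).trans hle
  by_cases heq : (f x / z).re = 1
  · exfalso
    have him : (f x / z).im = 0 := by
      have := Complex.sq_norm_sub_sq_re (f x / z)
      rw [heq] at this
      have h3 : ‖f x / z‖ ^ 2 ≤ 1 := by
        have := norm_nonneg (f x / z); nlinarith
      nlinarith [sq_nonneg (f x / z).im]
    have : f x / z = 1 := Complex.ext (by simpa using heq) (by simpa using him)
    exact h2 ((div_eq_one_iff_eq hz0).mp this)
  · left
    have : (f x / z).re < 1 := lt_of_le_of_ne hre heq
    simpa using this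

end
end VonKoch

namespace VonKoch
noncomputable section

/-! ### Simple closed curves in the plane -/

/-- Borsuk's criterion: no continuous logarithm of `x ↦ (x - p) ^ a * f x` on the frontier of a
bounded open set containing `p` exists, unless `a = 0`. -/
theorem borsuk {U : Set ℂ} (hU : Bornology.IsBounded U) {p : ℂ} {a : ℤ}
    (hpU : U ∈ 𝓝 p) {f : ℂ → ℂ} (hf : ContinuousOn f (closure U)) (hf0 : ∀ x ∈ closure U, f x ≠ 0)
    {G : ℂ → ℂ} (hG : Continuous G)
    (hGf : ∀ x ∈ frontier U, Complex.exp (G x) = (x - p) ^ a * f x) : a = 0 := by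
  classical
  have hpc : ∀ x ∈ closure Uᶜ, x - p ≠ 0 := by
    intro x hx h0
    rw [sub_eq_zero.mp h0, closure_compl] at hx
    exact hx (mem_interior_iff_mem_nhds.mpr hpU)
  -- The two formulas agree on the frontier, so `h` is continuous and nowhere zero on the whole
  -- plane and has a logarithm there. But on a large circle `h` is `(x - p) ^ a`, which turns `a`
  -- times.
  set h : ℂ → ℂ := U.piecewise (fun x => Complex.exp (G x) / f x) (fun x => (x - p) ^ a)
  have hcont : Continuous h := by
    refine continuous_piecewise ?_ ?_ ?_
    · intro x hx
      rw [hGf x hx]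
      exact mul_div_cancel_right₀ _ (hf0 x (frontier_subset_closure hx))
    · exact (Complex.continuous_exp.comp hG).continuousOn.div hf hf0
    · intro x hx
      exact ((continuousAt_id.sub continuousAt_const).zpow₀ a
        (Or.inl (hpc x hx))).continuousWithinAt
  have h0 : ∀ x, h x ≠ 0 := by
    intro x
    by_cases hx : x ∈ U
    · simp only [h, piecewise_eq_of_mem _ _ _ hx]
      exact div_ne_zero (Complex.exp_ne_zero _) (hf0 x (subset_closure hx))
    · simp only [h, piecewise_eq_of_notMem _ _ _ hx]
      exact zpow_ne_zero _ (hpc x (subset_closure hx))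
  obtain ⟨H, hH, hHh⟩ := exists_continuous_log hcont h0
  obtain ⟨R, hR0, hR⟩ := hU.subset_ball_lt 0 p
  have hcirc : ∀ θ : ℝ, h (p + R * Complex.exp (2 * Real.pi * θ * Complex.I)) =
      (R * Complex.exp (2 * Real.pi * θ * Complex.I)) ^ a := by
    intro θ
    have : p + R * Complex.exp (2 * Real.pi * θ * Complex.I) ∉ U := by
      intro hmem
      have := hR hmem
      rw [mem_ball_iff_norm, add_sub_cancel_left, norm_mul,
        show (2 * Real.pi * θ * Complex.I : ℂ) = ((2 * Real.pi * θ : ℝ) : ℂ) * Complex.I by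
          push_cast; ring, Complex.norm_exp_ofReal_mul_I] at this
      simp [abs_of_pos hR0] at this
    simp [h, piecewise_eq_of_notMem _ _ _ this]
  have t1 := turn_eq (f := fun θ : ℝ => h (p + R * Complex.exp (2 * Real.pi * θ * Complex.I)))
    (g := fun θ : ℝ => H (p + R * Complex.exp (2 * Real.pi * θ * Complex.I))) zero_le_one
    (by fun_prop) (fun x _ => hHh _)
  have t2 := turn_eq (f := fun θ : ℝ => h (p + R * Complex.exp (2 * Real.pi * θ * Complex.I)))
    (g := fun θ : ℝ => a * (Complex.log R + 2 * Real.pi * θ * Complex.I)) zero_le_one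
    (by fun_prop) (fun x _ => by
      rw [hcirc, Complex.exp_int_mul, Complex.exp_add, Complex.exp_log (by exact_mod_cast hR0.ne')])
  rw [t1] at t2
  have e1 : Complex.exp (2 * Real.pi * ((1 : ℝ) : ℂ) * Complex.I) = 1 := by
    push_cast; rw [mul_one]; exact Complex.exp_two_pi_mul_I
  have e0 : Complex.exp (2 * Real.pi * ((0 : ℝ) : ℂ) * Complex.I) = 1 := by simp
  rw [e1, e0, sub_self, ← mul_sub] at t2
  have t3 : (a : ℝ) = 0 := by
    have : (a * (Complex.log R + 2 * Real.pi * ((1 : ℝ) : ℂ) * Complex.I -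
        (Complex.log R + 2 * Real.pi * ((0 : ℝ) : ℂ) * Complex.I))).im / (2 * Real.pi)
        = (a : ℝ) := by
      simp
    rw [← this, ← t2]
    simp
  exact_mod_cast t3

/-- A parametrization of a simple closed curve by the reals modulo one. -/
structure IsSimpleParam (κ : ℝ → ℂ) : Prop where
  continuous : Continuous κ
  periodic : Function.Periodic κ 1
  inj : ∀ s t, κ s = κ t → ∃ k : ℤ, t = s + k

theorem IsSimpleClosedCurve.exists_param {K : Set ℂ} (hK : IsSimpleClosedCurve K) :
    ∃ κ : ℝ → ℂ, IsSimpleParam κ ∧ range κ = K := by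
  obtain ⟨γ, hγ, hinj, rfl⟩ := hK
  refine ⟨fun s => γ (Circle.exp (2 * Real.pi * s)), ⟨by fun_prop, ?_, ?_⟩, ?_⟩
  · intro s
    simp only [mul_add, mul_one]
    rw [Circle.periodic_exp]
  · intro s t h
    have h2 := hinj h
    obtain ⟨k, hk⟩ := (Circle.exp_eq_exp).mp h2
    refine ⟨-k, ?_⟩
    have : 2 * Real.pi * (s - t - k) = 0 := by linarith
    have := (mul_eq_zero.mp this).resolve_left (by positivity)
    push_cast; linarith
  · ext z
    constructor
    · rintro ⟨s, rfl⟩; exact mem_range_self _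
    · rintro ⟨c, rfl⟩
      refine ⟨Complex.arg c / (2 * Real.pi), ?_⟩
      simp only
      rw [mul_div_cancel₀ _ (by positivity), Circle.exp_arg]

namespace IsSimpleParam

variable {κ : ℝ → ℂ} (hκ : IsSimpleParam κ)
include hκ

theorem add_int (s : ℝ) (k : ℤ) : κ (s + k) = κ s := by
  have := hκ.periodic.int_mul k s
  simpa using this

theorem range_eq (a : ℝ) : range κ = κ '' Icc a (a + 1) := by
  rw [← hκ.periodic.image_Icc one_pos a]

theorem isCompact_range : IsCompact (range κ) := by
  rw [hκ.range_eq 0]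
  exact isCompact_Icc.image hκ.continuous

/-- The curve is a closed embedding of the circle, so a periodic function of the parameter is a
continuous function on the curve and extends to the plane by Tietze. -/
theorem exists_extension_periodic {L : ℝ → ℂ} (hL : Continuous L) (hper : Function.Periodic L 1) :
    ∃ G : ℂ → ℂ, Continuous G ∧ ∀ s, G (κ s) = L s := by
  have : Fact ((0 : ℝ) < 1) := ⟨one_pos⟩
  have hc : Continuous (hκ.periodic.lift : AddCircle (1 : ℝ) → ℂ) :=
    continuous_quot_lift _ hκ.continuous
  have hLc : Continuous (hper.lift : AddCircle (1 : ℝ) → ℂ) := continuous_quot_lift _ hL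
  have hinj : Function.Injective (hκ.periodic.lift : AddCircle (1 : ℝ) → ℂ) := by
    intro x y
    induction x using QuotientAddGroup.induction_on with | H s => ?_
    induction y using QuotientAddGroup.induction_on with | H t => ?_
    intro h
    rw [Function.Periodic.lift_coe, Function.Periodic.lift_coe] at h
    obtain ⟨k, rfl⟩ := hκ.inj s t h
    rw [QuotientAddGroup.eq]
    exact ⟨k, by simp⟩
  obtain ⟨G, hG⟩ := ContinuousMap.exists_extension (hc.isClosedEmbedding hinj) ⟨_, hLc⟩
  refine ⟨G, G.continuous, fun s => ?_⟩
  have := DFunLike.congr_fun hG (s : AddCircle (1 : ℝ))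
  simpa using this

/-- Over less than a full period the curve is a closed embedding of an interval, so here Tietze
needs no periodicity of `L`. -/
theorem exists_extension_arc {L : ℝ → ℂ} (hL : Continuous L) {a b : ℝ} (hb : b < a + 1) :
    ∃ G : ℂ → ℂ, Continuous G ∧ ∀ s ∈ Icc a b, G (κ s) = L s := by
  have hinj : Function.Injective (fun s : Icc a b => κ s) := by
    rintro ⟨s, hs⟩ ⟨t, ht⟩ h
    obtain ⟨k, hk⟩ := hκ.inj s t h
    have h1 : (k : ℝ) < 1 := by linarith [hs.1, ht.2]
    have h2 : (-1 : ℝ) < k := by linarith [ht.1, hs.2]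
    have h1' : k < 1 := by exact_mod_cast h1
    have h2' : -1 < k := by exact_mod_cast h2
    have : k = 0 := by omega
    subst this
    simpa using hk.symm
  have hc : Continuous (fun s : Icc a b => κ s) := hκ.continuous.comp continuous_subtype_val
  obtain ⟨G, hG⟩ := ContinuousMap.exists_extension (hc.isClosedEmbedding hinj)
    ⟨fun s : Icc a b => L s, hL.comp continuous_subtype_val⟩
  refine ⟨G, G.continuous, fun s hs => ?_⟩
  have := DFunLike.congr_fun hG ⟨s, hs⟩
  simpa using this

/-- A continuous logarithm of the curve around a point, and its period. -/
theorem exists_log {z : ℂ} (hz : z ∉ range κ) :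
    ∃ (g : ℝ → ℂ) (d : ℤ), Continuous g ∧ (∀ s, Complex.exp (g s) = κ s - z) ∧
      turn (fun s => κ s - z) 0 1 = d ∧
      ∀ s (k : ℤ), g (s + k) = g s + k * (d * (2 * Real.pi * Complex.I)) := by
  have h0 : ∀ s, κ s - z ≠ 0 := fun s h => hz ⟨s, sub_eq_zero.mp h⟩
  obtain ⟨g, hg, hgκ⟩ := exists_continuous_log (f := fun s => κ s - z)
    (hκ.continuous.sub continuous_const) h0
  have hstep : ∀ s, ∃ k : ℤ, g (s + 1) = g s + k * (2 * Real.pi * Complex.I) := fun s =>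
    Complex.exp_eq_exp_iff_exists_int.mp (by rw [hgκ, hgκ, hκ.periodic s])
  choose k hk using hstep
  have hk' : ∀ s, (g (s + 1) - g s).im / (2 * Real.pi) = k s := by
    intro s
    rw [hk s]
    simp
  have hconst : ∀ s, k s = k 0 := by
    intro s
    have := eq_of_isPreconnected_of_int (isPreconnected_univ (α := ℝ))
      (f := fun s => (g (s + 1) - g s).im / (2 * Real.pi))
      (by
        apply Continuous.continuousOn
        exact (Complex.continuous_im.comp (by fun_prop)).div_const _)
      (fun x _ => ⟨k x, hk' x⟩) (mem_univ s) (mem_univ 0)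
    simp only [hk'] at this
    exact_mod_cast this
  refine ⟨g, k 0, hg, hgκ, ?_, ?_⟩
  · rw [turn_eq zero_le_one hg.continuousOn (fun x _ => hgκ x), ← hk']
    simp
  · intro s j
    induction j using Int.induction_on with
    | zero => simp
    | succ i ih =>
      have := hk (s + (i : ℤ))
      rw [hconst, ih] at this
      push_cast at this ⊢
      rw [← add_assoc, this]; ring
    | pred i ih =>
      have := hk (s + ((-(i : ℤ) - 1 : ℤ) : ℝ))
      rw [hconst] at this
      push_cast at this ih ⊢
      rw [show s + (-(i : ℝ) - 1) + 1 = s + -(i : ℝ) by ring, ih] at this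
      linear_combination -this

/-- A closed path inside a simple closed curve winds around every point a multiple of the number
of times the curve does. -/
theorem turn_comp {z : ℂ} (hz : z ∉ range κ) {u : ℝ → ℝ} (hu : Continuous u) {a b : ℝ}
    (hab : a ≤ b) {m : ℤ} (hm : u b = u a + m) :
    turn (fun s => κ (u s) - z) a b = m * turn (fun s => κ s - z) 0 1 := by
  obtain ⟨g, d, hg, hgκ, hd, hstep⟩ := hκ.exists_log hz
  rw [hd, turn_eq (g := fun s => g (u s)) hab (hg.comp hu).continuousOn (fun x _ => hgκ (u x)),
    hm, hstep]
  simp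
  field_simp

/-- The winding number of a simple closed curve is at most one in absolute value. -/
theorem natAbs_turn_le_one {p : ℂ} (hp : p ∉ range κ) {d : ℤ}
    (hd : turn (fun s => κ s - p) 0 1 = d) : d.natAbs ≤ 1 := by
  by_contra! he
  obtain ⟨g, d', hg, hgκ, hd', hstep⟩ := hκ.exists_log hp
  have hdd : d' = d := by exact_mod_cast hd'.symm.trans hd
  subst hdd
  set e : ℕ := d'.natAbs with hedef
  have he0 : (e : ℂ) ≠ 0 := by
    have : e ≠ 0 := by omega
    exact_mod_cast this
  -- With `e = |d| ≥ 2`, `q` is a continuous `e`-th root of `κ - p`. It is closed because `e`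
  -- divides the winding number, and it turns `σ = ±1` times about `0`. Simplicity of `κ` makes the
  -- trace of `q` disjoint from its rotation by the root of unity `ζ`. The contradiction is that
  -- this disjointness forces the turn of `q` about `0` to vanish.
  set q : ℝ → ℂ := fun s => Complex.exp (g s / e) with hq
  have hqc : Continuous q := by fun_prop
  have hq0 : ∀ s, q s ≠ 0 := fun s => Complex.exp_ne_zero _
  have hqpow : ∀ s, q s ^ e = κ s - p := by
    intro s
    rw [hq, ← Complex.exp_nat_mul, mul_div_cancel₀ _ he0, hgκ]
  obtain ⟨σ, hσ⟩ : ∃ σ : ℤ, d' = e * σ := ⟨d'.sign, by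
    rw [mul_comm]; exact (Int.sign_mul_natAbs d').symm⟩
  have hσ' : (d' : ℂ) = e * σ := by exact_mod_cast congrArg (Int.cast : ℤ → ℂ) hσ
  have hgint : ∀ s (k : ℤ), g (s + k) / e = g s / e + (k * σ : ℤ) * (2 * Real.pi * Complex.I) := by
    intro s k
    rw [hstep, hσ']
    push_cast
    field_simp
  have hqper : ∀ s (k : ℤ), q (s + k) = q s := by
    intro s k
    rw [hq]
    simp only
    rw [hgint, Complex.exp_add, Complex.exp_int_mul_two_pi_mul_I, mul_one]
  set ζ : ℂ := Complex.exp (2 * Real.pi * Complex.I / e) with hζ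
  have hprim : IsPrimitiveRoot ζ e := Complex.isPrimitiveRoot_exp e (by omega)
  have hζ1 : ζ ≠ 1 := hprim.ne_one (by omega)
  have hζn : ‖ζ‖ = 1 := hprim.norm'_eq_one (by omega)
  have hζ0 : ζ ≠ 0 := by rw [← norm_pos_iff, hζn]; exact one_pos
  have hdisj : ∀ s t, q s ≠ ζ * q t := by
    intro s t h
    have h1 : κ s = κ t := by
      have := congrArg (· ^ e) h
      simp only [mul_pow, hprim.pow_eq_one, one_mul, hqpow] at this
      exact sub_left_injective this
    obtain ⟨k, rfl⟩ := hκ.inj s t h1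
    rw [hqper] at h
    have : (ζ - 1) * q s = 0 := by linear_combination -h
    rcases mul_eq_zero.mp this with h | h
    · exact hζ1 (sub_eq_zero.mp h)
    · exact hq0 s h
  set J := q '' Icc 0 1 with hJ
  have hclosed : q 0 = q 1 := by
    have := hqper 0 1
    simpa using this.symm
  set F : ℂ → ℝ := fun w => turn (fun s => q s - w) 0 1 with hF
  have hFc : ContinuousOn F Jᶜ := turn_sub_continuousOn zero_le_one hqc.continuousOn
  have hFint : ∀ w ∈ Jᶜ, ∃ k : ℤ, F w = k := fun w hw =>
    exists_turn_eq_int zero_le_one (hqc.sub continuous_const).continuousOn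
      (fun x hx h => hw ⟨x, hx, sub_eq_zero.mp h⟩) (by simp [hclosed])
  have hζJ : ∀ s, ζ⁻¹ * q s ∈ Jᶜ := by
    rintro s ⟨t, -, ht⟩
    apply hdisj s t
    rw [ht, mul_inv_cancel_left₀ hζ0]
  obtain ⟨sM, -, hM⟩ := isCompact_Icc.exists_isMaxOn (nonempty_Icc.mpr (zero_le_one (α := ℝ)))
    (continuous_norm.comp hqc).continuousOn
  obtain ⟨sm, -, hmin⟩ := isCompact_Icc.exists_isMinOn (nonempty_Icc.mpr (zero_le_one (α := ℝ)))
    (continuous_norm.comp hqc).continuousOn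
  have hnorm : ∀ s, ‖ζ⁻¹ * q s‖ = ‖q s‖ := by
    intro s; rw [norm_mul, norm_inv, hζn]; simp
  -- The point of the rotated trace farthest from `0` is at least as far away as all of `J`, so `q`
  -- does not turn about it. As the rotated trace is connected and misses `J`, the same holds at its
  -- point nearest to `0`.
  have f1 : F (ζ⁻¹ * q sM) = 0 := by
    rw [hF]
    simp only
    rw [turn_sub_of_norm_le zero_le_one hqc.continuousOn, hclosed]
    · simp
    · intro x hx
      refine ⟨by rw [hnorm]; exact hM hx, fun h => hζJ sM ⟨x, hx, h⟩⟩
  have f2 : F (ζ⁻¹ * q sm) = 0 := by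
    rw [← f1]
    refine eq_of_isPreconnected_of_int (S := range fun s => ζ⁻¹ * q s)
      (isPreconnected_range (by fun_prop)) (hFc.mono ?_) ?_ ⟨sm, rfl⟩ ⟨sM, rfl⟩
    · rintro _ ⟨s, rfl⟩; exact hζJ s
    · rintro _ ⟨s, rfl⟩; exact hFint _ (hζJ s)
  -- No point of `J` is closer to `0` than `q sm`, so the segment from `0` to the nearest point of
  -- the rotated trace misses `J` and carries the turn zero to the origin.
  have hseg : ∀ w ∈ segment ℝ 0 (ζ⁻¹ * q sm), w ∈ Jᶜ := by
    intro w hw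
    rw [segment_eq_image'] at hw
    obtain ⟨θ, hθ, rfl⟩ := hw
    rcases eq_or_lt_of_le hθ.2 with h1 | h1
    · simp only [h1, zero_add, sub_zero, one_smul]; exact hζJ sm
    · rintro ⟨t, ht, hte⟩
      simp only at hte
      have h2 : ‖q sm‖ ≤ ‖q t‖ := hmin ht
      rw [hte, zero_add, sub_zero, norm_smul, hnorm, Real.norm_of_nonneg hθ.1] at h2
      have := norm_pos_iff.mpr (hq0 sm)
      nlinarith
  have f3 : F 0 = 0 := by
    rw [← f2]
    exact eq_of_isPreconnected_of_int (convex_segment 0 (ζ⁻¹ * q sm)).isPreconnected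
      (hFc.mono hseg) (fun w hw => hFint w (hseg w hw)) (left_mem_segment ..)
      (right_mem_segment ..)
  have f4 : F 0 = σ := by
    rw [hF]
    simp only [sub_zero]
    rw [turn_eq (g := fun s => g s / e) zero_le_one (by fun_prop) (fun x _ => rfl)]
    have := hgint 0 1
    simp only [Int.cast_one, zero_add, one_mul] at this
    rw [this]
    simp
  have hσ0 : σ = 0 := by exact_mod_cast f4.symm.trans f3
  rw [hσ0] at hσ
  have : d' = 0 := by simpa using hσ
  simp [hedef, this] at he

end IsSimpleParam
end
end VonKoch

namespace VonKoch
noncomputable section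

/-! ### Winding numbers about a bounded complementary component, and its frontier. -/

namespace IsBoundedComponent

variable {K Ω : Set ℂ} (h : IsBoundedComponent K Ω)
include h

theorem isBounded : Bornology.IsBounded Ω := h.2

theorem isPreconnected : IsPreconnected Ω := by
  obtain ⟨⟨x, hx, rfl⟩, -⟩ := h
  exact isPreconnected_connectedComponentIn

theorem nonempty : Ω.Nonempty := by
  obtain ⟨⟨x, hx, rfl⟩, -⟩ := h
  exact ⟨x, mem_connectedComponentIn hx⟩

theorem subset_compl : Ω ⊆ Kᶜ := by
  obtain ⟨⟨x, hx, rfl⟩, -⟩ := h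
  exact connectedComponentIn_subset _ _

theorem isOpen (hK : IsClosed K) : IsOpen Ω := by
  obtain ⟨⟨x, hx, rfl⟩, -⟩ := h
  exact hK.isOpen_compl.connectedComponentIn

/-- A point off `K` has an open component in the complement; if the point is in the closure of `Ω`,
this component meets `Ω` and therefore equals it. -/
theorem closure_subset (hK : IsClosed K) : closure Ω ⊆ K ∪ Ω := by
  intro y hy
  by_contra hn
  have hyK : y ∉ K := fun hk => hn (Or.inl hk)
  have hyΩ : y ∉ Ω := fun hk => hn (Or.inr hk)
  obtain ⟨⟨x, hx, rfl⟩, -⟩ := h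
  have ho : IsOpen (connectedComponentIn Kᶜ y) := hK.isOpen_compl.connectedComponentIn
  obtain ⟨z, hz1, hz2⟩ := mem_closure_iff.mp hy _ ho (mem_connectedComponentIn hyK)
  have e1 := connectedComponentIn_eq hz1
  have e2 := connectedComponentIn_eq hz2
  apply hyΩ
  rw [e2, ← e1]
  exact mem_connectedComponentIn hyK

theorem frontier_subset (hK : IsClosed K) : frontier Ω ⊆ K := by
  intro y hy
  rw [(h.isOpen hK).frontier_eq] at hy
  exact (h.closure_subset hK hy.1).resolve_right hy.2

end IsBoundedComponent

namespace IsSimpleParam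

variable {κ : ℝ → ℂ} (hκ : IsSimpleParam κ)
include hκ

/-- A bounded open set cannot have its frontier inside a proper arc of a simple closed curve,
if it contains a point off the curve. -/
theorem not_frontier_subset_arc {U : Set ℂ} (hU : IsOpen U) (hUb : Bornology.IsBounded U)
    {p : ℂ} (hp : p ∈ U) (hpK : p ∉ range κ) {y : ℂ} (hy : y ∈ range κ) {ε : ℝ} (hε : 0 < ε) :
    ¬ frontier U ⊆ range κ \ Metric.ball y ε := by
  intro hfr
  obtain ⟨s₀, rfl⟩ := hy
  obtain ⟨η, hη, hball⟩ := Metric.continuous_iff.mp hκ.continuous s₀ ε hε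
  obtain ⟨g, d, hg, hgκ, -, -⟩ := hκ.exists_log hpK
  -- The part of the curve outside the ball lies over `[s₀ + η, s₀ + 1 - η]`. Over such an arc the
  -- logarithm `g` of `x - p` extends to the plane whatever its period, so Borsuk's criterion with
  -- `a = 1` applies.
  obtain ⟨G, hG, hGg⟩ := hκ.exists_extension_arc hg
    (show s₀ + 1 - η < s₀ + η + 1 by linarith)
  have := borsuk (a := 1) (f := fun _ => 1) hUb (hU.mem_nhds hp)
    continuousOn_const (fun _ _ => one_ne_zero) hG (by
      intro x hx
      obtain ⟨hxK, hxb⟩ := hfr hx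
      rw [hκ.range_eq s₀] at hxK
      obtain ⟨s, hs, rfl⟩ := hxK
      have h1 : η ≤ s - s₀ := by
        by_contra! hlt
        exact hxb (hball s (by rw [Real.dist_eq, abs_of_nonneg] <;> linarith [hs.1]))
      have h2 : s ≤ s₀ + 1 - η := by
        by_contra! hlt
        apply hxb
        have h3 := hball (s - 1) (by rw [Real.dist_eq, abs_of_nonpos] <;> linarith [hs.2])
        have h4 := hκ.periodic (s - 1)
        rw [sub_add_cancel] at h4
        rw [h4]
        exact h3
      rw [hGg s ⟨by linarith, h2⟩, hgκ]; simp)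
  exact one_ne_zero this

/-- A path in the curve, followed in the parameter. -/
theorem exists_param_lift {Γ : ℝ → ℂ} (hΓ : Continuous Γ) (hr : range Γ ⊆ range κ) :
    ∃ u : ℝ → ℝ, Continuous u ∧ ∀ t, Γ t = κ (u t) := by
  -- `E` recovers `exp (2π i s)` from the point `κ s`. A logarithm of `E ∘ Γ` then gives the
  -- parameter up to an integer.
  obtain ⟨E, hE, hEκ⟩ := hκ.exists_extension_periodic
    (L := fun s => Complex.exp (s * (2 * Real.pi * Complex.I))) (by fun_prop) (fun s => by
      simp only [Complex.ofReal_add, Complex.ofReal_one, add_mul, one_mul, Complex.exp_add,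
        Complex.exp_two_pi_mul_I, mul_one])
  have hs : ∀ t, ∃ s, κ s = Γ t := fun t => hr (mem_range_self t)
  obtain ⟨g, hg, hgE⟩ := exists_continuous_log (f := fun t => E (Γ t)) (hE.comp hΓ) (fun t => by
    obtain ⟨s, hs⟩ := hs t
    rw [← hs, hEκ]
    exact Complex.exp_ne_zero _)
  refine ⟨fun t => (g t).im / (2 * Real.pi), (Complex.continuous_im.comp hg).div_const _,
    fun t => ?_⟩
  obtain ⟨s, hs⟩ := hs t
  obtain ⟨k, hk⟩ := exists_int_of_exp_eq ((hgE t).trans ((congrArg E hs).symm.trans (hEκ s)))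
  simp only
  rw [hk, ← hs, hκ.add_int]
  congr 1
  simp

variable {Ω : Set ℂ} (hΩ : IsBoundedComponent (range κ) Ω)
include hΩ

/-- If the winding number were zero, the logarithm of `κ - p` would be periodic and extend to the
plane, against Borsuk's criterion with `a = 1`. -/
theorem turn_ne_zero {p : ℂ} (hp : p ∈ Ω) : turn (fun s => κ s - p) 0 1 ≠ 0 := by
  intro h0
  have hK := hκ.isCompact_range.isClosed
  obtain ⟨g, d, hg, hgκ, hd, hstep⟩ := hκ.exists_log (hΩ.subset_compl hp)
  have hd0 : d = 0 := by exact_mod_cast hd.symm.trans h0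
  obtain ⟨G, hG, hGg⟩ := hκ.exists_extension_periodic hg (fun s => by
    have := hstep s 1
    simpa [hd0] using this)
  have := borsuk (a := 1) (f := fun _ => 1) hΩ.isBounded ((hΩ.isOpen hK).mem_nhds hp)
    continuousOn_const (fun _ _ => one_ne_zero) hG (by
      intro x hx
      obtain ⟨s, rfl⟩ := hΩ.frontier_subset hK hx
      rw [hGg, hgκ]; simp)
  exact one_ne_zero this

/-- For `p ∈ Ω` with winding number `d`, and `d'` that of `q`, the logarithm `d' g - d g'` of `(x -
p) ^ d' (x - q) ^ (-d)` is periodic. The second factor has no zero on the closure of `Ω`, so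
Borsuk's criterion gives `d' = 0`. -/
theorem turn_eq_zero {q : ℂ} (hqK : q ∉ range κ) (hqΩ : q ∉ Ω) :
    turn (fun s => κ s - q) 0 1 = 0 := by
  have hK := hκ.isCompact_range.isClosed
  obtain ⟨p, hp⟩ := hΩ.nonempty
  obtain ⟨g, d, hg, hgκ, hd, hstep⟩ := hκ.exists_log (hΩ.subset_compl hp)
  obtain ⟨g', d', hg', hgκ', hd', hstep'⟩ := hκ.exists_log hqK
  have hne : ∀ x ∈ closure Ω, x - q ≠ 0 := by
    intro x hx h0
    rw [sub_eq_zero.mp h0] at hx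
    rcases hΩ.closure_subset hK hx with h | h
    exacts [hqK h, hqΩ h]
  obtain ⟨G, hG, hGg⟩ := hκ.exists_extension_periodic (L := fun s => d' * g s + (-d : ℤ) * g' s)
    (by fun_prop) (fun s => by
      have h1 := hstep s 1
      have h2 := hstep' s 1
      simp only [Int.cast_one] at h1 h2
      simp only [h1, h2]
      push_cast; ring)
  have := borsuk (a := d') (f := fun x => (x - q) ^ (-d)) hΩ.isBounded
    ((hΩ.isOpen hK).mem_nhds hp)
    ((continuousOn_id.sub continuousOn_const).zpow₀ _ (fun x hx => Or.inl (hne x hx)))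
    (fun x hx => zpow_ne_zero _ (hne x hx)) hG (by
      intro x hx
      obtain ⟨s, rfl⟩ := hΩ.frontier_subset hK hx
      rw [hGg, Complex.exp_add, Complex.exp_int_mul, Complex.exp_int_mul, hgκ, hgκ'])
  rw [hd', this]
  simp

/-- The winding number of a simple closed curve about the points of a bounded component of its
complement is `1` or `-1`, and it vanishes elsewhere. -/
theorem exists_winding : ∃ d : ℤ, (d = 1 ∨ d = -1) ∧
    (∀ z ∈ Ω, turn (fun s => κ s - z) 0 1 = d) ∧
    ∀ z ∉ range κ, z ∉ Ω → turn (fun s => κ s - z) 0 1 = 0 := by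
  have hint : ∀ z ∈ Ω, ∃ k : ℤ, turn (fun s => κ s - z) 0 1 = k := by
    intro z hz
    obtain ⟨-, d, -, -, hd, -⟩ := hκ.exists_log (hΩ.subset_compl hz)
    exact ⟨d, hd⟩
  obtain ⟨p, hp⟩ := hΩ.nonempty
  obtain ⟨d, hd⟩ := hint p hp
  have h1 := hκ.natAbs_turn_le_one (hΩ.subset_compl hp) hd
  have h2 : d ≠ 0 := by
    rintro rfl
    exact hκ.turn_ne_zero hΩ hp (by simpa using hd)
  refine ⟨d, by omega, fun z hz => ?_, fun z hz hzΩ => hκ.turn_eq_zero hΩ hz hzΩ⟩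
  rw [← hd]
  refine eq_of_isPreconnected_of_int (f := fun z => turn (fun s => κ s - z) 0 1)
    hΩ.isPreconnected ?_ hint hz hp
  refine (turn_sub_continuousOn zero_le_one hκ.continuous.continuousOn).mono fun z hz h => ?_
  exact hΩ.subset_compl hz (image_subset_range _ _ h)

/-- Otherwise the frontier of `Ω` would stay in the curve minus a ball, hence in a proper arc. -/
theorem exists_mem_ball_inside {y : ℂ} (hy : y ∈ range κ) {ε : ℝ} (hε : 0 < ε) :
    (Metric.ball y ε ∩ Ω).Nonempty := by
  by_contra hn
  have hK := hκ.isCompact_range.isClosed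
  obtain ⟨p, hp⟩ := hΩ.nonempty
  refine hκ.not_frontier_subset_arc (hΩ.isOpen hK) hΩ.isBounded hp (hΩ.subset_compl hp) hy hε ?_
  intro x hx
  refine ⟨hΩ.frontier_subset hK hx, fun hxb => hn ?_⟩
  exact mem_closure_iff.mp (frontier_subset_closure hx) _ Metric.isOpen_ball hxb

/-- If the ball were covered by the curve and `Ω`, then `Ω` enlarged by the ball would be a bounded
open set with frontier in a proper arc. -/
theorem exists_mem_ball_outside {y : ℂ} (hy : y ∈ range κ) {ε : ℝ} (hε : 0 < ε) :
    (Metric.ball y ε ∩ (range κ ∪ Ω)ᶜ).Nonempty := by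
  by_contra hn
  have hK := hκ.isCompact_range.isClosed
  have hsub : Metric.ball y ε ⊆ range κ ∪ Ω := by
    intro x hx
    by_contra hxn
    exact hn ⟨x, hx, hxn⟩
  obtain ⟨p, hp⟩ := hΩ.nonempty
  have hU : IsOpen (Ω ∪ Metric.ball y ε) := (hΩ.isOpen hK).union Metric.isOpen_ball
  refine hκ.not_frontier_subset_arc hU
    (hΩ.isBounded.union Metric.isBounded_ball) (Or.inl hp) (hΩ.subset_compl hp) hy hε ?_
  intro x hx
  rw [hU.frontier_eq] at hx
  obtain ⟨hxc, hxn⟩ := hx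
  refine ⟨?_, fun hb => hxn (Or.inr hb)⟩
  rw [closure_union] at hxc
  have hcl : closure (Metric.ball y ε) ⊆ range κ ∪ Ω := by
    refine (closure_mono hsub).trans ?_
    rw [closure_union, hK.closure_eq]
    exact union_subset subset_union_left (hΩ.closure_subset hK)
  rcases hxc with h | h
  · exact (hΩ.closure_subset hK h).resolve_right fun h => hxn (Or.inl h)
  · exact (hcl h).resolve_right fun h => hxn (Or.inl h)

end IsSimpleParam
end
end VonKoch

namespace VonKoch
noncomputable section

/-! ### Self-similar curves -/

/-- The affine map carrying `0` to `p` and `1` to `q`. -/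
def affineTo (p q z : ℂ) : ℂ := p + (q - p) * z

@[simp] theorem affineTo_zero (p q : ℂ) : affineTo p q 0 = p := by simp [affineTo]

@[simp] theorem affineTo_one (p q : ℂ) : affineTo p q 1 = q := by simp [affineTo]

theorem affineTo_comp (p q s t z : ℂ) :
    affineTo p q (affineTo s t z) = affineTo (affineTo p q s) (affineTo p q t) z := by
  simp only [affineTo]; ring

theorem dist_affineTo (p q z w : ℂ) :
    dist (affineTo p q z) (affineTo p q w) = ‖q - p‖ * dist z w := by
  simp only [affineTo, dist_eq_norm]
  rw [← norm_mul]; ring_nf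

/-- The vertices `0 = p 0, p 1, …, p b = 1` of a polygonal path whose edges are shorter than one. -/
structure IsGenerator (b : ℕ) (p : ℕ → ℂ) (ρ : ℝ) : Prop where
  zero : p 0 = 0
  last : p b = 1
  pos : 0 < b
  nonneg : 0 ≤ ρ
  lt_one : ρ < 1
  norm_le : ∀ i < b, ‖p (i + 1) - p i‖ ≤ ρ

/-- `γ` is the self-similar curve generated by the polygonal path with vertices `p`. -/
structure IsSelfSimilarCurve (b : ℕ) (p : ℕ → ℂ) (γ : ℝ → ℂ) : Prop where
  continuous : Continuous γ
  left : ∀ x ≤ 0, γ x = 0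
  right : ∀ x, 1 ≤ x → γ x = 1
  piece : ∀ i < b, ∀ x ∈ Icc (0 : ℝ) 1, γ ((i + x) / b) = affineTo (p i) (p (i + 1)) (γ x)

open scoped BoundedContinuousFunction in
/-- The refinement operator, of which the self-similar curve is the fixed point. -/
def refine (b : ℕ) (p : ℕ → ℂ) (f : ℝ →ᵇ ℂ) : ℝ →ᵇ ℂ :=
  ∑ i ∈ Finset.range b, (p (i + 1) - p i) • f.compContinuous ⟨fun x : ℝ => b * x - i, by fun_prop⟩

open scoped BoundedContinuousFunction in
theorem refine_apply (b : ℕ) (p : ℕ → ℂ) (f : ℝ →ᵇ ℂ) (x : ℝ) :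
    refine b p f x = ∑ i ∈ Finset.range b, (p (i + 1) - p i) * f (b * x - i) := by
  simp [refine, BoundedContinuousFunction.sum_apply]

/-- Steps before the `i`-th are completed and telescope to `p i`, the `i`-th is in progress, and
later ones have not begun. -/
theorem sum_steps {p : ℕ → ℂ} {f : ℝ → ℂ} (h0 : ∀ x ≤ 0, f x = 0) (h1 : ∀ x, 1 ≤ x → f x = 1)
    (hp : p 0 = 0) {i m : ℕ} (him : i < m) {x : ℝ} (hx : x ∈ Icc (0 : ℝ) 1) :
    ∑ j ∈ Finset.range m, (p (j + 1) - p j) * f (i + x - j) = affineTo (p i) (p (i + 1)) (f x) := by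
  induction m, him using Nat.le_induction with
  | base =>
    rw [Finset.sum_range_succ, add_sub_cancel_left, affineTo]
    congr 1
    rw [Finset.sum_congr rfl (g := fun j => p (j + 1) - p j), Finset.sum_range_sub, hp, sub_zero]
    intro j hj
    have : (j : ℝ) + 1 ≤ i := by exact_mod_cast Finset.mem_range.mp hj
    rw [h1 _ (by linarith [hx.1]), mul_one]
  | succ m hm ih =>
    have : (i : ℝ) + 1 ≤ m := by exact_mod_cast hm
    rw [Finset.sum_range_succ, ih, h0 (i + x - m) (by linarith [hx.2]), mul_zero, add_zero]

open scoped BoundedContinuousFunction in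
-- The curve is the fixed point of `refine` on the closed set of bounded continuous functions that
-- are `0` left of `0` and `1` right of `1`.
theorem IsGenerator.exists_curve {b : ℕ} {p : ℕ → ℂ} {ρ : ℝ} (h : IsGenerator b p ρ) :
    ∃ γ : ℝ → ℂ, IsSelfSimilarCurve b p γ := by
  have hb : (0 : ℝ) < b := by exact_mod_cast h.pos
  set S : Set (ℝ →ᵇ ℂ) := {f | (∀ x ≤ 0, f x = 0) ∧ ∀ x, 1 ≤ x → f x = 1} with hS
  have hclosed : IsClosed S := by
    rw [hS, ofPred_and]
    refine IsClosed.inter ?_ ?_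
    · simp only [ofPred_forall]
      exact isClosed_iInter fun x => isClosed_iInter fun _ =>
        isClosed_eq ((BoundedContinuousFunction.lipschitz_eval_const x).continuous) continuous_const
    · simp only [ofPred_forall]
      exact isClosed_iInter fun x => isClosed_iInter fun _ =>
        isClosed_eq ((BoundedContinuousFunction.lipschitz_eval_const x).continuous) continuous_const
  have hmaps : MapsTo (refine b p) S S := by
    rintro f ⟨hf0, hf1⟩
    refine ⟨fun x hx => ?_, fun x hx => ?_⟩
    · rw [refine_apply]
      refine Finset.sum_eq_zero fun i _ => ?_
      have : b * x ≤ 0 := mul_nonpos_of_nonneg_of_nonpos hb.le hx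
      rw [hf0 _ (by have : (0 : ℝ) ≤ i := i.cast_nonneg; linarith), mul_zero]
    · rw [refine_apply, Finset.sum_congr rfl (g := fun j => p (j + 1) - p j), Finset.sum_range_sub,
        h.last, h.zero, sub_zero]
      intro i hi
      have : (i : ℝ) + 1 ≤ b := by exact_mod_cast Finset.mem_range.mp hi
      have : (b : ℝ) ≤ b * x := le_mul_of_one_le_right hb.le hx
      rw [hf1 _ (by linarith), mul_one]
  have hcontr : ContractingWith ⟨ρ, h.nonneg⟩ (hmaps.restrict (refine b p) S S) := by
    refine ⟨by exact_mod_cast h.lt_one, LipschitzWith.of_dist_le_mul ?_⟩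
    rintro ⟨f, hf0, hf1⟩ ⟨g, hg0, hg1⟩
    change dist (refine b p f) (refine b p g) ≤ ρ * dist f g
    rw [BoundedContinuousFunction.dist_le (mul_nonneg h.nonneg dist_nonneg)]
    intro x
    rw [refine_apply, refine_apply, dist_eq_norm, ← Finset.sum_sub_distrib]
    simp only [← mul_sub]
    -- Two functions in `S` agree outside the unit interval, so at each `x` a single summand
    -- differs. This is why the contraction constant is the largest edge length and not their sum.
    have hne : ∀ i : ℕ, i ≠ ⌊(b : ℝ) * x⌋₊ → f (b * x - i) - g (b * x - i) = 0 := by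
      intro i hi
      rcases lt_or_gt_of_ne hi with hlt | hgt
      · have h1 : ((i + 1 : ℕ) : ℝ) ≤ b * x :=
          (Nat.le_floor_iff' (Nat.succ_ne_zero i)).mp hlt
        push_cast at h1
        rw [hf1 _ (by linarith), hg1 _ (by linarith), sub_self]
      · have h1 : (b : ℝ) * x < i := Nat.lt_of_floor_lt hgt
        rw [hf0 _ (by linarith), hg0 _ (by linarith), sub_self]
    by_cases hmem : ⌊(b : ℝ) * x⌋₊ ∈ Finset.range b
    · rw [Finset.sum_eq_single_of_mem _ hmem (fun i _ hi => by rw [hne i hi, mul_zero]), norm_mul]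
      refine mul_le_mul (h.norm_le _ (Finset.mem_range.mp hmem)) ?_ (norm_nonneg _) h.nonneg
      rw [← dist_eq_norm]
      exact BoundedContinuousFunction.dist_coe_le_dist _
    · rw [Finset.sum_eq_zero (fun i hi => by
        rw [hne i (fun he => hmem (he ▸ hi)), mul_zero]), norm_zero]
      exact mul_nonneg h.nonneg dist_nonneg
  let f₀ : ℝ →ᵇ ℂ := BoundedContinuousFunction.ofNormedAddCommGroup
    (fun x : ℝ => ((max 0 (min x 1) : ℝ) : ℂ)) (by fun_prop) 1 (fun x => by
      rw [Complex.norm_real, Real.norm_of_nonneg (le_max_left _ _)]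
      exact max_le zero_le_one (min_le_right _ _))
  have hf₀ : f₀ ∈ S := by
    refine ⟨fun x hx => ?_, fun x hx => ?_⟩
    · change ((max 0 (min x 1) : ℝ) : ℂ) = 0
      rw [max_eq_left ((min_le_left _ _).trans hx)]; simp
    · change ((max 0 (min x 1) : ℝ) : ℂ) = 1
      rw [min_eq_right hx]; simp
  obtain ⟨γ, ⟨hγ0, hγ1⟩, hfix, -⟩ := hcontr.exists_fixedPoint' hclosed.isComplete hmaps hf₀
    (edist_ne_top _ _)
  refine ⟨γ, γ.continuous, hγ0, hγ1, fun i hi x hx => ?_⟩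
  have h1 : refine b p γ = γ := hfix
  rw [← h1, refine_apply, mul_div_cancel₀ _ hb.ne', sum_steps hγ0 hγ1 h.zero hi hx, h1]

/-- Uniqueness of the attractor. -/
theorem attractor_subset {b : ℕ} {T : ℕ → ℂ → ℂ} {ρ : ℝ} (hρ : ρ < 1) (hρ0 : 0 ≤ ρ)
    (hT : ∀ i < b, ∀ z w, dist (T i z) (T i w) ≤ ρ * dist z w)
    {A B : Set ℂ} (hA : IsCompact A) (hA1 : A ⊆ ⋃ i ∈ Finset.range b, T i '' A)
    (hB : IsCompact B) (hBn : B.Nonempty) (hB1 : (⋃ i ∈ Finset.range b, T i '' B) ⊆ B) : A ⊆ B := by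
  rcases A.eq_empty_or_nonempty with rfl | hAn
  · exact empty_subset _
  -- A point of `A` farthest from `B` is the image of a point of `A` under one contraction, so its
  -- distance is at most `ρ` times the maximal one and must vanish.
  obtain ⟨x₀, hx₀, hmax⟩ := hA.exists_isMaxOn hAn
    (Metric.continuous_infDist_pt B).continuousOn
  obtain ⟨i, hi, x₁, hx₁, hx⟩ : ∃ i ∈ Finset.range b, ∃ x ∈ A, T i x = x₀ := by
    simpa using hA1 hx₀
  obtain ⟨y, hy, hyd⟩ := hB.exists_infDist_eq_dist hBn x₁
  have h1 : Metric.infDist x₀ B ≤ ρ * Metric.infDist x₁ B := by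
    rw [hyd, ← hx]
    refine (Metric.infDist_le_dist_of_mem (hB1 ?_)).trans (hT i (Finset.mem_range.mp hi) x₁ y)
    simp only [mem_iUnion]
    exact ⟨i, hi, mem_image_of_mem _ hy⟩
  have h2 : Metric.infDist x₁ B ≤ Metric.infDist x₀ B := hmax hx₁
  have h3 : Metric.infDist x₀ B = 0 := by
    have := Metric.infDist_nonneg (x := x₀) (s := B)
    nlinarith [mul_le_mul_of_nonneg_left h2 hρ0]
  intro x hxA
  have h4 : Metric.infDist x B ≤ 0 := h3 ▸ hmax hxA
  exact (hB.isClosed.mem_iff_infDist_zero hBn).mpr (le_antisymm h4 Metric.infDist_nonneg)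

theorem IsSelfSimilarCurve.image_eq {b : ℕ} {p : ℕ → ℂ} {γ : ℝ → ℂ} (hb : 0 < b)
    (h : IsSelfSimilarCurve b p γ) :
    γ '' Icc 0 1 = ⋃ i ∈ Finset.range b, affineTo (p i) (p (i + 1)) '' (γ '' Icc 0 1) := by
  have hb' : (0 : ℝ) < b := by exact_mod_cast hb
  ext z
  simp only [mem_iUnion, Finset.mem_range, exists_prop]
  constructor
  · rintro ⟨x, hx, rfl⟩
    -- At `x = 1` the floor of `b x` is `b`, one past the last piece; the end point belongs to piece
    -- `b - 1`.
    rcases eq_or_lt_of_le hx.2 with h1 | h1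
    · refine ⟨b - 1, by omega, γ 1, ⟨1, by simp, rfl⟩, ?_⟩
      rw [← h.piece (b - 1) (by omega) 1 (by simp), h1]
      congr 1
      rw [Nat.cast_sub hb]
      field_simp
      simp
    · refine ⟨⌊(b : ℝ) * x⌋₊, ?_, γ (b * x - ⌊(b : ℝ) * x⌋₊), ⟨_, ?_, rfl⟩, ?_⟩
      · rw [Nat.floor_lt (mul_nonneg hb'.le hx.1)]
        nlinarith
      · exact ⟨by linarith [Nat.floor_le (mul_nonneg hb'.le hx.1)],
          by linarith [Nat.lt_floor_add_one ((b : ℝ) * x)]⟩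
      · rw [← h.piece]
        · congr 1; field_simp; ring
        · rw [Nat.floor_lt (mul_nonneg hb'.le hx.1)]; nlinarith
        · exact ⟨by linarith [Nat.floor_le (mul_nonneg hb'.le hx.1)],
          by linarith [Nat.lt_floor_add_one ((b : ℝ) * x)]⟩
  · rintro ⟨i, hi, _, ⟨x, hx, rfl⟩, rfl⟩
    refine ⟨(i + x) / b, ⟨by have := hx.1; positivity, ?_⟩, h.piece i hi x hx⟩
    rw [div_le_one hb']
    have : (i : ℝ) + 1 ≤ b := by exact_mod_cast hi
    linarith [hx.2]

theorem IsSelfSimilarCurve.eq_attractor {b : ℕ} {p : ℕ → ℂ} {γ : ℝ → ℂ} {ρ : ℝ}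
    (hp : IsGenerator b p ρ) (h : IsSelfSimilarCurve b p γ) {A : Set ℂ} (hA : IsCompact A)
    (hAn : A.Nonempty) (hA1 : A = ⋃ i ∈ Finset.range b, affineTo (p i) (p (i + 1)) '' A) :
    γ '' Icc 0 1 = A := by
  have hT : ∀ i < b, ∀ z w, dist (affineTo (p i) (p (i + 1)) z) (affineTo (p i) (p (i + 1)) w) ≤
      ρ * dist z w := fun i hi z w => by
    rw [dist_affineTo]
    exact mul_le_mul_of_nonneg_right (hp.norm_le i hi) dist_nonneg
  have hc : IsCompact (γ '' Icc 0 1) := isCompact_Icc.image h.continuous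
  exact Subset.antisymm
    (attractor_subset hp.lt_one hp.nonneg hT hc (h.image_eq hp.pos).subset hA hAn hA1.symm.subset)
    (attractor_subset hp.lt_one hp.nonneg hT hA hA1.subset hc ⟨_, 0, by simp, rfl⟩
      (h.image_eq hp.pos).symm.subset)

end
end VonKoch

namespace VonKoch
noncomputable section

/-! ### The generator of the von Koch curve -/

/-- The primitive `n`-th root of unity `exp (2 π i / n)`. -/
def unitRoot (n : ℕ) : ℂ := Complex.exp (centralAngle n * Complex.I)

section unitRoot

variable {n : ℕ} (hn : 3 ≤ n)

theorem norm_unitRoot (n : ℕ) : ‖unitRoot n‖ = 1 := Complex.norm_exp_ofReal_mul_I _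

theorem unitRoot_ne_zero (n : ℕ) : unitRoot n ≠ 0 := Complex.exp_ne_zero _

include hn

theorem isPrimitiveRoot_unitRoot : IsPrimitiveRoot (unitRoot n) n := by
  have : unitRoot n = Complex.exp (2 * Real.pi * Complex.I / n) := by
    unfold unitRoot centralAngle
    congr 1
    push_cast; ring
  rw [this]
  exact Complex.isPrimitiveRoot_exp n (by omega)

theorem unitRoot_pow : unitRoot n ^ n = 1 := (isPrimitiveRoot_unitRoot hn).pow_eq_one

theorem unitRoot_ne_one : unitRoot n ≠ 1 := (isPrimitiveRoot_unitRoot hn).ne_one (by omega)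

theorem sum_unitRoot : ∑ j ∈ Finset.range n, unitRoot n ^ j = 0 :=
  (isPrimitiveRoot_unitRoot hn).geom_sum_eq_zero (by omega)

omit hn in
theorem exp_interiorAngle (n : ℕ) : Complex.exp (-(interiorAngle n * Complex.I)) = -unitRoot n := by
  unfold interiorAngle unitRoot centralAngle
  rw [show -(((Real.pi - 2 * Real.pi / n : ℝ) : ℂ) * Complex.I) =
    ((2 * Real.pi / n : ℝ) : ℂ) * Complex.I - Real.pi * Complex.I by push_cast; ring,
    Complex.exp_sub, Complex.exp_pi_mul_I]
  ring

end unitRoot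

/-- The vertices of the polygonal path generating the mirror image of the von Koch curve. -/
def koch (n : ℕ) (r : ℝ) : ℕ → ℂ
  | 0 => 0
  | k + 1 => if k < n then conjRatio r - r * ∑ j ∈ Finset.range k, unitRoot n ^ (j + 1) else 1

section generator

variable {n : ℕ} (hn : 3 ≤ n) {r : ℝ} (hr0 : 0 < r) (hr1 : r < 1)

theorem two_mul_conjRatio_add (r : ℝ) : 2 * conjRatio r + r = 1 := by unfold conjRatio; ring

theorem koch_zero (n : ℕ) (r : ℝ) : koch n r 0 = 0 := rfl

theorem koch_succ {k : ℕ} (hk : k < n) :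
    koch n r (k + 1) = conjRatio r - r * ∑ j ∈ Finset.range k, unitRoot n ^ (j + 1) := by
  simp [koch, hk]

theorem koch_last (n : ℕ) (r : ℝ) : koch n r (n + 1) = 1 := by simp [koch]

include hn

/-- All `n` roots of unity sum to zero, and the bump uses all of them except `1`, so its edges add
up to the missing side `r`. -/
theorem koch_pred_last : koch n r n = conjRatio r + r := by
  obtain ⟨m, rfl⟩ : ∃ m, n = m + 1 := ⟨n - 1, by omega⟩
  have := sum_unitRoot hn
  rw [Finset.sum_range_succ', pow_zero] at this
  rw [koch_succ (by omega), eq_neg_of_add_eq_zero_left this]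
  ring

theorem koch_step_zero : koch n r 1 - koch n r 0 = conjRatio r := by
  rw [koch_succ (by omega)]; simp [koch]

theorem koch_step_last : koch n r (n + 1) - koch n r n = conjRatio r := by
  rw [koch_last, koch_pred_last hn]
  have := congrArg (fun x : ℝ => (x : ℂ)) (two_mul_conjRatio_add r)
  push_cast at this
  linear_combination -this

omit hn in
theorem koch_step {k : ℕ} (hk : k + 1 < n) :
    koch n r (k + 1 + 1) - koch n r (k + 1) = -r * unitRoot n ^ (k + 1) := by
  rw [koch_succ hk, koch_succ (by omega), Finset.sum_range_succ]
  ring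

/-- The scaling ratios of the von Koch curve. -/
theorem norm_koch_step {i : ℕ} (hr0 : 0 < r) (hr1 : r < 1) (hi : i < n + 1) :
    ‖koch n r (i + 1) - koch n r i‖ = if i = 0 ∨ i = n then conjRatio r else r := by
  have hl : 0 ≤ conjRatio r := by unfold conjRatio; linarith
  rcases i with _ | k
  · rw [koch_step_zero hn]
    simp [abs_of_nonneg hl]
  · rcases eq_or_ne (k + 1) n with h | h
    · rw [h, koch_step_last hn]
      simp [abs_of_nonneg hl]
    · rw [koch_step (by omega)]
      simp [norm_unitRoot, h, abs_of_pos hr0]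

include hr0 hr1

omit hn hr0 in
theorem conjRatio_pos : 0 < conjRatio r := by unfold conjRatio; linarith

omit hn hr1 in
theorem conjRatio_lt_one : conjRatio r < 1 := by unfold conjRatio; linarith

theorem isGenerator_koch : IsGenerator (n + 1) (koch n r) (max (conjRatio r) r) where
  zero := rfl
  last := koch_last n r
  pos := by omega
  nonneg := hr0.le.trans (le_max_right _ _)
  lt_one := max_lt (conjRatio_lt_one hr0) hr1
  norm_le i hi := by
    rw [norm_koch_step hn hr0 hr1 hi]
    split_ifs
    exacts [le_max_left _ _, le_max_right _ _]

theorem koch_step_ne_zero {i : ℕ} (hi : i < n + 1) : koch n r (i + 1) - koch n r i ≠ 0 := by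
  rw [← norm_pos_iff, norm_koch_step hn hr0 hr1 hi]
  split_ifs
  exacts [conjRatio_pos hr1, hr0]

end generator

open ComplexConjugate in
-- Conjugating the rotation by `α - m θ` gives multiplication by `-ω ^ (m + 1)`, because `exp (-i α)
-- = -ω`. The zero-based `psi` with index `k` therefore lands on edge `k + 1` of the generator; edge
-- `0` belongs to `phiL`.
theorem conj_psi {n : ℕ} (hn : 3 ≤ n) (r : ℝ) (k : ℕ) (hk : k + 1 < n) (z : ℂ) :
    conj (psi n r k (conj z)) = affineTo (koch n r (k + 1)) (koch n r (k + 2)) z := by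
  have hrot : ∀ (m : ℕ) (w : ℂ),
      conj (rot (interiorAngle n - m * centralAngle n) w) = -unitRoot n ^ (m + 1) * conj w := by
    intro m w
    have hf : ((interiorAngle n : ℂ) - m * centralAngle n) =
        ((interiorAngle n - m * centralAngle n : ℝ) : ℂ) := by push_cast; ring
    rw [rot, map_mul, ← Complex.exp_conj, map_mul, Complex.conj_ofReal, Complex.conj_I]
    rw [← hf, show ((interiorAngle n : ℂ) - m * centralAngle n) * -Complex.I =
      -(interiorAngle n * Complex.I) + m * (centralAngle n * Complex.I) by ring, Complex.exp_add,
      exp_interiorAngle, Complex.exp_nat_mul, pow_succ, unitRoot]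
    ring
  rw [affineTo, koch_step hk]
  induction k generalizing z with
  | zero =>
    have := hrot 0 (r * conj z)
    simp only [Nat.cast_zero, zero_mul, sub_zero] at this
    rw [psi, map_add, this, koch_succ (by omega)]
    simp
    ring
  | succ k ih =>
    have := hrot (k + 1) (r * conj z)
    push_cast at this
    have h1 := ih (by omega) 1
    rw [map_one] at h1
    rw [psi, map_add, this, h1, ← koch_step (by omega)]
    simp
    ring

open ComplexConjugate in
/-- The mirror image of the standard curve is the attractor generated by `koch n r`. -/
theorem IsStandardCurve.conj_eq {n : ℕ} (hn : 3 ≤ n) {r : ℝ} {C : Set ℂ}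
    (hC : IsStandardCurve n r C) :
    conj '' C = ⋃ i ∈ Finset.range (n + 1),
      affineTo (koch n r i) (koch n r (i + 1)) '' (conj '' C) := by
  have hL : ∀ z, conj (phiL r z) = affineTo (koch n r 0) (koch n r 1) (conj z) := fun z => by
    rw [affineTo, koch_step_zero hn, koch_zero, phiL]; simp
  have hR : ∀ z, conj (phiR r z) = affineTo (koch n r n) (koch n r (n + 1)) (conj z) := fun z => by
    rw [affineTo, koch_step_last hn, koch_pred_last hn, phiR]; simp
  have hψ : ∀ k, k + 1 < n → ∀ z, conj (psi n r k z) =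
      affineTo (koch n r (k + 1)) (koch n r (k + 2)) (conj z) := fun k hk z => by
    rw [← conj_psi hn r k hk, Complex.conj_conj]
  apply Subset.antisymm
  · rintro _ ⟨z, hz, rfl⟩
    rw [hC.fixed] at hz
    simp only [mem_iUnion, Finset.mem_range, exists_prop]
    rcases hz with (⟨w, hw, rfl⟩ | ⟨w, hw, rfl⟩) | hz
    · exact ⟨0, by omega, _, ⟨w, hw, rfl⟩, (hL w).symm⟩
    · exact ⟨n, by omega, _, ⟨w, hw, rfl⟩, (hR w).symm⟩
    · simp only [mem_iUnion, Finset.mem_range, exists_prop] at hz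
      obtain ⟨k, hk, w, hw, rfl⟩ := hz
      exact ⟨k + 1, by omega, _, ⟨w, hw, rfl⟩, (hψ k (by omega) w).symm⟩
  · intro z hz
    simp only [mem_iUnion, Finset.mem_range, exists_prop] at hz
    obtain ⟨i, hi, _, ⟨w, hw, rfl⟩, rfl⟩ := hz
    have hmem : ∀ v, v ∈ phiL r '' C ∪ phiR r '' C ∪ ⋃ k ∈ Finset.range (n - 1), psi n r k '' C →
        conj v ∈ conj '' C := fun v hv => ⟨v, by rw [hC.fixed]; exact hv, rfl⟩
    rcases i with _ | k
    · rw [← hL]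
      exact hmem _ (Or.inl (Or.inl ⟨w, hw, rfl⟩))
    · rcases eq_or_ne (k + 1) n with h | h
      · rw [h, ← hR]
        exact hmem _ (Or.inl (Or.inr ⟨w, hw, rfl⟩))
      · rw [← hψ k (by omega)]
        refine hmem _ (Or.inr ?_)
        simp only [mem_iUnion, Finset.mem_range, exists_prop]
        exact ⟨k, by omega, w, hw, rfl⟩

/-! ### The closed curve parametrizing the snowflake -/

/-- The centre of the regular `n`-gon of the snowflake. -/
def centre (n : ℕ) : ℂ := 1 / (1 - unitRoot n)

theorem centre_mul {n : ℕ} (hn : 3 ≤ n) : centre n * (1 - unitRoot n) = 1 := by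
  have : 1 - unitRoot n ≠ 0 := sub_ne_zero.mpr (unitRoot_ne_one hn).symm
  rw [centre]; field_simp

/-- The centre `1 / (1 - ω)` is the fixed point of `z ↦ 1 + ω z`, and all the edge maps are
rotations about it. -/
theorem edgeMap_eq {n : ℕ} (hn : 3 ≤ n) (k : ℕ) (z : ℂ) :
    edgeMap n k z = centre n + unitRoot n ^ (k + 1) * (z - centre n) := by
  have hc := centre_mul hn
  induction k generalizing z with
  | zero =>
    simp only [edgeMap, rot]
    rw [zero_add, pow_one, ← unitRoot]
    linear_combination -hc
  | succ k ih =>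
    have h2 : Complex.exp (((k + 2) * centralAngle n : ℝ) * Complex.I) = unitRoot n ^ (k + 2) := by
      rw [unitRoot, ← Complex.exp_nat_mul]
      congr 1
      push_cast; ring
    simp only [edgeMap, rot]
    rw [ih]
    push_cast at h2
    push_cast
    rw [h2]
    linear_combination -unitRoot n ^ (k + 1) * hc

/-- The closed curve running through the `n` rotated copies of the curve `γ`. -/
def loopCurve (n : ℕ) (γ : ℝ → ℂ) (t : ℝ) : ℂ :=
  centre n + unitRoot n ^ ⌊t⌋ * (γ (Int.fract t) - centre n)

section loopCurve

variable {n : ℕ} (hn : 3 ≤ n) {p : ℕ → ℂ} {b : ℕ} {γ : ℝ → ℂ} (hγ : IsSelfSimilarCurve b p γ)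

include hn hγ

/-- The end point `x = 1` is the content: there the floor jumps, and `centre n * (1 - ω) = 1` says
that consecutive copies join. -/
theorem loopCurve_add (k : ℤ) {x : ℝ} (hx : x ∈ Icc (0 : ℝ) 1) :
    loopCurve n γ (k + x) = centre n + unitRoot n ^ k * (γ x - centre n) := by
  rcases eq_or_lt_of_le hx.2 with rfl | h1
  · have h2 : (k : ℝ) + 1 = ((k + 1 : ℤ) : ℝ) := by push_cast; ring
    rw [loopCurve, h2, Int.floor_intCast, Int.fract_intCast, hγ.left 0 le_rfl, hγ.right 1 le_rfl,
      zpow_add_one₀ (unitRoot_ne_zero n)]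
    linear_combination unitRoot n ^ k * centre_mul hn
  · have hf : ⌊x⌋ = 0 := Int.floor_eq_zero_iff.mpr ⟨hx.1, h1⟩
    rw [loopCurve, Int.floor_intCast_add, Int.fract_intCast_add, hf, add_zero,
      Int.fract_eq_self.mpr ⟨hx.1, h1⟩]

theorem continuous_loopCurve : Continuous (loopCurve n γ) := by
  rw [continuous_iff_continuousAt]
  intro t₀
  set k := ⌊t₀⌋ with hk
  -- Since `γ` is constant outside the unit interval, one formula covers the pieces on both sides of
  -- the integer `k`: the first term is saturated at `1` after `k`, the second is `0` before it.
  have hev : loopCurve n γ =ᶠ[𝓝 t₀] fun t => centre n + unitRoot n ^ (k - 1) *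
      (γ (t - k + 1) + unitRoot n * γ (t - k) - centre n) := by
    have hmem : Ioo ((k : ℝ) - 1) (k + 1) ∈ 𝓝 t₀ :=
      Ioo_mem_nhds (by linarith [Int.floor_le t₀]) (Int.lt_floor_add_one t₀)
    filter_upwards [hmem] with t ht
    rcases lt_or_ge t k with h | h
    · have := loopCurve_add hn hγ (k - 1) (x := t - k + 1)
        ⟨by linarith [ht.1], by linarith⟩
      push_cast at this
      rw [show (k : ℝ) - 1 + (t - k + 1) = t by ring] at this
      rw [this, hγ.left (t - k) (by linarith)]
      ring
    · have := loopCurve_add hn hγ k (x := t - k) ⟨by linarith, by linarith [ht.2]⟩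
      rw [show (k : ℝ) + (t - k) = t by ring] at this
      have h0 : unitRoot n ^ k = unitRoot n ^ (k - 1) * unitRoot n := by
        rw [← zpow_add_one₀ (unitRoot_ne_zero n), sub_add_cancel]
      rw [this, hγ.right (t - k + 1) (by linarith), h0]
      linear_combination unitRoot n ^ (k - 1) * centre_mul hn
  refine ContinuousAt.congr (Continuous.continuousAt ?_) hev.symm
  have := hγ.continuous
  fun_prop

omit hn hγ in
theorem loopCurve_add_one (t : ℝ) :
    loopCurve n γ (t + 1) = centre n + unitRoot n * (loopCurve n γ t - centre n) := by
  rw [loopCurve, loopCurve, Int.floor_add_one, Int.fract_add_one,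
    zpow_add_one₀ (unitRoot_ne_zero n)]
  ring

omit hγ in
theorem loopCurve_add_period (t : ℝ) : loopCurve n γ (t + n) = loopCurve n γ t := by
  rw [loopCurve, loopCurve, Int.floor_add_natCast, Int.fract_add_natCast,
    zpow_add₀ (unitRoot_ne_zero n), zpow_natCast, unitRoot_pow hn, mul_one]

theorem range_loopCurve :
    range (loopCurve n γ) = ⋃ k ∈ Finset.range n, edgeMap n k '' (γ '' Icc 0 1) := by
  -- `edgeMap n j` rotates by the power `j + 1`, hence the residue of `k - 1` and not of `k`.
  have hmod : ∀ k : ℤ, ∃ j < n, unitRoot n ^ k = unitRoot n ^ (j + 1) := by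
    intro k
    refine ⟨((k - 1) % n).toNat, ?_, ?_⟩
    · have := Int.emod_lt_of_pos (k - 1) (show (0 : ℤ) < n by omega)
      have := Int.emod_nonneg (k - 1) (show (n : ℤ) ≠ 0 by omega)
      omega
    · have h0 := Int.emod_nonneg (k - 1) (show (n : ℤ) ≠ 0 by omega)
      have h1 : k = n * ((k - 1) / n) + ((((k - 1) % n).toNat + 1 : ℕ) : ℤ) := by
        have := Int.mul_ediv_add_emod (k - 1) n
        push_cast
        rw [Int.toNat_of_nonneg h0]; omega
      conv_lhs => rw [h1]
      rw [zpow_add₀ (unitRoot_ne_zero n), zpow_mul, zpow_natCast, unitRoot_pow hn, one_zpow,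
        one_mul, zpow_natCast]
  ext z
  simp only [mem_iUnion, Finset.mem_range, exists_prop]
  constructor
  · rintro ⟨t, rfl⟩
    obtain ⟨j, hj, hje⟩ := hmod ⌊t⌋
    refine ⟨j, hj, _, ⟨Int.fract t, ⟨Int.fract_nonneg t, (Int.fract_lt_one t).le⟩, rfl⟩, ?_⟩
    rw [edgeMap_eq hn, loopCurve, hje]
  · rintro ⟨k, -, _, ⟨x, hx, rfl⟩, rfl⟩
    refine ⟨((k + 1 : ℕ) : ℤ) + x, ?_⟩
    rw [loopCurve_add hn hγ _ hx, edgeMap_eq hn, zpow_natCast]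

/-- Every piece of the closed curve over an interval of a `b`-adic subdivision is similar to `γ`. -/
theorem loopCurve_cell (hb : 0 < b) (J : ℕ) (j : ℤ) {x : ℝ} (hx : x ∈ Icc (0 : ℝ) 1) :
    loopCurve n γ ((j + x) / b ^ J) = affineTo (loopCurve n γ (j / b ^ J))
      (loopCurve n γ ((j + 1) / b ^ J)) (γ x) := by
  have hb' : (0 : ℝ) < b := by exact_mod_cast hb
  induction J generalizing j x with
  | zero =>
    have h0 := loopCurve_add hn hγ j (x := 0) (by simp)
    have h1 := loopCurve_add hn hγ j (x := 1) (by simp)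
    rw [hγ.left 0 le_rfl, add_zero] at h0
    rw [hγ.right 1 le_rfl] at h1
    simp only [pow_zero, div_one]
    rw [loopCurve_add hn hγ j hx, h0, h1, affineTo]
    ring
  | succ J ih =>
    obtain ⟨j', i, hi, rfl⟩ : ∃ (j' : ℤ) (i : ℕ), i < b ∧ j = b * j' + i := by
      refine ⟨j / b, (j % b).toNat, ?_, ?_⟩
      · have := Int.emod_lt_of_pos j (show (0 : ℤ) < b by omega)
        have := Int.emod_nonneg j (show (b : ℤ) ≠ 0 by omega)
        omega
      · rw [Int.toNat_of_nonneg (Int.emod_nonneg j (show (b : ℤ) ≠ 0 by omega))]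
        exact (Int.mul_ediv_add_emod j b).symm
    have hib : (i : ℝ) + 1 ≤ b := by exact_mod_cast hi
    have key : ∀ y ∈ Icc (0 : ℝ) 1, loopCurve n γ ((((b * j' + i : ℤ) : ℝ) + y) / b ^ (J + 1)) =
        affineTo (loopCurve n γ (j' / b ^ J)) (loopCurve n γ ((j' + 1) / b ^ J))
          (affineTo (p i) (p (i + 1)) (γ y)) := by
      intro y hy
      rw [← hγ.piece i hi y hy, ← ih]
      · congr 1
        push_cast
        field_simp
        ring
      · constructor
        · have := hy.1; positivity
        · rw [div_le_one hb']; linarith [hy.2]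
    have k0 := key 0 (by simp)
    have k1 := key 1 (by simp)
    rw [add_zero] at k0
    rw [key x hx, k0, k1, hγ.left 0 le_rfl, hγ.right 1 le_rfl, affineTo_zero, affineTo_one,
      affineTo_comp]

/-- The end points of the subintervals of a `b`-adic interval. -/
theorem loopCurve_refine (hb : 0 < b) (J : ℕ) (j : ℤ) {i : ℕ} (hi : i ≤ b) (hp0 : p 0 = 0) :
    loopCurve n γ ((((b * j + i : ℤ) : ℝ)) / b ^ (J + 1)) =
      affineTo (loopCurve n γ (j / b ^ J)) (loopCurve n γ ((j + 1) / b ^ J)) (p i) := by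
  have hb' : (0 : ℝ) < b := by exact_mod_cast hb
  have hγp : γ (i / b) = p i := by
    rcases i with _ | i
    · rw [Nat.cast_zero, zero_div, hγ.left 0 le_rfl, hp0]
    · have := hγ.piece i hi 1 (by simp)
      rw [hγ.right 1 le_rfl, affineTo_one] at this
      rw [← this]; push_cast; rfl
  rw [← hγp, ← loopCurve_cell hn hγ hb J j]
  · congr 1
    push_cast
    field_simp
    ring
  · exact ⟨by positivity, (div_le_one hb').mpr (by exact_mod_cast hi)⟩

end loopCurve
end
end VonKoch

namespace VonKoch
noncomputable section

/-! ### Angle sums of regular polygons -/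

/-- After rotation by `e` both points lie in the right half-plane, so the difference of their
arguments lies in `(-π, π)` and needs no branch correction. -/
theorem arg_div_of_re_pos {e a b : ℂ} (ha : 0 < (e * a).re) (hb : 0 < (e * b).re) :
    (b / a).arg = (e * b).arg - (e * a).arg := by
  have he : e ≠ 0 := by rintro rfl; simp at ha
  have ha0 : e * a ≠ 0 := by intro h; simp [h] at ha
  have hb0 : e * b ≠ 0 := by intro h; simp [h] at hb
  have h1 : b / a = (e * b) / (e * a) := by rw [mul_div_mul_left _ _ he]
  have h2 := Complex.arg_div_coe_angle hb0 ha0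
  have h3 := abs_lt.mp ((Complex.abs_arg_lt_pi_div_two_iff).mpr (Or.inl ha))
  have h4 := abs_lt.mp ((Complex.abs_arg_lt_pi_div_two_iff).mpr (Or.inl hb))
  rw [← Real.Angle.coe_sub] at h2
  have h5 := congrArg Real.Angle.toReal h2
  rw [Complex.arg_coe_angle_toReal_eq_arg, Real.Angle.toReal_coe_eq_self_iff.mpr
    ⟨by linarith, by linarith⟩] at h5
  rw [h1, h5]

theorem abs_arg_div_lt_pi {e a b : ℂ} (ha : 0 < (e * a).re) (hb : 0 < (e * b).re) :
    (b / a).arg < Real.pi := by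
  have h3 := abs_lt.mp ((Complex.abs_arg_lt_pi_div_two_iff).mpr (Or.inl ha))
  have h4 := abs_lt.mp ((Complex.abs_arg_lt_pi_div_two_iff).mpr (Or.inl hb))
  rw [arg_div_of_re_pos ha hb]
  linarith

/-- The angle under which the `k`-th edge of the standard regular `n`-gon is seen from `w`. -/
def edgeAngle (n : ℕ) (w : ℂ) (k : ℕ) : ℝ := ((unitRoot n ^ (k + 1) - w) / (unitRoot n ^ k - w)).arg

theorem unitRoot_pow_eq (n m : ℕ) : unitRoot n ^ m =
    (Real.cos (m * centralAngle n) : ℂ) + Real.sin (m * centralAngle n) * Complex.I := by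
  rw [unitRoot, ← Complex.exp_nat_mul, ← mul_assoc, Complex.exp_mul_I]
  push_cast
  rfl

/-- For `1 ≤ m < n` the angle lies between `π / n` and `2π - π / n`; for `m = 0` it is `-π / n`. -/
theorem cos_le_cos_pi_div {n m : ℕ} (hn : 3 ≤ n) (hm : m < n) :
    Real.cos ((2 * m - 1) * (Real.pi / n)) ≤ Real.cos (Real.pi / n) := by
  have hn0 : (0 : ℝ) < n := by positivity
  have hp := Real.pi_pos
  have h1 : 0 < Real.pi / n := by positivity
  have h2 : n * (Real.pi / n) = Real.pi := by field_simp
  rcases m with _ | m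
  · rw [Nat.cast_zero, mul_zero, zero_sub, neg_one_mul, Real.cos_neg]
  · have hmn : ((m + 1 : ℕ) : ℝ) + 1 ≤ n := by exact_mod_cast hm
    push_cast at hmn ⊢
    have hm0 : (0 : ℝ) ≤ m := m.cast_nonneg
    rcases le_total ((2 * (m + 1 : ℝ) - 1) * (Real.pi / n)) Real.pi with h | h
    · exact Real.cos_le_cos_of_nonneg_of_le_pi h1.le h (by nlinarith)
    · rw [← Real.cos_two_pi_sub]
      exact Real.cos_le_cos_of_nonneg_of_le_pi h1.le (by linarith) (by nlinarith)

open ComplexConjugate in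
/-- The vertices of a regular polygon lie to the left of each edge. -/
theorem im_conj_edge_mul_nonneg {n : ℕ} (hn : 3 ≤ n) (j k : ℕ) :
    0 ≤ (conj (unitRoot n ^ (k + 1) - unitRoot n ^ k) *
      (unitRoot n ^ j - unitRoot n ^ k)).im := by
  obtain ⟨m, hm, hmj⟩ : ∃ m < n, unitRoot n ^ j = unitRoot n ^ k * unitRoot n ^ m := by
    refine ⟨(j + (n - 1) * k) % n, Nat.mod_lt _ (by omega), ?_⟩
    rw [← pow_eq_pow_mod _ (unitRoot_pow hn), ← pow_add]
    have : k + (j + (n - 1) * k) = j + n * k := by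
      obtain ⟨q, rfl⟩ : ∃ q, n = q + 1 := ⟨n - 1, by omega⟩
      simp; ring
    rw [this, pow_add, pow_mul, unitRoot_pow hn, one_pow, mul_one]
  have hk : conj (unitRoot n ^ k) * unitRoot n ^ k = 1 := by
    rw [mul_comm, Complex.mul_conj, Complex.normSq_eq_norm_sq, norm_pow, norm_unitRoot]
    simp
  -- Rotating by `ω ^ (-k)` reduces the claim to the edge from `1` to `ω`. There the imaginary part
  -- equals `2 sin h (cos h - cos ((2m - 1) h))` with `h = π / n`.
  have h1 : conj (unitRoot n ^ (k + 1) - unitRoot n ^ k) * (unitRoot n ^ j - unitRoot n ^ k) =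
      conj (unitRoot n ^ 1 - 1) * (unitRoot n ^ m - 1) := by
    rw [hmj, pow_succ, pow_one]
    simp only [map_sub, map_mul, map_one]
    linear_combination (conj (unitRoot n) - 1) * (unitRoot n ^ m - 1) * hk
  rw [h1, unitRoot_pow_eq, unitRoot_pow_eq]
  set h := Real.pi / n with hh
  have hθ : centralAngle n = 2 * h := by rw [hh, centralAngle]; ring
  have h2 : (conj ((Real.cos ((1 : ℕ) * centralAngle n) : ℂ) +
      Real.sin ((1 : ℕ) * centralAngle n) * Complex.I - 1) *
      ((Real.cos (m * centralAngle n) : ℂ) + Real.sin (m * centralAngle n) * Complex.I - 1)).im =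
      2 * Real.sin h * (Real.cos h - Real.cos ((2 * m - 1) * h)) := by
    rw [hθ]
    simp only [map_sub, map_add, map_mul, Complex.conj_ofReal, Complex.conj_I, map_one,
      Complex.mul_im, Complex.sub_re, Complex.add_re, Complex.ofReal_re, Complex.mul_re,
      Complex.ofReal_im, Complex.I_re, Complex.I_im, Complex.sub_im, Complex.add_im, Complex.neg_re,
      Complex.neg_im, Complex.one_re, Complex.one_im, Nat.cast_one, one_mul]
    rw [show (2 * (m : ℝ) - 1) * h = m * (2 * h) - h by ring, Real.cos_sub, Real.sin_two_mul h,
      Real.cos_two_mul h]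
    linear_combination 2 * Real.sin (m * (2 * h)) * Real.sin_sq_add_cos_sq h
  rw [h2]
  have hs : 0 ≤ Real.sin h := Real.sin_nonneg_of_nonneg_of_le_pi (by positivity) (by
    rw [hh]; exact div_le_self Real.pi_pos.le (by exact_mod_cast (by omega : 1 ≤ n)))
  have := cos_le_cos_pi_div hn hm
  exact mul_nonneg (by linarith) (by rw [hh]; linarith)

open ComplexConjugate in
-- If some edge is seen under a negative angle, then `w` lies strictly beyond its line while all
-- vertices lie on the other side or on it. From `w` all vertices are then in one open half-plane,
-- so the angles telescope to zero and each is less than `π`.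
theorem edgeAngle_cases {n : ℕ} (hn : 3 ≤ n) (w : ℂ) :
    (∀ k, 0 ≤ edgeAngle n w k) ∨
      (∑ k ∈ Finset.range n, edgeAngle n w k = 0 ∧ ∀ k, edgeAngle n w k < Real.pi) := by
  by_cases hall : ∀ k, 0 ≤ edgeAngle n w k
  · exact Or.inl hall
  right
  push Not at hall
  obtain ⟨k, hk⟩ := hall
  rw [edgeAngle, Complex.arg_neg_iff, Complex.div_im] at hk
  set A := unitRoot n ^ k - w with hA
  set B := unitRoot n ^ (k + 1) - w with hB
  set e : ℂ := -Complex.I * conj (B - A) with he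
  have hBA : B - A = unitRoot n ^ (k + 1) - unitRoot n ^ k := by rw [hA, hB]; ring
  have hneg : B.im * A.re - B.re * A.im < 0 := by
    rw [← sub_div] at hk
    by_contra! hc
    exact absurd (div_nonneg hc (Complex.normSq_nonneg A)) (not_le.mpr hk)
  have hpos : ∀ j, 0 < (e * (unitRoot n ^ j - w)).re := by
    intro j
    have h1 := im_conj_edge_mul_nonneg hn j k
    rw [← hBA] at h1
    have h2 : (e * (unitRoot n ^ j - w)).re =
        (conj (B - A) * (unitRoot n ^ j - unitRoot n ^ k)).im + (conj (B - A) * A).im := by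
      rw [← Complex.add_im, ← mul_add, he]
      have : unitRoot n ^ j - unitRoot n ^ k + A = unitRoot n ^ j - w := by rw [hA]; ring
      rw [this]
      simp only [Complex.mul_re, Complex.mul_im, Complex.neg_re, Complex.neg_im, Complex.I_re,
        Complex.I_im]
      ring
    have h3 : (conj (B - A) * A).im = -(B.im * A.re - B.re * A.im) := by
      simp only [map_sub, Complex.mul_im, Complex.sub_re, Complex.sub_im, Complex.conj_re,
        Complex.conj_im]
      ring
    rw [h2, h3]
    linarith
  refine ⟨?_, fun j => abs_arg_div_lt_pi (hpos j) (hpos (j + 1))⟩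
  simp only [edgeAngle]
  rw [Finset.sum_congr rfl (fun j _ => arg_div_of_re_pos (hpos j) (hpos (j + 1))),
    Finset.sum_range_sub (fun j => (e * (unitRoot n ^ j - w)).arg), unitRoot_pow hn, pow_zero,
    sub_self]

theorem sum_edgeAngle_nonneg {n : ℕ} (hn : 3 ≤ n) (w : ℂ) :
    0 ≤ ∑ k ∈ Finset.range n, edgeAngle n w k := by
  rcases edgeAngle_cases hn w with h | h
  · exact Finset.sum_nonneg fun k _ => h k
  · exact h.1.ge

/-- The sum telescopes in the group of angles modulo `2π`. -/
theorem exists_sum_edgeAngle_eq {n : ℕ} (hn : 3 ≤ n) {w : ℂ} (hw : ∀ k, unitRoot n ^ k ≠ w) :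
    ∃ m : ℤ, ∑ k ∈ Finset.range n, edgeAngle n w k = 2 * Real.pi * m := by
  have hne : ∀ k, unitRoot n ^ k - w ≠ 0 := fun k => sub_ne_zero.mpr (hw k)
  have h : ((∑ k ∈ Finset.range n, edgeAngle n w k : ℝ) : Real.Angle) = (0 : ℝ) := by
    rw [← Real.Angle.coe_coeHom, map_sum]
    simp only [Real.Angle.coe_coeHom, edgeAngle]
    rw [Finset.sum_congr rfl (fun k _ => Complex.arg_div_coe_angle (hne (k + 1)) (hne k)),
      Finset.sum_range_sub (fun k => (((unitRoot n ^ k - w).arg : ℝ) : Real.Angle)),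
      unitRoot_pow hn, pow_zero, sub_self]
    rfl
  obtain ⟨m, hm⟩ := Real.Angle.angle_eq_iff_two_pi_dvd_sub.mp h
  exact ⟨m, by rw [← hm, sub_zero]⟩

theorem centralAngle_pos {n : ℕ} (hn : 3 ≤ n) : 0 < centralAngle n := by
  have := Real.pi_pos
  unfold centralAngle
  positivity

theorem centralAngle_lt_pi {n : ℕ} (hn : 3 ≤ n) : centralAngle n < Real.pi := by
  have h3 : (3 : ℝ) ≤ n := by exact_mod_cast hn
  have := Real.pi_pos
  rw [centralAngle, div_lt_iff₀ (by linarith)]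
  nlinarith

theorem arg_unitRoot {n : ℕ} (hn : 3 ≤ n) : (unitRoot n).arg = centralAngle n := by
  have := centralAngle_pos hn
  have := centralAngle_lt_pi hn
  rw [unitRoot, Complex.arg_exp_mul_I, toIocMod_eq_self]
  constructor <;> linarith

theorem tendsto_edgeAngle {n : ℕ} (hn : 3 ≤ n) (k : ℕ) :
    Tendsto (fun w => edgeAngle n w k) (𝓝 0) (𝓝 (centralAngle n)) := by
  have hval : (unitRoot n ^ (k + 1) - 0) / (unitRoot n ^ k - 0) = unitRoot n := by
    rw [sub_zero, sub_zero, pow_succ, mul_div_cancel_left₀ _ (pow_ne_zero _ (unitRoot_ne_zero n))]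
  have h1 : ContinuousAt (fun w : ℂ => (unitRoot n ^ (k + 1) - w) / (unitRoot n ^ k - w)) 0 :=
    (by fun_prop : ContinuousAt (fun w : ℂ => unitRoot n ^ (k + 1) - w) 0).div (by fun_prop)
      (by rw [sub_zero]; exact pow_ne_zero _ (unitRoot_ne_zero n))
  have h2 : ContinuousAt Complex.arg (unitRoot n) := Complex.continuousAt_arg (by
    rw [Complex.mem_slitPlane_iff_arg, arg_unitRoot hn]
    exact ⟨(centralAngle_lt_pi hn).ne, unitRoot_ne_zero n⟩)
  rw [← arg_unitRoot hn]
  refine h2.tendsto.comp ?_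
  have h3 := h1.tendsto
  rwa [hval] at h3

/-- At the centre each edge is seen under `2π / n`, and the angles are continuous there. -/
theorem eventually_sum_edgeAngle_pos {n : ℕ} (hn : 3 ≤ n) :
    ∀ᶠ w in 𝓝 (0 : ℂ), 0 < ∑ k ∈ Finset.range n, edgeAngle n w k := by
  have hcont := tendsto_finsetSum (Finset.range n) (fun k _ => tendsto_edgeAngle hn k)
  refine hcont.eventually (lt_mem_nhds ?_)
  have := centralAngle_pos hn
  simp only [Finset.sum_const, Finset.card_range, nsmul_eq_mul]
  positivity

end
end VonKoch

namespace VonKoch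
noncomputable section

/-! ### Nonnegativity of the angular defect of the von Koch curve -/

theorem arg_real_div {x y : ℝ} (h : 0 < x * y) : ((x : ℂ) / y).arg = 0 := by
  rw [← Complex.ofReal_div, Complex.arg_ofReal_of_nonneg]
  rcases pos_and_pos_or_neg_and_neg_of_mul_pos h with ⟨h1, h2⟩ | ⟨h1, h2⟩
  · positivity
  · exact div_nonneg_of_nonpos h1.le h2.le

theorem arg_real_div_neg {x y : ℝ} (h : x * y < 0) : ((x : ℂ) / y).arg = Real.pi := by
  rw [← Complex.ofReal_div, Complex.arg_ofReal_of_neg]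
  rcases mul_neg_iff.mp h with ⟨h1, h2⟩ | ⟨h1, h2⟩
  · exact div_neg_of_pos_of_neg h1 h2
  · exact div_neg_of_neg_of_pos h1 h2

/-- Following `a → b`, jumping to `c → d`, and returning along `d → a` is, for angles, the same as
`c → b`. Principal arguments on the real axis violate this only for `z` between `b` and `c`, where
both sides are `π` in absolute value but of opposite sign. -/
theorem arg_bracket {a b c d : ℝ} (hab : a < b) (hbc : b < c) (hcd : c < d) {z : ℂ}
    (ha : (a : ℂ) ≠ z) (hb : (b : ℂ) ≠ z) (hc : (c : ℂ) ≠ z) (hd : (d : ℂ) ≠ z) :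
    ((b - z) / (a - z)).arg + ((d - z) / (c - z)).arg - ((d - z) / (a - z)).arg =
        ((b - z) / (c - z)).arg ∨
      (((b - z) / (a - z)).arg + ((d - z) / (c - z)).arg - ((d - z) / (a - z)).arg = -Real.pi ∧
        ((b - z) / (c - z)).arg = Real.pi) := by
  by_cases hz : z.im = 0
  · obtain ⟨t, rfl⟩ : ∃ t : ℝ, (t : ℂ) = z := ⟨z.re, Complex.ext rfl (by simp [hz])⟩
    have ha' : a - t ≠ 0 := sub_ne_zero.mpr (by exact_mod_cast ha)
    have hb' : b - t ≠ 0 := sub_ne_zero.mpr (by exact_mod_cast hb)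
    have hc' : c - t ≠ 0 := sub_ne_zero.mpr (by exact_mod_cast hc)
    have hd' : d - t ≠ 0 := sub_ne_zero.mpr (by exact_mod_cast hd)
    simp only [← Complex.ofReal_sub]
    rcases lt_or_gt_of_ne ha' with h1 | h1
    · rcases lt_or_gt_of_ne hb' with h2 | h2
      · rcases lt_or_gt_of_ne hc' with h3 | h3
        · rcases lt_or_gt_of_ne hd' with h4 | h4
          · left
            rw [arg_real_div (mul_pos_of_neg_of_neg h2 h1), arg_real_div (mul_pos_of_neg_of_neg h4 h3),
              arg_real_div (mul_pos_of_neg_of_neg h4 h1), arg_real_div (mul_pos_of_neg_of_neg h2 h3)]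
            ring
          · left
            rw [arg_real_div (mul_pos_of_neg_of_neg h2 h1), arg_real_div_neg (mul_neg_of_pos_of_neg h4 h3),
              arg_real_div_neg (mul_neg_of_pos_of_neg h4 h1),
              arg_real_div (mul_pos_of_neg_of_neg h2 h3)]
            ring
        · right
          have h4 : 0 < d - t := by linarith
          rw [arg_real_div (mul_pos_of_neg_of_neg h2 h1), arg_real_div (mul_pos h4 h3),
            arg_real_div_neg (mul_neg_of_pos_of_neg h4 h1),
            arg_real_div_neg (mul_neg_of_neg_of_pos h2 h3)]
          exact ⟨by ring, rfl⟩
      · left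
        have h3 : 0 < c - t := by linarith
        have h4 : 0 < d - t := by linarith
        rw [arg_real_div_neg (mul_neg_of_pos_of_neg h2 h1), arg_real_div (mul_pos h4 h3),
          arg_real_div_neg (mul_neg_of_pos_of_neg h4 h1), arg_real_div (mul_pos h2 h3)]
        ring
    · left
      have h2 : 0 < b - t := by linarith
      have h3 : 0 < c - t := by linarith
      have h4 : 0 < d - t := by linarith
      rw [arg_real_div (mul_pos h2 h1), arg_real_div (mul_pos h4 h3), arg_real_div (mul_pos h4 h1),
        arg_real_div (mul_pos h2 h3)]
      ring
  · left
    have hpos : ∀ x : ℝ, 0 < (Complex.I * z.im * (x - z)).re := by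
      intro x
      have : (Complex.I * z.im * (x - z)).re = z.im ^ 2 := by simp; ring
      rw [this]
      positivity
    rw [arg_div_of_re_pos (hpos a) (hpos b), arg_div_of_re_pos (hpos c) (hpos d),
      arg_div_of_re_pos (hpos a) (hpos d), arg_div_of_re_pos (hpos c) (hpos b)]
    ring

/-- The angle by which the polygonal path with vertices `p` exceeds the segment from `0` to `1`,
seen from `z`. -/
def excessAngle (b : ℕ) (p : ℕ → ℂ) (z : ℂ) : ℝ :=
  ∑ i ∈ Finset.range b, ((p (i + 1) - z) / (p i - z)).arg - ((1 - z) / (0 - z)).arg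

section koch

variable {n : ℕ} (hn : 3 ≤ n) {r : ℝ} (hr0 : 0 < r) (hr1 : r < 1)

/-- The centre of the polygonal bump. -/
def bumpCentre (n : ℕ) (r : ℝ) : ℂ := conjRatio r - r * unitRoot n * centre n

include hn

/-- Vertices `1, …, n` of the generator are the vertices of a regular `n`-gon, the image of the
powers of `ω` under one similarity. This reduces angles seen from `z` to `edgeAngle`. -/
theorem koch_eq {k : ℕ} (hk : k < n) :
    koch n r (k + 1) = bumpCentre n r + r * unitRoot n * centre n * unitRoot n ^ k := by
  have h : ∑ j ∈ Finset.range k, unitRoot n ^ (j + 1) =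
      unitRoot n * centre n * (1 - unitRoot n ^ k) := by
    have hc := centre_mul hn
    have hg := mul_neg_geom_sum (unitRoot n) k
    rw [Finset.sum_congr rfl (fun j _ => pow_succ' (unitRoot n) j), ← Finset.mul_sum, ← hg]
    linear_combination -(unitRoot n * ∑ i ∈ Finset.range k, unitRoot n ^ i) * hc
  rw [koch_succ hk, h, bumpCentre]
  ring

theorem centre_ne_zero : centre n ≠ 0 := fun h => by
  have := centre_mul hn
  rw [h, zero_mul] at this
  exact zero_ne_one this

include hr0 hr1

/-- By `arg_bracket` the two outer segments minus the unit segment amount to the missing side of the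
bump polygon, traversed from `ℓ + r` to `ℓ`. So the excess is the full angle sum of a regular
polygon, up to `2π` for `z` on that side. -/
theorem excessAngle_koch_cases {z : ℂ} (hz : ∀ i ≤ n + 1, koch n r i ≠ z) :
    excessAngle (n + 1) (koch n r) z = ∑ k ∈ Finset.range n,
        edgeAngle n ((z - bumpCentre n r) / (r * unitRoot n * centre n)) k ∨
      (excessAngle (n + 1) (koch n r) z = ∑ k ∈ Finset.range n,
        edgeAngle n ((z - bumpCentre n r) / (r * unitRoot n * centre n)) k - 2 * Real.pi ∧
        edgeAngle n ((z - bumpCentre n r) / (r * unitRoot n * centre n)) (n - 1) = Real.pi) := by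
  have hb0 : r * unitRoot n * centre n ≠ 0 :=
    mul_ne_zero (mul_ne_zero (by exact_mod_cast hr0.ne') (unitRoot_ne_zero n)) (centre_ne_zero hn)
  set w := (z - bumpCentre n r) / (r * unitRoot n * centre n) with hw
  have hzw : z = bumpCentre n r + r * unitRoot n * centre n * w := by
    rw [hw, mul_div_cancel₀ _ hb0]; ring
  have hdiff : ∀ k < n, koch n r (k + 1) - z =
      r * unitRoot n * centre n * (unitRoot n ^ k - w) := by
    intro k hk
    rw [koch_eq hn hk, hzw]; ring
  obtain ⟨m, rfl⟩ : ∃ m, n = m + 1 := ⟨n - 1, by omega⟩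
  have hmid : ∀ k ∈ Finset.range m, ((koch (m + 1) r (k + 1 + 1) - z) /
      (koch (m + 1) r (k + 1) - z)).arg = edgeAngle (m + 1) w k := by
    intro k hk
    have := Finset.mem_range.mp hk
    rw [hdiff (k + 1) (by omega), hdiff k (by omega), mul_div_mul_left _ _ hb0, edgeAngle]
  have hclose : ((koch (m + 1) r 1 - z) / (koch (m + 1) r (m + 1) - z)).arg =
      edgeAngle (m + 1) w m := by
    rw [hdiff 0 (by omega), hdiff m (by omega), mul_div_mul_left _ _ hb0, edgeAngle,
      unitRoot_pow hn, pow_zero]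
  have hl := conjRatio_pos hr1
  have h2 := two_mul_conjRatio_add r
  have e0 : koch (m + 1) r 0 = ((0 : ℝ) : ℂ) := by simp [koch]
  have e1 : koch (m + 1) r 1 = (conjRatio r : ℂ) := by rw [koch_succ (by omega)]; simp
  have e2 : koch (m + 1) r (m + 1) = ((conjRatio r + r : ℝ) : ℂ) := by
    rw [koch_pred_last hn]; push_cast; rfl
  have e3 : koch (m + 1) r (m + 1 + 1) = ((1 : ℝ) : ℂ) := by rw [koch_last]; simp
  have hbr := arg_bracket hl (show conjRatio r < conjRatio r + r by linarith)
    (show conjRatio r + r < 1 by linarith) (z := z) (by rw [← e0]; exact hz _ (by omega))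
    (by rw [← e1]; exact hz _ (by omega)) (by rw [← e2]; exact hz _ (by omega))
    (by rw [← e3]; exact hz _ le_rfl)
  rw [← e0, ← e1, ← e2, ← e3, hclose] at hbr
  have hexc : excessAngle (m + 1 + 1) (koch (m + 1) r) z =
      ∑ k ∈ Finset.range m, edgeAngle (m + 1) w k +
      (((koch (m + 1) r 1 - z) / (koch (m + 1) r 0 - z)).arg +
        ((koch (m + 1) r (m + 1 + 1) - z) / (koch (m + 1) r (m + 1) - z)).arg -
        ((koch (m + 1) r (m + 1 + 1) - z) / (koch (m + 1) r 0 - z)).arg) := by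
    rw [excessAngle, Finset.sum_range_succ, Finset.sum_range_succ', Finset.sum_congr rfl hmid,
      koch_last, koch_zero]
    ring
  rw [Finset.sum_range_succ, hexc, Nat.add_sub_cancel]
  rcases hbr with h | ⟨h, h'⟩
  · left; rw [h]
  · right
    rw [h, h']
    exact ⟨by ring, rfl⟩

/-- In the exceptional case the missing side is seen under `π`, so all angles are nonnegative and
their sum is at least `π`. Being a multiple of `2π`, it is at least `2π`, which pays for the
correction. -/
theorem excessAngle_koch_nonneg {z : ℂ} (hz : ∀ i ≤ n + 1, koch n r i ≠ z) :
    0 ≤ excessAngle (n + 1) (koch n r) z := by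
  have hp := Real.pi_pos
  set w := (z - bumpCentre n r) / (r * unitRoot n * centre n) with hw
  have hb0 : r * unitRoot n * centre n ≠ 0 :=
    mul_ne_zero (mul_ne_zero (by exact_mod_cast hr0.ne') (unitRoot_ne_zero n)) (centre_ne_zero hn)
  rcases excessAngle_koch_cases hn hr0 hr1 hz with h | ⟨h, hpi⟩
  · rw [h]
    exact sum_edgeAngle_nonneg hn _
  · rw [h]
    have hwne : ∀ k, unitRoot n ^ k ≠ w := by
      intro k hk
      rw [pow_eq_pow_mod k (unitRoot_pow hn)] at hk
      have hlt : k % n < n := Nat.mod_lt _ (by omega)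
      apply hz (k % n + 1) (by omega)
      rw [koch_eq hn hlt, hk, hw, mul_div_cancel₀ _ hb0]
      ring
    obtain ⟨m, hm⟩ := exists_sum_edgeAngle_eq hn hwne
    rcases edgeAngle_cases hn w with hall | ⟨-, hlt⟩
    · have hge : Real.pi ≤ ∑ k ∈ Finset.range n, edgeAngle n w k := by
        rw [← hpi]
        exact Finset.single_le_sum (fun k _ => hall k) (Finset.mem_range.mpr (by omega))
      rw [hm] at hge ⊢
      have h1 : (0 : ℝ) < m := by
        by_contra! hc
        nlinarith
      have h2 : 1 ≤ m := by exact_mod_cast h1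
      have h3 : (1 : ℝ) ≤ m := by exact_mod_cast h2
      nlinarith
    · exact absurd hpi (hlt (n - 1)).ne

theorem eventually_excessAngle_koch_pos : ∀ᶠ z in 𝓝 (bumpCentre n r),
    (∀ i ≤ n + 1, koch n r i ≠ z) → 0 < excessAngle (n + 1) (koch n r) z := by
  have hc : Tendsto (fun z => (z - bumpCentre n r) / (r * unitRoot n * centre n))
      (𝓝 (bumpCentre n r)) (𝓝 0) := by
    have : Continuous fun z => (z - bumpCentre n r) / (r * unitRoot n * centre n) := by fun_prop
    simpa using this.tendsto (bumpCentre n r)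
  filter_upwards [hc.eventually (eventually_sum_edgeAngle_pos hn), hc.eventually
    ((tendsto_edgeAngle hn (n - 1)).eventually (gt_mem_nhds (centralAngle_lt_pi hn)))]
    with z h1 h2 hz
  rcases excessAngle_koch_cases hn hr0 hr1 hz with h | ⟨-, h⟩
  · rw [h]; exact h1
  · exact absurd h h2.ne

end koch

/-- The number of turns around `z` by which the curve `γ` from `0` to `1` exceeds the segment. -/
def defect (γ : ℝ → ℂ) (z : ℂ) : ℝ :=
  turn (fun x => γ x - z) 0 1 - ((1 - z) / (0 - z)).arg / (2 * Real.pi)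

/-- A piece of a curve similar to `γ` makes the turn of its chord plus a defect. -/
theorem turn_cell {Γ γ : ℝ → ℂ} (hΓ : Continuous Γ) (hγ : Continuous γ) {P Q : ℂ} (hPQ : Q - P ≠ 0)
    {M j : ℝ} (hM : 0 < M) (hcell : ∀ x ∈ Icc (0 : ℝ) 1, Γ ((j + x) / M) = affineTo P Q (γ x))
    {z : ℂ} (hz : z ∉ Γ '' Icc (j / M) ((j + 1) / M)) :
    turn (fun t => Γ t - z) (j / M) ((j + 1) / M) =
      defect γ ((z - P) / (Q - P)) + ((Q - z) / (P - z)).arg / (2 * Real.pi) := by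
  have hne : ∀ x ∈ Icc (0 : ℝ) 1, γ x - (z - P) / (Q - P) ≠ 0 := by
    intro x hx he
    apply hz
    refine ⟨(j + x) / M, ⟨by have := hx.1; gcongr; linarith, by have := hx.2; gcongr⟩, ?_⟩
    rw [hcell x hx, affineTo, sub_eq_zero.mp he]
    field_simp
    ring
  have e0 : (1 / M) * 0 + j / M = j / M := by ring
  have e1 : (1 / M) * 1 + j / M = (j + 1) / M := by ring
  have t1 := turn_comp_affine (f := fun t => Γ t - z) (m := 1 / M) (k := j / M) (a := 0) (b := 1)
    (by positivity) zero_le_one (by fun_prop) (by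
      intro t ht he
      rw [e0, e1] at ht
      exact hz ⟨t, ht, sub_eq_zero.mp he⟩)
  rw [e0, e1] at t1
  rw [← t1, turn_congr (g := fun x => (Q - P) * (γ x - (z - P) / (Q - P))) zero_le_one,
    turn_const_mul (f := fun x => γ x - (z - P) / (Q - P)) hPQ zero_le_one (by fun_prop) hne, defect]
  · have h2 : (1 - (z - P) / (Q - P)) / (0 - (z - P) / (Q - P)) = (Q - z) / (P - z) := by
      rw [← mul_div_mul_left _ _ hPQ]
      congr 1 <;> field_simp <;> ring
    rw [h2]; ring
  · intro x hx
    simp only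
    rw [show 1 / M * x + j / M = (j + x) / M by ring, hcell x hx, affineTo]
    field_simp
    ring

/-- From a point farther from `0` than the whole curve, curve and chord are seen without crossing
the branch cut, so their turns agree. -/
theorem defect_eq_zero_of_far {γ : ℝ → ℂ} (hγ : Continuous γ) (h0 : γ 0 = 0) (h1 : γ 1 = 1)
    {z : ℂ} (hz : ∀ x ∈ Icc (0 : ℝ) 1, ‖γ x‖ < ‖z‖) : defect γ z = 0 := by
  have hz0 : z ≠ 0 := by
    rintro rfl
    exact absurd (hz 0 (by simp)) (by simp [h0])
  rw [defect, turn_sub_of_norm_le zero_le_one hγ.continuousOn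
    (fun x hx => ⟨(hz x hx).le, fun h => (hz x hx).ne (by rw [h])⟩), h0, h1]
  have : (1 - z) / (0 - z) = 1 - 1 / z := by field_simp; ring
  rw [this]
  simp

namespace IsSelfSimilarCurve

variable {b : ℕ} {p : ℕ → ℂ} {γ : ℝ → ℂ} (hγ : IsSelfSimilarCurve b p γ)
include hγ

theorem mem_image_of_piece {i : ℕ} (hi : i < b) (hp : p (i + 1) - p i ≠ 0) {z : ℂ}
    (hz : (z - p i) / (p (i + 1) - p i) ∈ γ '' Icc 0 1) : z ∈ γ '' Icc 0 1 := by
  rw [hγ.image_eq (by omega)]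
  simp only [mem_iUnion, Finset.mem_range, exists_prop]
  refine ⟨i, hi, _, hz, ?_⟩
  rw [affineTo]; field_simp; ring

theorem vertex_mem {i : ℕ} (hi : i ≤ b) (hp0 : p 0 = 0) : γ (i / b) = p i := by
  rcases i with _ | i
  · rw [Nat.cast_zero, zero_div, hγ.left 0 le_rfl, hp0]
  · have := hγ.piece i hi 1 (by simp)
    rw [hγ.right 1 le_rfl, affineTo_one] at this
    rw [← this]; push_cast; rfl

/-- Turns of the pieces add up, each being the angle of its chord plus the rescaled defect; the
chord angles exceed the angle of the whole chord by `excessAngle`. -/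
theorem defect_eq (hb : 0 < b) (hp : ∀ i < b, p (i + 1) - p i ≠ 0)
    {z : ℂ} (hz : z ∉ γ '' Icc 0 1) :
    defect γ z = ∑ i ∈ Finset.range b, defect γ ((z - p i) / (p (i + 1) - p i)) +
      excessAngle b p z / (2 * Real.pi) := by
  have hb' : (0 : ℝ) < b := by exact_mod_cast hb
  have hmono : Monotone fun i : ℕ => (i : ℝ) / b := fun i j hij => by
    simp only; gcongr
  have hsum := turn_sum (f := fun x => γ x - z) hmono b
    (hγ.continuous.sub continuous_const).continuousOn (by
      intro x hx he
      simp only [Nat.cast_zero, zero_div, div_self hb'.ne'] at hx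
      exact hz ⟨x, hx, sub_eq_zero.mp he⟩)
  simp only [Nat.cast_zero, zero_div, div_self hb'.ne'] at hsum
  rw [defect, ← hsum, excessAngle,
    sub_div (∑ i ∈ Finset.range b, ((p (i + 1) - z) / (p i - z)).arg), Finset.sum_div, ← add_sub_assoc,
    ← Finset.sum_add_distrib]
  congr 1
  refine Finset.sum_congr rfl fun i hi => ?_
  have hib := Finset.mem_range.mp hi
  have := turn_cell hγ.continuous hγ.continuous (hp i hib) (j := i) hb' (hγ.piece i hib) (z := z)
    (by
      rintro ⟨x, hx, hxz⟩
      refine hz ⟨x, ⟨?_, ?_⟩, hxz⟩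
      · exact le_trans (by positivity) hx.1
      · refine hx.2.trans ((div_le_one hb').mpr ?_)
        exact_mod_cast hib)
  push_cast
  exact this

/-- Passing to a piece stretches the distance from the curve by at least `1 / ρ`. Iterating
`defect_eq` finitely often therefore leaves only nonnegative excess angles and defects seen from
afar, which vanish. -/
theorem defect_nonneg {ρ : ℝ} (hg : IsGenerator b p ρ) (hρ : 0 < ρ)
    (hp : ∀ i < b, p (i + 1) - p i ≠ 0)
    (hexc : ∀ z, (∀ i ≤ b, p i ≠ z) → 0 ≤ excessAngle b p z) {z : ℂ} (hz : z ∉ γ '' Icc 0 1) :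
    0 ≤ defect γ z := by
  have hc : IsCompact (γ '' Icc 0 1) := isCompact_Icc.image hγ.continuous
  obtain ⟨L, hL⟩ := hc.isBounded.exists_norm_le
  have hL0 : 0 ≤ L := (norm_nonneg _).trans (hL (γ 0) ⟨0, by simp, rfl⟩)
  have key : ∀ (J : ℕ) (z : ℂ), (∀ a ∈ γ '' Icc 0 1, ρ ^ J * (L + 1) ≤ dist z a) →
      0 ≤ defect γ z := by
    intro J
    induction J with
    | zero =>
      intro z hz
      rw [defect_eq_zero_of_far hγ.continuous (hγ.left 0 le_rfl) (hγ.right 1 le_rfl)]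
      intro x hx
      have h1 := hL _ ⟨x, hx, rfl⟩
      have h2 := hz (γ 0) ⟨0, by simp, rfl⟩
      rw [hγ.left 0 le_rfl, dist_zero_right, pow_zero, one_mul] at h2
      linarith
    | succ J ih =>
      intro z hz
      have hpos : 0 < ρ ^ (J + 1) * (L + 1) := by positivity
      have hzA : z ∉ γ '' Icc 0 1 := by
        intro hmem
        have := hz z hmem
        rw [dist_self] at this
        linarith
      rw [hγ.defect_eq hg.pos hp hzA]
      refine add_nonneg (Finset.sum_nonneg fun i hi => ih _ ?_) (div_nonneg (hexc z ?_)
        (by have := Real.pi_pos; positivity))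
      · intro a ha
        have hib := Finset.mem_range.mp hi
        have hpi := hp i hib
        have hmem : affineTo (p i) (p (i + 1)) a ∈ γ '' Icc 0 1 := by
          apply hγ.mem_image_of_piece hib hpi
          rw [affineTo, add_sub_cancel_left, mul_div_cancel_left₀ _ hpi]
          exact ha
        have h1 := hz _ hmem
        have h2 : z = affineTo (p i) (p (i + 1)) ((z - p i) / (p (i + 1) - p i)) := by
          rw [affineTo]; field_simp; ring
        rw [h2, dist_affineTo, pow_succ] at h1
        have h3 := mul_le_mul_of_nonneg_right (hg.norm_le i hib)
          (dist_nonneg (x := (z - p i) / (p (i + 1) - p i)) (y := a))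
        have h4 : ρ * (ρ ^ J * (L + 1)) ≤ ρ * dist ((z - p i) / (p (i + 1) - p i)) a := by
          linarith
        exact le_of_mul_le_mul_left h4 hρ
      · intro i hi he
        exact hzA ⟨i / b, ⟨by positivity, div_le_one_of_le₀ (by exact_mod_cast hi) (by positivity)⟩,
          (hγ.vertex_mem hi hg.zero).trans he⟩
  obtain ⟨ε, hε, hball⟩ := Metric.isOpen_iff.mp hc.isClosed.isOpen_compl z hz
  obtain ⟨J, hJ⟩ := exists_pow_lt_of_lt_one (show 0 < ε / (L + 1) by positivity) hg.lt_one
  refine key J z fun a ha => ?_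
  by_contra! hlt
  have h1 : ρ ^ J * (L + 1) < ε := (lt_div_iff₀ (by positivity)).mp hJ
  exact hball (Metric.mem_ball'.mpr (hlt.trans h1)) ha

end IsSelfSimilarCurve
end
end VonKoch

namespace VonKoch
noncomputable section

/-! ### Loops in a simple snowflake -/

/-- A von Koch snowflake that is a simple closed curve parametrized by `κ`, with its
self-similar parametrization `loopCurve n γ` and a bounded component `Ω` of its complement. -/
structure IsKochLoop (n : ℕ) (r : ℝ) (γ κ : ℝ → ℂ) (Ω : Set ℂ) : Prop where
  three_le : 3 ≤ n
  pos : 0 < r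
  lt_one : r < 1
  curve : IsSelfSimilarCurve (n + 1) (koch n r) γ
  param : IsSimpleParam κ
  range_eq : range κ = range (loopCurve n γ)
  component : IsBoundedComponent (range (loopCurve n γ)) Ω

/-- The `j`-th point of the `J`-th subdivision. -/
def gridPoint (n : ℕ) (γ : ℝ → ℂ) (J : ℕ) (j : ℤ) : ℂ :=
  loopCurve n γ (j / ((n + 1 : ℕ) : ℝ) ^ J)

/-- The `j`-th chord of the `J`-th subdivision. -/
def chord (n : ℕ) (γ : ℝ → ℂ) (J : ℕ) (j : ℤ) : ℂ := gridPoint n γ J (j + 1) - gridPoint n γ J j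

/-- The defect of the `j`-th piece of the `J`-th subdivision. -/
def cellDefect (n : ℕ) (γ : ℝ → ℂ) (J : ℕ) (j : ℤ) (z : ℂ) : ℝ :=
  defect γ ((z - gridPoint n γ J j) / chord n γ J j)

namespace IsKochLoop

variable {n : ℕ} {r : ℝ} {γ κ : ℝ → ℂ} {Ω : Set ℂ} (h : IsKochLoop n r γ κ Ω)
include h

omit h in
theorem base_pos : (0 : ℝ) < ((n + 1 : ℕ) : ℝ) := by positivity

theorem continuous : Continuous (loopCurve n γ) := continuous_loopCurve h.three_le h.curve

theorem generator : IsGenerator (n + 1) (koch n r) (max (conjRatio r) r) :=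
  isGenerator_koch h.three_le h.pos h.lt_one

theorem step_ne_zero : ∀ i < n + 1, koch n r (i + 1) - koch n r i ≠ 0 := fun _ hi =>
  koch_step_ne_zero h.three_le h.pos h.lt_one hi

theorem isClosed_range : IsClosed (range (loopCurve n γ)) := by
  rw [← h.range_eq]; exact h.param.isCompact_range.isClosed

theorem exists_outside {y : ℂ} (hy : y ∈ range (loopCurve n γ)) {ε : ℝ} (hε : 0 < ε) :
    ∃ z ∈ Metric.ball y ε, z ∉ range (loopCurve n γ) ∧ z ∉ Ω := by
  have hΩ := h.component
  rw [← h.range_eq] at hΩ hy ⊢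
  obtain ⟨z, hz1, hz2⟩ := h.param.exists_mem_ball_outside hΩ hy hε
  exact ⟨z, hz1, fun hk => hz2 (Or.inl hk), fun hk => hz2 (Or.inr hk)⟩

theorem exists_inside {y : ℂ} (hy : y ∈ range (loopCurve n γ)) {ε : ℝ} (hε : 0 < ε) :
    ∃ z ∈ Metric.ball y ε, z ∈ Ω := by
  have hΩ := h.component
  rw [← h.range_eq] at hΩ hy
  exact h.param.exists_mem_ball_inside hΩ hy hε

theorem dense_compl_range : Dense (range (loopCurve n γ))ᶜ := by
  rw [dense_iff_inter_open]
  rintro U hU ⟨y, hy⟩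
  by_cases hyK : y ∈ range (loopCurve n γ)
  · obtain ⟨ε, hε, hball⟩ := Metric.isOpen_iff.mp hU y hy
    obtain ⟨z, hz, hzK, -⟩ := h.exists_outside hyK hε
    exact ⟨z, hball hz, hzK⟩
  · exact ⟨y, hy, hyK⟩

/-- A loop in the snowflake winds around all points of `Ω` equally often, and does not wind around
the points outside. -/
theorem exists_turn_loop {x y : ℝ} (hxy : x ≤ y) (he : loopCurve n γ x = loopCurve n γ y) :
    ∃ m : ℤ, (∀ z ∈ Ω, turn (fun t => loopCurve n γ t - z) x y = m) ∧
      ∀ z ∉ range (loopCurve n γ), z ∉ Ω → turn (fun t => loopCurve n γ t - z) x y = 0 := by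
  have hΩ := h.component
  rw [← h.range_eq] at hΩ ⊢
  obtain ⟨d, -, hd1, hd2⟩ := h.param.exists_winding hΩ
  -- In the parameter of the simple curve `κ` a closed subloop advances by an integer `m`, so it
  -- turns `m` times as often as `κ`.
  obtain ⟨u, hu, hΓ⟩ := h.param.exists_param_lift h.continuous h.range_eq.symm.subset
  obtain ⟨m, hm⟩ := h.param.inj (u x) (u y) (by rw [← hΓ, ← hΓ, he])
  have hΓ' : loopCurve n γ = fun t => κ (u t) := funext hΓ
  rw [hΓ']
  refine ⟨m * d, fun z hz => ?_, fun z hz hzΩ => ?_⟩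
  · rw [h.param.turn_comp (hΩ.subset_compl hz) hu hxy hm, hd1 z hz]
    push_cast; rfl
  · rw [h.param.turn_comp hz hu hxy hm, hd2 z hz hzΩ, mul_zero]

/-! Cells -/

theorem gridPoint_refine (J : ℕ) (j : ℤ) {i : ℕ} (hi : i ≤ n + 1) :
    gridPoint n γ (J + 1) ((n + 1 : ℕ) * j + i) =
      affineTo (gridPoint n γ J j) (gridPoint n γ J (j + 1)) (koch n r i) := by
  have := loopCurve_refine h.three_le h.curve (Nat.succ_pos n) J j hi rfl
  simp only [gridPoint]
  push_cast at this ⊢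
  exact this

theorem chord_refine (J : ℕ) (j : ℤ) {i : ℕ} (hi : i < n + 1) :
    chord n γ (J + 1) ((n + 1 : ℕ) * j + i) =
      chord n γ J j * (koch n r (i + 1) - koch n r i) := by
  have h1 := h.gridPoint_refine J j (i := i + 1) hi
  rw [Nat.cast_succ i, ← add_assoc] at h1
  rw [chord, h.gridPoint_refine J j hi.le, h1, affineTo, affineTo, chord]
  ring

omit h in
theorem exists_parent (j : ℤ) : ∃ (k : ℤ) (i : ℕ), i < n + 1 ∧ j = (n + 1 : ℕ) * k + i := by
  refine ⟨j / (n + 1 : ℕ), (j % (n + 1 : ℕ)).toNat, ?_, ?_⟩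
  · have := Int.emod_lt_of_pos j (show (0 : ℤ) < (n + 1 : ℕ) by omega)
    have := Int.emod_nonneg j (show (((n + 1 : ℕ)) : ℤ) ≠ 0 by omega)
    omega
  · rw [Int.toNat_of_nonneg (Int.emod_nonneg j (show (((n + 1 : ℕ)) : ℤ) ≠ 0 by omega))]
    exact (Int.mul_ediv_add_emod j _).symm

theorem gridPoint_zero (k : ℤ) : gridPoint n γ 0 k = centre n * (1 - unitRoot n ^ k) := by
  have := loopCurve_add h.three_le h.curve k (x := 0) (by simp)
  rw [h.curve.left 0 le_rfl, add_zero] at this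
  rw [gridPoint, pow_zero, div_one, this]; ring

theorem chord_zero (k : ℤ) : chord n γ 0 k = unitRoot n ^ k := by
  rw [chord, h.gridPoint_zero, h.gridPoint_zero, zpow_add_one₀ (unitRoot_ne_zero n)]
  linear_combination unitRoot n ^ k * centre_mul h.three_le

theorem chord_ne_zero (J : ℕ) (j : ℤ) : chord n γ J j ≠ 0 := by
  induction J generalizing j with
  | zero => rw [h.chord_zero]; exact zpow_ne_zero _ (unitRoot_ne_zero n)
  | succ J ih =>
    obtain ⟨k, i, hi, rfl⟩ := exists_parent (n := n) j
    rw [h.chord_refine J k hi]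
    exact mul_ne_zero (ih k) (h.step_ne_zero i hi)

theorem norm_chord_le (J : ℕ) (j : ℤ) : ‖chord n γ J j‖ ≤ max (conjRatio r) r ^ J := by
  induction J generalizing j with
  | zero => rw [h.chord_zero, norm_zpow, norm_unitRoot]; simp
  | succ J ih =>
    obtain ⟨k, i, hi, rfl⟩ := exists_parent (n := n) j
    rw [h.chord_refine J k hi, norm_mul, pow_succ]
    exact mul_le_mul (ih k) (h.generator.norm_le i hi) (norm_nonneg _)
      (pow_nonneg h.generator.nonneg _)

theorem cell_eq (J : ℕ) (j : ℤ) {x : ℝ} (hx : x ∈ Icc (0 : ℝ) 1) :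
    loopCurve n γ ((j + x) / ((n + 1 : ℕ) : ℝ) ^ J) =
      affineTo (gridPoint n γ J j) (gridPoint n γ J (j + 1)) (γ x) := by
  have := loopCurve_cell h.three_le h.curve (Nat.succ_pos n) J j hx
  simp only [gridPoint]
  push_cast at this ⊢
  exact this

/-- The preimage of a point off the snowflake under the similarity of a cell is off the curve. -/
theorem cell_notMem (J : ℕ) (j : ℤ) {z : ℂ} (hz : z ∉ range (loopCurve n γ)) :
    (z - gridPoint n γ J j) / chord n γ J j ∉ γ '' Icc 0 1 := by
  rintro ⟨x, hx, hxz⟩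
  refine hz ⟨_, (h.cell_eq J j hx).trans ?_⟩
  rw [hxz, affineTo, ← chord, mul_div_cancel₀ _ (h.chord_ne_zero J j)]
  ring

theorem excessAngle_nonneg {w : ℂ} (hw : ∀ i ≤ n + 1, koch n r i ≠ w) :
    0 ≤ excessAngle (n + 1) (koch n r) w :=
  excessAngle_koch_nonneg h.three_le h.pos h.lt_one hw

theorem vertex_ne {w : ℂ} (hw : w ∉ γ '' Icc 0 1) : ∀ i ≤ n + 1, koch n r i ≠ w := by
  intro i hi he
  refine hw ⟨i / (n + 1 : ℕ), ⟨by positivity,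
    div_le_one_of_le₀ (by exact_mod_cast hi) (by positivity)⟩, ?_⟩
  rw [h.curve.vertex_mem hi rfl, he]

theorem cellDefect_nonneg (J : ℕ) (j : ℤ) {z : ℂ} (hz : z ∉ range (loopCurve n γ)) :
    0 ≤ cellDefect n γ J j z :=
  h.curve.defect_nonneg h.generator (h.pos.trans_le (le_max_right _ _)) h.step_ne_zero
    (fun _ hw => h.excessAngle_nonneg hw) (h.cell_notMem J j hz)

theorem cellDefect_eq (J : ℕ) (j : ℤ) {z : ℂ} (hz : z ∉ range (loopCurve n γ)) :
    cellDefect n γ J j z =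
      ∑ i ∈ Finset.range (n + 1), cellDefect n γ (J + 1) ((n + 1 : ℕ) * j + i) z +
      excessAngle (n + 1) (koch n r) ((z - gridPoint n γ J j) / chord n γ J j) /
        (2 * Real.pi) := by
  rw [cellDefect, h.curve.defect_eq (Nat.succ_pos n) h.step_ne_zero (h.cell_notMem J j hz)]
  congr 1
  refine Finset.sum_congr rfl fun i hi => ?_
  have hin := Finset.mem_range.mp hi
  rw [cellDefect, h.chord_refine J j hin, h.gridPoint_refine J j hin.le, affineTo, ← chord]
  congr 1
  have h1 := h.chord_ne_zero J j
  have h2 := h.step_ne_zero i hin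
  field_simp
  ring

theorem cellDefect_child_le (J : ℕ) (j : ℤ) {i : ℕ} (hi : i < n + 1) {z : ℂ}
    (hz : z ∉ range (loopCurve n γ)) :
    cellDefect n γ (J + 1) ((n + 1 : ℕ) * j + i) z ≤ cellDefect n γ J j z := by
  rw [h.cellDefect_eq J j hz]
  have h1 := Finset.single_le_sum (f := fun i : ℕ =>
    cellDefect n γ (J + 1) ((n + 1 : ℕ) * j + i) z) (s := Finset.range (n + 1))
    (fun i _ => h.cellDefect_nonneg _ _ hz) (Finset.mem_range.mpr hi)
  have h2 := h.excessAngle_nonneg (h.vertex_ne (h.cell_notMem J j hz))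
  have h3 : 0 ≤ excessAngle (n + 1) (koch n r) ((z - gridPoint n γ J j) / chord n γ J j) /
    (2 * Real.pi) := div_nonneg h2 (by have := Real.pi_pos; positivity)
  linarith

theorem excessAngle_le_cellDefect (J : ℕ) (j : ℤ) {z : ℂ} (hz : z ∉ range (loopCurve n γ)) :
    excessAngle (n + 1) (koch n r) ((z - gridPoint n γ J j) / chord n γ J j) / (2 * Real.pi) ≤
      cellDefect n γ J j z := by
  rw [h.cellDefect_eq J j hz]
  exact le_add_of_nonneg_left (Finset.sum_nonneg fun i _ => h.cellDefect_nonneg _ _ hz)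

/-- The defects of the cells containing a given parameter decrease with the level. -/
theorem cellDefect_floor_le (t : ℝ) {J J' : ℕ} (hJ : J ≤ J') {z : ℂ}
    (hz : z ∉ range (loopCurve n γ)) :
    cellDefect n γ J' ⌊t * ((n + 1 : ℕ) : ℝ) ^ J'⌋ z ≤
      cellDefect n γ J ⌊t * ((n + 1 : ℕ) : ℝ) ^ J⌋ z := by
  induction J', hJ using Nat.le_induction with
  | base => exact le_rfl
  | succ J' hJ ih =>
    refine le_trans ?_ ih
    obtain ⟨k, i, hi, hk⟩ := exists_parent (n := n) ⌊t * ((n + 1 : ℕ) : ℝ) ^ (J' + 1)⌋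
    have hkf : k = ⌊t * ((n + 1 : ℕ) : ℝ) ^ J'⌋ := by
      symm
      have hb := base_pos (n := n)
      have h1 := Int.floor_le (t * ((n + 1 : ℕ) : ℝ) ^ (J' + 1))
      have h2 := Int.lt_floor_add_one (t * ((n + 1 : ℕ) : ℝ) ^ (J' + 1))
      rw [hk] at h1 h2
      have hi' : (i : ℝ) + 1 ≤ ((n + 1 : ℕ) : ℝ) := by exact_mod_cast hi
      have hi0 : (0 : ℝ) ≤ i := i.cast_nonneg
      rw [pow_succ, ← mul_assoc] at h1 h2
      rw [Int.cast_add, Int.cast_mul, Int.cast_natCast, Int.cast_natCast] at h1 h2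
      rw [Int.floor_eq_iff]
      constructor
      · by_contra! hc
        nlinarith
      · by_contra! hc
        nlinarith
    rw [hk, hkf]
    exact h.cellDefect_child_le J' _ hi hz

/-- Curve and chord have the same end points, so their turns differ by an integer. -/
theorem exists_cellDefect_eq_int (J : ℕ) (j : ℤ) {z : ℂ} (hz : z ∉ range (loopCurve n γ)) :
    ∃ m : ℤ, cellDefect n γ J j z = m := by
  have hw := h.cell_notMem J j hz
  set w := (z - gridPoint n γ J j) / chord n γ J j with hwdef
  obtain ⟨m, hm⟩ := exists_turn_eq_arg_add (f := fun x => γ x - w) zero_le_one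
    (h.curve.continuous.sub continuous_const).continuousOn
    (fun x hx he => hw ⟨x, hx, sub_eq_zero.mp he⟩)
  refine ⟨m, ?_⟩
  rw [cellDefect, ← hwdef, defect, hm, h.curve.left 0 le_rfl, h.curve.right 1 le_rfl]
  ring

theorem turn_cells (J : ℕ) (j : ℤ) (m : ℕ) {z : ℂ} (hz : z ∉ range (loopCurve n γ)) :
    turn (fun t => loopCurve n γ t - z) (j / ((n + 1 : ℕ) : ℝ) ^ J)
        (((j + m : ℤ) : ℝ) / ((n + 1 : ℕ) : ℝ) ^ J) =
      ∑ i ∈ Finset.range m, cellDefect n γ J (j + i) z +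
      ∑ i ∈ Finset.range m,
        ((gridPoint n γ J (j + i + 1) - z) / (gridPoint n γ J (j + i) - z)).arg /
          (2 * Real.pi) := by
  have hb := base_pos (n := n)
  have hmono : Monotone fun i : ℕ => (((j + i : ℤ) : ℝ) / ((n + 1 : ℕ) : ℝ) ^ J) := by
    intro i i' hii
    simp only
    gcongr
  have hsum := turn_sum (f := fun t => loopCurve n γ t - z) hmono m
    (h.continuous.sub continuous_const).continuousOn
    (fun x _ he => hz ⟨x, sub_eq_zero.mp he⟩)
  simp only [Nat.cast_zero, add_zero] at hsum
  rw [← hsum, ← Finset.sum_add_distrib]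
  refine Finset.sum_congr rfl fun i _ => ?_
  have := turn_cell h.continuous h.curve.continuous (h.chord_ne_zero J (j + i))
    (j := ((j + i : ℤ) : ℝ)) (pow_pos hb J) (fun x hx => h.cell_eq J (j + i) hx) (z := z)
    (fun hmem => hz (image_subset_range _ _ hmem))
  rw [cellDefect, chord, ← this]
  congr 1
  push_cast
  ring

/-- The total turn about an outside point is zero, but it is also the sum of the level-0 defects and
of the angle sum of a regular `n`-gon, all nonnegative. So the level-0 defects vanish, and a child's
defect is at most its parent's. -/
theorem cellDefect_eq_zero_of_outside {z : ℂ} (hz : z ∉ range (loopCurve n γ)) (hzΩ : z ∉ Ω)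
    (J : ℕ) (j : ℤ) : cellDefect n γ J j z = 0 := by
  refine le_antisymm ?_ (h.cellDefect_nonneg J j hz)
  induction J generalizing j with
  | zero =>
    have h1 := h.turn_cells 0 j n hz
    obtain ⟨m, -, hm⟩ := h.exists_turn_loop (x := j) (y := j + n) (by simp)
      (loopCurve_add_period h.three_le _).symm
    simp only [pow_zero, div_one] at h1
    push_cast at h1
    rw [hm z hz hzΩ, ← Finset.sum_div] at h1
    have hc := centre_ne_zero h.three_le
    have hω := zpow_ne_zero j (unitRoot_ne_zero n)
    have h2 : ∀ i ∈ Finset.range n,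
        ((gridPoint n γ 0 (j + i + 1) - z) / (gridPoint n γ 0 (j + i) - z)).arg =
        edgeAngle n ((centre n - z) / (centre n * unitRoot n ^ j)) i := by
      intro i _
      have h3 : ∀ k : ℕ, centre n * (1 - unitRoot n ^ (j + k)) - z =
          -(centre n * unitRoot n ^ j) *
            (unitRoot n ^ k - (centre n - z) / (centre n * unitRoot n ^ j)) := by
        intro k
        rw [zpow_add₀ (unitRoot_ne_zero n), zpow_natCast]
        field_simp
        ring
      have h4 := h3 (i + 1)
      rw [Nat.cast_succ, ← add_assoc] at h4
      rw [h.gridPoint_zero, h.gridPoint_zero, h4, h3, mul_div_mul_left _ _ (by simp [hc, hω]),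
        edgeAngle]
    rw [Finset.sum_congr rfl h2] at h1
    have h5 := sum_edgeAngle_nonneg h.three_le ((centre n - z) / (centre n * unitRoot n ^ j))
    have h6 := div_nonneg h5 (show 0 ≤ 2 * Real.pi by have := Real.pi_pos; positivity)
    have h7 := Finset.single_le_sum (f := fun i : ℕ => cellDefect n γ 0 (j + i) z)
      (s := Finset.range n) (fun i _ => h.cellDefect_nonneg _ _ hz)
      (Finset.mem_range.mpr (show 0 < n by have := h.three_le; omega))
    simp only [Nat.cast_zero, add_zero] at h7
    linarith
  | succ J ih =>
    obtain ⟨k, i, hi, rfl⟩ := exists_parent (n := n) j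
    exact (h.cellDefect_child_le J k hi hz).trans (ih k)

end IsKochLoop
end
end VonKoch

namespace VonKoch
noncomputable section

/-! ### Closed subloops turn positively around the component. -/

namespace IsKochLoop

variable {n : ℕ} {r : ℝ} {γ κ : ℝ → ℂ} {Ω : Set ℂ} (h : IsKochLoop n r γ κ Ω)
include h

theorem one_lt_base : (1 : ℝ) < ((n + 1 : ℕ) : ℝ) := by
  have := h.three_le
  exact_mod_cast (by omega : 1 < n + 1)

theorem eventually_inv_base_lt {ε : ℝ} (hε : 0 < ε) :
    ∀ᶠ J : ℕ in atTop, 1 / ((n + 1 : ℕ) : ℝ) ^ J < ε := by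
  have h1 := tendsto_inv_atTop_zero.comp (tendsto_pow_atTop_atTop_of_one_lt h.one_lt_base)
  filter_upwards [h1.eventually (gt_mem_nhds hε)] with J hJ
  rw [one_div]; exact hJ

theorem exists_cell {x x' : ℝ} (hx : x < x') :
    ∃ (J : ℕ) (j : ℤ), x < j / ((n + 1 : ℕ) : ℝ) ^ J ∧ (j + 1) / ((n + 1 : ℕ) : ℝ) ^ J < x' := by
  obtain ⟨J, hJ⟩ := (h.eventually_inv_base_lt (ε := (x' - x) / 2) (by linarith)).exists
  have hb : (0 : ℝ) < ((n + 1 : ℕ) : ℝ) ^ J := pow_pos (base_pos (n := n)) J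
  refine ⟨J, ⌊x * ((n + 1 : ℕ) : ℝ) ^ J⌋ + 1, ?_, ?_⟩
  · rw [lt_div_iff₀ hb]
    rw [Int.cast_add, Int.cast_one]
    exact Int.lt_floor_add_one _
  · have h1 := Int.floor_le (x * ((n + 1 : ℕ) : ℝ) ^ J)
    rw [div_lt_iff₀ hb] at hJ ⊢
    push_cast at *
    nlinarith

/-- Every parameter interval contains a cell, and the vertices `0`, `ℓ`, `ℓ - r ω` of the generator
are not collinear, so no cell lies in a line. -/
theorem dense_off_line {P B : ℂ} (hB : B ≠ 0) :
    Dense {t : ℝ | ((loopCurve n γ t - P) / B).im ≠ 0} := by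
  rw [dense_iff_inter_open]
  rintro U hU ⟨t, ht⟩
  obtain ⟨ε, hε, hball⟩ := Metric.isOpen_iff.mp hU t ht
  obtain ⟨J, j, hj1, hj2⟩ := h.exists_cell (x := t - ε) (x' := t + ε) (by linarith)
  have hb : (0 : ℝ) < ((n + 1 : ℕ) : ℝ) ^ J := pow_pos (base_pos (n := n)) J
  have hn := h.three_le
  have hpt : ∀ i ≤ n + 1, (j + (i : ℝ) / (n + 1 : ℕ)) / ((n + 1 : ℕ) : ℝ) ^ J ∈ U ∧
      loopCurve n γ ((j + (i : ℝ) / (n + 1 : ℕ)) / ((n + 1 : ℕ) : ℝ) ^ J) =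
        affineTo (gridPoint n γ J j) (gridPoint n γ J (j + 1)) (koch n r i) := by
    intro i hi
    have hx : (i : ℝ) / (n + 1 : ℕ) ∈ Icc (0 : ℝ) 1 := ⟨by positivity,
      div_le_one_of_le₀ (by exact_mod_cast hi) (by positivity)⟩
    refine ⟨hball ?_, ?_⟩
    · rw [Real.ball_eq_Ioo]
      refine ⟨hj1.trans_le ?_, lt_of_le_of_lt ?_ hj2⟩
      · gcongr; linarith [hx.1]
      · gcongr; exact hx.2
    · rw [h.cell_eq J j hx, h.curve.vertex_mem hi rfl]
  by_contra hcon
  have hz : ∀ i ≤ n + 1, ((affineTo (gridPoint n γ J j) (gridPoint n γ J (j + 1)) (koch n r i) - P)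
      / B).im = 0 := by
    intro i hi
    obtain ⟨h1, h2⟩ := hpt i hi
    by_contra hne
    exact hcon ⟨_, h1, by rw [mem_ofPred_eq, h2]; exact hne⟩
  set A := (gridPoint n γ J j - P) / B with hA
  set D := chord n γ J j / B with hD
  have hz' : ∀ i ≤ n + 1, (A + D * koch n r i).im = 0 := by
    intro i hi
    rw [← hz i hi, affineTo, ← chord, hA, hD]
    congr 1; ring
  have h0 := hz' 0 (by omega)
  have h1 := hz' 1 (by omega)
  have h2 := hz' 2 (by omega)
  rw [koch_zero, mul_zero, add_zero] at h0
  have hℓ := conjRatio_pos h.lt_one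
  have e1 : koch n r 1 = conjRatio r := by have := koch_step_zero hn (r := r); rwa [koch_zero, sub_zero] at this
  have e2 : koch n r 2 = conjRatio r - r * unitRoot n := by
    rw [koch_succ (by omega : 1 < n)]; simp
  rw [e1] at h1
  rw [e2] at h2
  have hDim : D.im = 0 := by
    have : D.im * conjRatio r = 0 := by simpa [h0] using h1
    simpa [hℓ.ne'] using this
  have hω : (unitRoot n).im = Real.sin (centralAngle n) := by
    rw [unitRoot, Complex.exp_ofReal_mul_I_im]
  have hs := Real.sin_pos_of_pos_of_lt_pi (centralAngle_pos hn) (centralAngle_lt_pi hn)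
  have hDre : D.re = 0 := by
    have : D.re * (r * (unitRoot n).im) = 0 := by simpa [h0, hDim] using h2
    rw [hω] at this
    rcases mul_eq_zero.mp this with h3 | h3
    · exact h3
    · exact absurd h3 (mul_pos h.pos hs).ne'
  exact div_ne_zero (h.chord_ne_zero J j) hB (Complex.ext hDre hDim)

/-- Arbitrarily close to each parameter, the loop is off all lines spanned by chords of a given
level. -/
theorem exists_off_lines (J : ℕ) {a b : ℝ} (hab : a < b) :
    ∃ t ∈ Ioo a b, ∀ j : ℤ, ((loopCurve n γ t - gridPoint n γ J j) / chord n γ J j).im ≠ 0 := by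
  -- Baire's theorem for the countably many chords of one level.
  have hd := dense_iInter_of_isOpen (f := fun j : ℤ =>
      {t : ℝ | ((loopCurve n γ t - gridPoint n γ J j) / chord n γ J j).im ≠ 0})
    (fun j => isOpen_ne_fun (Complex.continuous_im.comp
      ((h.continuous.sub continuous_const).div_const _)) continuous_const)
    (fun j => h.dense_off_line (h.chord_ne_zero J j))
  obtain ⟨t, ht1, ht2⟩ := hd.inter_open_nonempty _ isOpen_Ioo (nonempty_Ioo.mpr hab)
  exact ⟨t, ht1, fun j => mem_iInter.mp ht2 j⟩

omit h in
-- The quotient `(Q - y) / (P - y)` is real only when `y` is on the line through `P` and `Q`; off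
-- this line it avoids the branch cut.
theorem continuousAt_arg_chord {P Q y : ℂ} (hy : ((y - P) / (Q - P)).im ≠ 0) :
    ContinuousAt (fun z => ((Q - z) / (P - z)).arg) y := by
  have hPy : P - y ≠ 0 := by
    intro he
    rw [← neg_sub, he] at hy; simp at hy
  have hPQ : Q - P ≠ 0 := by
    intro he
    rw [he] at hy; simp at hy
  have hslit : (Q - y) / (P - y) ∈ Complex.slitPlane := by
    refine Or.inr fun him => hy ?_
    have e : (y - P) / (Q - P) = 1 / (1 - (Q - y) / (P - y)) := by
      have : 1 - (Q - y) / (P - y) = (Q - P) / (y - P) := by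
        have : y - P ≠ 0 := by rw [← neg_sub]; exact neg_ne_zero.mpr hPy
        rw [← neg_sub y P, div_neg]; field_simp; ring
      rw [this, one_div_div]
    obtain ⟨s, hs⟩ : ∃ s : ℝ, (Q - y) / (P - y) = s :=
      ⟨((Q - y) / (P - y)).re, Complex.ext rfl (by simpa using him)⟩
    rw [e, hs, show (1 : ℂ) / (1 - s) = ((1 / (1 - s) : ℝ) : ℂ) by push_cast; rfl,
      Complex.ofReal_im]
  have h2 := Complex.continuousAt_arg hslit
  exact ContinuousAt.comp (f := fun z => (Q - z) / (P - z)) h2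
    ((continuousAt_const.sub continuousAt_id).div (continuousAt_const.sub continuousAt_id) hPy)

/-- Near a point of general position, the number of turns of a loop is a sum of defects. -/
theorem eventually_turn_eq_sum {x x' : ℝ} (hxx : x ≤ x')
    (he : loopCurve n γ x = loopCurve n γ x') (J : ℕ) (a : ℤ) (m : ℕ)
    (ha : x ≤ a / ((n + 1 : ℕ) : ℝ) ^ J) (hm : ((a + m : ℤ) : ℝ) / ((n + 1 : ℕ) : ℝ) ^ J ≤ x')
    {y : ℂ} (hyK : y ∈ range (loopCurve n γ))
    (hy1 : y ∉ loopCurve n γ '' Icc x (a / ((n + 1 : ℕ) : ℝ) ^ J))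
    (hy2 : y ∉ loopCurve n γ '' Icc (((a + m : ℤ) : ℝ) / ((n + 1 : ℕ) : ℝ) ^ J) x')
    (hy3 : ∀ j : ℤ, ((y - gridPoint n γ J j) / chord n γ J j).im ≠ 0) :
    ∀ᶠ z in 𝓝 y, z ∉ range (loopCurve n γ) → turn (fun t => loopCurve n γ t - z) x x' =
      ∑ i ∈ Finset.range m, cellDefect n γ J (a + i) z := by
  set α := (a : ℝ) / ((n + 1 : ℕ) : ℝ) ^ J with hα
  set β := ((a + m : ℤ) : ℝ) / ((n + 1 : ℕ) : ℝ) ^ J with hβ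
  have hαβ : α ≤ β := by
    have hb := base_pos (n := n)
    rw [hα, hβ]; gcongr; simp
  -- `G` collects all of the turn except the defects of the complete cells. It is continuous at `y`
  -- and integral off the curve, and it vanishes at outside points, where both the loop's turn and
  -- the defects are zero. Outside points exist arbitrarily near `y`, so `G = 0` near `y` off the
  -- curve.
  set G : ℂ → ℝ := fun z => turn (fun t => loopCurve n γ t - z) x α +
    (∑ i ∈ Finset.range m,
        ((gridPoint n γ J (a + i + 1) - z) / (gridPoint n γ J (a + i) - z)).arg /
          (2 * Real.pi)) + turn (fun t => loopCurve n γ t - z) β x' with hG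
  have hcont : ContinuousAt G y := by
    refine ((ContinuousAt.add ?_ (tendsto_finsetSum _ fun i _ => ?_)).add ?_)
    · exact (turn_sub_continuousOn ha h.continuous.continuousOn).continuousAt
        ((isCompact_Icc.image h.continuous).isClosed.isOpen_compl.mem_nhds hy1)
    · exact (continuousAt_arg_chord (hy3 (a + i))).div_const _
    · exact (turn_sub_continuousOn hm h.continuous.continuousOn).continuousAt
        ((isCompact_Icc.image h.continuous).isClosed.isOpen_compl.mem_nhds hy2)
  have hsum : ∀ z ∉ range (loopCurve n γ), turn (fun t => loopCurve n γ t - z) x x' =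
      G z + ∑ i ∈ Finset.range m, cellDefect n γ J (a + i) z := by
    intro z hz
    have hc : ∀ s : Set ℝ, ContinuousOn (fun t => loopCurve n γ t - z) s := fun s =>
      (h.continuous.sub continuous_const).continuousOn
    have h0 : ∀ t, loopCurve n γ t - z ≠ 0 := fun t he => hz ⟨t, sub_eq_zero.mp he⟩
    rw [← turn_add (ha.trans hαβ) hm (hc _) (fun t _ => h0 t),
      ← turn_add ha hαβ (hc _) (fun t _ => h0 t), h.turn_cells J a m hz]
    simp only [hG]; ring
  have hint : ∀ z ∉ range (loopCurve n γ), ∃ k : ℤ, G z = k := by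
    intro z hz
    obtain ⟨k, hk⟩ := exists_turn_eq_int hxx
      (h.continuous.sub continuous_const).continuousOn (f := fun t => loopCurve n γ t - z)
      (fun t _ he => hz ⟨t, sub_eq_zero.mp he⟩) (by simp only [he])
    choose d hd using fun i : ℕ => h.exists_cellDefect_eq_int J (a + i) hz
    refine ⟨k - ∑ i ∈ Finset.range m, d i, ?_⟩
    have := hsum z hz
    rw [hk, Finset.sum_congr rfl (fun i _ => hd i)] at this
    push_cast
    linarith
  obtain ⟨ε, hε, hball⟩ := Metric.continuousAt_iff.mp hcont (1 / 2) (by norm_num)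
  obtain ⟨z₁, hz₁, hz₁K, hz₁Ω⟩ := h.exists_outside hyK hε
  have hG1 : G z₁ = 0 := by
    obtain ⟨m', -, hm'⟩ := h.exists_turn_loop hxx he
    have := hsum z₁ hz₁K
    rw [hm' z₁ hz₁K hz₁Ω, Finset.sum_eq_zero
      (fun i _ => h.cellDefect_eq_zero_of_outside hz₁K hz₁Ω J (a + (i : ℕ)))] at this
    linarith
  filter_upwards [Metric.ball_mem_nhds y hε] with z hz hzK
  rw [hsum z hzK]
  obtain ⟨k, hk⟩ := hint z hzK
  have h1 := hball (Metric.mem_ball.mp hz)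
  have h2 := hball (Metric.mem_ball.mp hz₁)
  rw [hG1, Real.dist_eq] at h2
  rw [Real.dist_eq] at h1
  have : |(k : ℝ)| < 1 := by
    rw [← hk]
    have h3 := abs_sub_abs_le_abs_sub (G z) (G y)
    rw [zero_sub, abs_neg] at h2
    linarith
  have hk0 : k = 0 := Int.abs_lt_one_iff.mp (by exact_mod_cast this)
  rw [hk, hk0]; simp

/-- Close to each point of the loop there are points at which the defect of the cell is
positive. -/
theorem frequently_cellDefect_pos (t : ℝ) (J : ℕ) :
    ∃ᶠ z in 𝓝 (loopCurve n γ t), z ∉ range (loopCurve n γ) ∧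
      0 < cellDefect n γ J ⌊t * ((n + 1 : ℕ) : ℝ) ^ J⌋ z := by
  rw [frequently_iff]
  intro U hU
  obtain ⟨ε, hε, hball⟩ := Metric.mem_nhds_iff.mp hU
  obtain ⟨M, hM⟩ := (isCompact_Icc (a := (0 : ℝ)) (b := 1)).exists_bound_of_continuousOn
    h.curve.continuous.continuousOn
  have hM0 : 0 ≤ M := (norm_nonneg _).trans (hM 0 ⟨le_rfl, zero_le_one⟩)
  set ρ := max (conjRatio r) r with hρ
  have hρ1 : ρ < 1 := h.generator.lt_one
  have htend : Tendsto (fun J : ℕ => (M + ‖bumpCentre n r‖) * ρ ^ J) atTop (𝓝 0) := by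
    simpa using (tendsto_pow_atTop_nhds_zero_of_lt_one h.generator.nonneg hρ1).const_mul
      (M + ‖bumpCentre n r‖)
  -- At a fine level `J'` the bump centre of the cell containing `t` is within `ε` of the loop
  -- point. Near it the excess angle is positive, which bounds the defect of that cell, and so of
  -- its ancestor at level `J`, from below.
  obtain ⟨J', hJ', hJJ'⟩ := ((htend.eventually (gt_mem_nhds hε)).and
    (eventually_ge_atTop J)).exists
  set j := ⌊t * ((n + 1 : ℕ) : ℝ) ^ J'⌋ with hj
  have hb : (0 : ℝ) < ((n + 1 : ℕ) : ℝ) ^ J' := pow_pos (base_pos (n := n)) J'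
  set P := gridPoint n γ J' j with hP
  set c := chord n γ J' j with hc
  have hc0 : c ≠ 0 := h.chord_ne_zero J' j
  have hy : loopCurve n γ t = P + c * γ (Int.fract (t * ((n + 1 : ℕ) : ℝ) ^ J')) := by
    have := h.cell_eq J' j (x := Int.fract (t * ((n + 1 : ℕ) : ℝ) ^ J'))
      ⟨Int.fract_nonneg _, (Int.fract_lt_one _).le⟩
    rw [Int.floor_add_fract, mul_div_cancel_right₀ _ hb.ne'] at this
    rw [this, affineTo, ← chord]
  set q := P + c * bumpCentre n r with hq
  have hqball : q ∈ Metric.ball (loopCurve n γ t) ε := by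
    rw [Metric.mem_ball, dist_eq_norm, hy, hq]
    refine lt_of_le_of_lt ?_ hJ'
    rw [add_sub_add_left_eq_sub, ← mul_sub, norm_mul, mul_comm]
    refine mul_le_mul ?_ (h.norm_chord_le J' j) (norm_nonneg _) (by positivity)
    refine (norm_sub_le _ _).trans ?_
    rw [add_comm]
    gcongr
    exact hM _ ⟨Int.fract_nonneg _, (Int.fract_lt_one _).le⟩
  have hev : ∀ᶠ z in 𝓝 q, (∀ i ≤ n + 1, koch n r i ≠ (z - P) / c) →
      0 < excessAngle (n + 1) (koch n r) ((z - P) / c) := by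
    have hcont : Tendsto (fun z => (z - P) / c) (𝓝 q) (𝓝 (bumpCentre n r)) := by
      have : ContinuousAt (fun z => (z - P) / c) q := by fun_prop
      have h2 := this.tendsto
      rwa [show (q - P) / c = bumpCentre n r by rw [hq]; field_simp; ring] at h2
    exact hcont.eventually (eventually_excessAngle_koch_pos h.three_le h.pos h.lt_one)
  obtain ⟨z, hz, hzK⟩ := mem_closure_iff_nhds.mp (h.dense_compl_range q) _
    (hev.and (Metric.isOpen_ball.mem_nhds hqball))
  refine ⟨z, hball hz.2, hzK, ?_⟩
  refine lt_of_lt_of_le ?_ (h.cellDefect_floor_le t hJJ' hzK)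
  refine lt_of_lt_of_le ?_ (h.excessAngle_le_cellDefect J' _ hzK)
  exact div_pos (hz.1 (h.vertex_ne (h.cell_notMem J' _ hzK))) (by have := Real.pi_pos; positivity)

/-- A loop in the snowflake winds around `Ω` at least once. -/
theorem one_le_turn_loop {x x' : ℝ} (hxx : x < x') (he : loopCurve n γ x = loopCurve n γ x')
    {z : ℂ} (hz : z ∈ Ω) : 1 ≤ turn (fun t => loopCurve n γ t - z) x x' := by
  obtain ⟨k, hk1, hk2⟩ := h.exists_turn_loop hxx.le he
  rw [hk1 z hz]
  suffices hpos : (0 : ℝ) < k by exact_mod_cast hpos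
  -- A parameter interval around `t₀` is chosen whose image `Y` misses the base point of the loop,
  -- so that points of `Y` stay away from the incomplete cells at the two ends.
  obtain ⟨t₀, ht₀, hg⟩ : ∃ t ∈ Ioo x x', loopCurve n γ t ≠ loopCurve n γ x := by
    obtain ⟨J, j, hj1, hj2⟩ := h.exists_cell hxx
    have hb : (0 : ℝ) < ((n + 1 : ℕ) : ℝ) ^ J := pow_pos (base_pos (n := n)) J
    have hlt : (j : ℝ) / ((n + 1 : ℕ) : ℝ) ^ J < (j + 1) / ((n + 1 : ℕ) : ℝ) ^ J := by
      gcongr; linarith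
    by_contra! hcon
    have h1 := hcon _ ⟨hj1, hlt.trans hj2⟩
    have h2 := hcon _ ⟨hj1.trans hlt, hj2⟩
    refine h.chord_ne_zero J j ?_
    rw [chord, gridPoint, gridPoint]
    push_cast at h1 h2 ⊢
    rw [h1, h2, sub_self]
  obtain ⟨η, hη, hball⟩ : ∃ η > 0, ∀ t ∈ Icc (t₀ - η) (t₀ + η), x < t ∧ t < x' ∧
      loopCurve n γ t ≠ loopCurve n γ x := by
    have hev : ∀ᶠ t in 𝓝 t₀, x < t ∧ t < x' ∧ loopCurve n γ t ≠ loopCurve n γ x :=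
      ((lt_mem_nhds ht₀.1).and ((gt_mem_nhds ht₀.2).and
        (h.continuous.continuousAt.eventually_ne hg)))
    obtain ⟨η, hη, hs⟩ := Metric.nhds_basis_closedBall.mem_iff.mp hev
    refine ⟨η, hη, fun t ht => ?_⟩
    exact hs (by rw [Real.closedBall_eq_Icc]; exact ht)
  have hYc : IsClosed (loopCurve n γ '' Icc (t₀ - η) (t₀ + η)) :=
    (isCompact_Icc.image h.continuous).isClosed
  have hgY : loopCurve n γ x ∈ (loopCurve n γ '' Icc (t₀ - η) (t₀ + η))ᶜ := by
    rintro ⟨t, ht, hte⟩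
    exact (hball t ht).2.2 hte
  have hnx : ∀ s, loopCurve n γ s = loopCurve n γ x →
      ∃ ε > 0, ∀ t, |t - s| < ε → loopCurve n γ t ∉ loopCurve n γ '' Icc (t₀ - η) (t₀ + η) := by
    intro s hs
    have := (h.continuous.continuousAt (x := s)).eventually
      (hYc.isOpen_compl.mem_nhds (by rw [hs]; exact hgY))
    obtain ⟨ε, hε, hs⟩ := Metric.eventually_nhds_iff.mp this
    exact ⟨ε, hε, fun t ht => hs (by rwa [Real.dist_eq])⟩
  obtain ⟨ε₁, hε₁, hx1⟩ := hnx x rfl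
  obtain ⟨ε₂, hε₂, hx2⟩ := hnx x' he.symm
  have hl := (hball (t₀ - η) ⟨le_rfl, by linarith⟩).1
  have hr := (hball (t₀ + η) ⟨by linarith, le_rfl⟩).2.1
  -- The level is so fine that the parts of `[x, x']` left over by complete cells map off `Y`, and
  -- the cell of any parameter near `t₀` is complete.
  obtain ⟨J, hJ1, hJ2, hJ3, hJ4⟩ := ((h.eventually_inv_base_lt hε₁).and
    ((h.eventually_inv_base_lt hε₂).and ((h.eventually_inv_base_lt (sub_pos.mpr hl)).and
    (h.eventually_inv_base_lt (sub_pos.mpr hr))))).exists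
  set b := ((n + 1 : ℕ) : ℝ) ^ J with hbdef
  have hb : 0 < b := pow_pos (base_pos (n := n)) J
  obtain ⟨t, ht, hoff⟩ := h.exists_off_lines J (a := t₀ - η) (b := t₀ + η) (by linarith)
  have ha1 : x ≤ ⌈x * b⌉ / b := by rw [le_div_iff₀ hb]; exact Int.le_ceil _
  have ha2 : ⌈x * b⌉ / b < x + 1 / b := by
    rw [div_lt_iff₀ hb, add_mul, one_div_mul_cancel hb.ne']; exact Int.ceil_lt_add_one _
  have hc1 : ⌊x' * b⌋ / b ≤ x' := by rw [div_le_iff₀ hb]; exact Int.floor_le _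
  have hc2 : x' - 1 / b < ⌊x' * b⌋ / b := by
    rw [lt_div_iff₀ hb, sub_mul, one_div_mul_cancel hb.ne']; exact Int.sub_one_lt_floor _
  have hfl1 : ⌈x * b⌉ ≤ ⌊t * b⌋ := by
    rw [Int.le_floor, ← div_le_iff₀ hb]; linarith [ht.1]
  have hfl2 : ⌊t * b⌋ < ⌊x' * b⌋ := by
    rw [Int.floor_lt, ← lt_div_iff₀ hb]; linarith [ht.2]
  obtain ⟨m, hm⟩ := Int.eq_ofNat_of_zero_le (sub_nonneg.mpr (hfl1.trans hfl2.le))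
  have hm' : ⌈x * b⌉ + (m : ℤ) = ⌊x' * b⌋ := by omega
  obtain ⟨i, hi⟩ := Int.eq_ofNat_of_zero_le (sub_nonneg.mpr hfl1)
  have hi' : ⌊t * b⌋ = ⌈x * b⌉ + (i : ℤ) := by omega
  have him : i < m := by omega
  have hyY : loopCurve n γ t ∈ loopCurve n γ '' Icc (t₀ - η) (t₀ + η) :=
    mem_image_of_mem _ ⟨ht.1.le, ht.2.le⟩
  have hev := h.eventually_turn_eq_sum hxx.le he J ⌈x * b⌉ m ha1 (by rw [hm']; exact hc1)
    (mem_range_self t) (by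
      rintro ⟨s, hs, hse⟩
      exact hx1 s (by rw [abs_lt]; constructor <;> linarith [hs.1, hs.2]) (hse ▸ hyY)) (by
      rw [hm']
      rintro ⟨s, hs, hse⟩
      exact hx2 s (by rw [abs_lt]; constructor <;> linarith [hs.1, hs.2]) (hse ▸ hyY)) hoff
  -- Near the generic point the turn is a sum of nonnegative defects, one of them positive at `z₂`.
  -- Outside `Ω` the turn vanishes, so `z₂` lies in `Ω` and the common turn is positive.
  obtain ⟨z₂, ⟨hz₂K, hz₂⟩, hz₂eq⟩ := ((h.frequently_cellDefect_pos t J).and_eventually hev).exists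
  have hW : 0 < turn (fun t => loopCurve n γ t - z₂) x x' := by
    rw [hz₂eq hz₂K]
    refine Finset.sum_pos' (fun i _ => h.cellDefect_nonneg J _ hz₂K)
      ⟨i, Finset.mem_range.mpr him, ?_⟩
    rw [← hi']; exact hz₂
  by_cases hΩ : z₂ ∈ Ω
  · rwa [hk1 z₂ hΩ] at hW
  · rw [hk2 z₂ hz₂K hΩ] at hW
    exact absurd hW (lt_irrefl _)

end IsKochLoop
end
end VonKoch

namespace VonKoch
noncomputable section

/-! ### Injectivity of the self-similar parametrization. -/

namespace IsKochLoop

variable {n : ℕ} {r : ℝ} {γ κ : ℝ → ℂ} {Ω : Set ℂ} (h : IsKochLoop n r γ κ Ω)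
include h

theorem loop_add_period (t : ℝ) : loopCurve n γ (t + n) = loopCurve n γ t :=
  loopCurve_add_period h.three_le t

theorem loop_add_int_period (t : ℝ) (k : ℤ) : loopCurve n γ (t + k * n) = loopCurve n γ t :=
  (show Function.Periodic (loopCurve n γ) n from h.loop_add_period).int_mul k t

omit h in
theorem sub_ne_zero_of_notMem {z : ℂ} (hz : z ∉ range (loopCurve n γ)) (t : ℝ) :
    loopCurve n γ t - z ≠ 0 := fun he => hz ⟨t, sub_eq_zero.mp he⟩

theorem component_notMem {z : ℂ} (hz : z ∈ Ω) : z ∉ range (loopCurve n γ) :=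
  h.component.subset_compl hz

theorem turn_add' {z : ℂ} (hz : z ∉ range (loopCurve n γ)) {a b c : ℝ} (hab : a ≤ b) (hbc : b ≤ c) :
    turn (fun t => loopCurve n γ t - z) a b + turn (fun t => loopCurve n γ t - z) b c =
      turn (fun t => loopCurve n γ t - z) a c :=
  turn_add hab hbc (h.continuous.sub continuous_const).continuousOn
    fun t _ => sub_ne_zero_of_notMem hz t

theorem turn_period_eq {z : ℂ} (hz : z ∉ range (loopCurve n γ)) {a b : ℝ} (hab : a ≤ b) :
    turn (fun t => loopCurve n γ t - z) a (a + n) =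
      turn (fun t => loopCurve n γ t - z) b (b + n) := by
  have h1 := h.turn_add' hz (a := a) (b := a + n) (c := b + n) (by simp) (by linarith)
  have h2 := h.turn_add' hz (a := a) (b := b) (c := b + n) hab (by simp)
  have h3 := turn_comp_affine (f := fun t => loopCurve n γ t - z) (m := 1) (k := n) one_pos hab
    (h.continuous.sub continuous_const).continuousOn fun t _ => sub_ne_zero_of_notMem hz t
  simp only [one_mul, h.loop_add_period] at h3
  linarith

/-- By self-similarity a double point of `γ` reappears in an arbitrarily small cell at the loop
point `0`. Seen from a fixed point of `Ω` the resulting loop stays in a half-plane and turns zero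
times, against `one_le_turn_loop`. -/
theorem injOn_curve : InjOn γ (Icc 0 1) := by
  suffices hlt : ∀ s ∈ Icc (0 : ℝ) 1, ∀ s' ∈ Icc (0 : ℝ) 1, s < s' → γ s ≠ γ s' by
    intro s hs s' hs' he
    rcases lt_trichotomy s s' with hl | hl | hl
    · exact absurd he (hlt s hs s' hs' hl)
    · exact hl
    · exact absurd he.symm (hlt s' hs' s hs hl)
  intro s hs s' hs' hlt he
  obtain ⟨z, hz⟩ := h.component.nonempty
  have hzK := h.component_notMem hz
  have h00 : loopCurve n γ 0 = 0 := by
    have := h.gridPoint_zero 0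
    simpa [gridPoint] using this
  have hz0 : z ≠ 0 := fun h0 => hzK ⟨0, by rw [h0, h00]⟩
  obtain ⟨ε, hε, hball⟩ := Metric.continuousAt_iff.mp (h.continuous.continuousAt (x := 0)) ‖z‖
    (norm_pos_iff.mpr hz0)
  obtain ⟨J, hJ⟩ := (h.eventually_inv_base_lt hε).exists
  set b := ((n + 1 : ℕ) : ℝ) ^ J
  have hb : 0 < b := pow_pos (base_pos (n := n)) J
  have hloop : loopCurve n γ (s / b) = loopCurve n γ (s' / b) := by
    have h1 := h.cell_eq J 0 hs
    have h2 := h.cell_eq J 0 hs'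
    rw [Int.cast_zero, zero_add] at h1 h2
    rw [h1, h2, he]
  have hlt' : s / b < s' / b := by gcongr
  have h1 := h.one_le_turn_loop hlt' hloop hz
  rw [turn_of_div_slitPlane (f := fun t => loopCurve n γ t - z) (c := -z⁻¹) (by simp [hz0]) hlt'.le
    (h.continuous.sub continuous_const).continuousOn, hloop, sub_self, zero_div] at h1
  · linarith
  intro t ht
  have htb : dist t 0 < ε := by
    rw [dist_zero_right, Real.norm_of_nonneg ((div_nonneg hs.1 hb.le).trans ht.1)]
    refine lt_of_le_of_lt (ht.2.trans ?_) hJ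
    gcongr; exact hs'.2
  have h2 := hball htb
  rw [h00, dist_zero_right] at h2
  left
  have h3 : ‖z⁻¹ * loopCurve n γ t‖ < 1 := by
    rw [norm_mul, norm_inv, inv_mul_lt_iff₀ (norm_pos_iff.mpr hz0), mul_one]; exact h2
  have h4 : -z⁻¹ * (loopCurve n γ t - z) = 1 - z⁻¹ * loopCurve n γ t := by
    field_simp; ring
  rw [h4, Complex.sub_re, Complex.one_re]
  linarith [(Complex.re_le_norm _).trans_lt h3]

theorem loop_ne_of_lt (k : ℤ) {s : ℝ} (hs0 : 0 < s) (hs1 : s ≤ 1) :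
    loopCurve n γ (k + s) ≠ loopCurve n γ k := by
  intro he
  have h1 := loopCurve_add h.three_le h.curve k (x := s) ⟨hs0.le, hs1⟩
  have h2 := loopCurve_add h.three_le h.curve k (x := 0) (by simp)
  rw [add_zero] at h2
  rw [h1, h2] at he
  have h3 := mul_left_cancel₀ (zpow_ne_zero k (unitRoot_ne_zero n)) (add_left_cancel he)
  have := h.injOn_curve ⟨hs0.le, hs1⟩ ⟨le_rfl, zero_le_one⟩ (sub_left_injective h3)
  exact hs0.ne' this

/-- If the lifted parameter moved by `1` along one edge, the intermediate value theorem would bring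
the loop back to the starting point of that edge. -/
theorem abs_lift_sub_lt {u : ℝ → ℝ} (hu : Continuous u) (hΓ : ∀ t, loopCurve n γ t = κ (u t))
    (k : ℤ) : |u (k + 1) - u k| < 1 := by
  have hle : (k : ℝ) ≤ k + 1 := by linarith
  have key : ∀ v : ℝ, v ∈ u '' Icc (k : ℝ) (k + 1) → (v = u k + 1 ∨ v = u k - 1) → False := by
    rintro v ⟨t, ht, rfl⟩ hv
    have hne : t ≠ k := by
      rintro rfl
      rcases hv with hv | hv <;> linarith
    have h1 := h.loop_ne_of_lt k (s := t - k) (sub_pos.mpr (lt_of_le_of_ne ht.1 hne.symm))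
      (by linarith [ht.2])
    rw [add_sub_cancel] at h1
    apply h1
    rw [hΓ, hΓ]
    rcases hv with hv | hv
    · have := h.param.add_int (u k) 1
      rw [← this, hv]; norm_num
    · have := h.param.add_int (u k) (-1)
      rw [← this, hv]; norm_num; rfl
  rw [abs_lt]
  constructor
  · by_contra! hc
    exact key _ (intermediate_value_Icc' hle hu.continuousOn ⟨by linarith, by linarith⟩)
      (Or.inr rfl)
  · by_contra! hc
    exact key _ (intermediate_value_Icc hle hu.continuousOn ⟨by linarith, by linarith⟩)
      (Or.inl rfl)

/-- The snowflake winds at least once and less than `n` times around `Ω`. -/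
theorem exists_turn_period : ∃ D : ℤ, 1 ≤ D ∧ D < n ∧
    (∀ z ∈ Ω, ∀ x, turn (fun t => loopCurve n γ t - z) x (x + n) = D) ∧
    ∀ z ∉ range (loopCurve n γ), z ∉ Ω →
      ∀ x, turn (fun t => loopCurve n γ t - z) x (x + n) = 0 := by
  have hn := h.three_le
  have hn0 : (0 : ℝ) < n := by exact_mod_cast (by omega : 0 < n)
  obtain ⟨D, hD1, hD2⟩ := h.exists_turn_loop (x := 0) (y := 0 + n) (by simp)
    (h.loop_add_period 0).symm
  have hall : ∀ z ∉ range (loopCurve n γ), ∀ x, turn (fun t => loopCurve n γ t - z) x (x + n) =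
      turn (fun t => loopCurve n γ t - z) 0 (0 + n) := by
    intro z hz x
    rcases le_total 0 x with hx | hx
    · exact (h.turn_period_eq hz hx).symm
    · exact h.turn_period_eq hz hx
  obtain ⟨z, hz⟩ := h.component.nonempty
  refine ⟨D, ?_, ?_, fun z hz x => by rw [hall z (h.component_notMem hz) x, hD1 z hz],
    fun z hz hzΩ x => by rw [hall z hz x, hD2 z hz hzΩ]⟩
  · have := h.one_le_turn_loop (x := 0) (x' := 0 + n) (by simpa using hn0)
      (h.loop_add_period 0).symm hz
    rw [hD1 z hz] at this
    exact_mod_cast this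
  · have hΩ := h.component
    have hzK := h.component_notMem hz
    rw [← h.range_eq] at hΩ hzK
    obtain ⟨d, hd, hd1, -⟩ := h.param.exists_winding hΩ
    obtain ⟨u, hu, hΓ⟩ := h.param.exists_param_lift h.continuous h.range_eq.symm.subset
    obtain ⟨m, hm⟩ := h.param.inj (u 0) (u (0 + n)) (by rw [← hΓ, ← hΓ, h.loop_add_period])
    have h1 : turn (fun t => loopCurve n γ t - z) 0 (0 + n) = m * d := by
      rw [show loopCurve n γ = fun t => κ (u t) from funext hΓ,
        h.param.turn_comp hzK hu (by simp) hm, hd1 z hz]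
    rw [hD1 z hz] at h1
    -- Each of the `n` edges advances the lift by less than one.
    have h2 : |(m : ℝ)| < n := by
      have h3 : (m : ℝ) = ∑ k ∈ Finset.range n, (u ((k + 1 : ℕ) : ℝ) - u (k : ℝ)) := by
        rw [Finset.sum_range_sub (fun k : ℕ => u (k : ℝ))]
        rw [zero_add] at hm
        rw [hm]; simp
      rw [h3]
      refine (Finset.abs_sum_le_sum_abs _ _).trans_lt ?_
      have h4 : ∑ k ∈ Finset.range n, |u ((k + 1 : ℕ) : ℝ) - u (k : ℝ)| <
          ∑ k ∈ Finset.range n, (1 : ℝ) := by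
        refine Finset.sum_lt_sum_of_nonempty (Finset.nonempty_range_iff.mpr (by omega))
          fun k _ => ?_
        have := h.abs_lift_sub_lt hu hΓ k
        push_cast at this ⊢
        exact this
      simpa using h4
    have h5 : (D : ℝ) < n := by
      rw [h1]
      refine lt_of_le_of_lt (le_abs_self _) ?_
      rw [abs_mul]
      rcases hd with rfl | rfl <;> simpa using h2
    exact_mod_cast h5

/-- The snowflake winds once around `Ω`. -/
theorem turn_period {z : ℂ} (hz : z ∈ Ω) (x : ℝ) :
    turn (fun t => loopCurve n γ t - z) x (x + n) = 1 := by
  have hn := h.three_le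
  obtain ⟨D, hD1, hDn, hΩ, hout⟩ := h.exists_turn_period
  rw [hΩ z hz x]
  -- If the loop met the centre, symmetry would bring it there once per edge, splitting it into `n`
  -- loops that each turn at least once, against `D < n`. Otherwise each edge turns `1 / n + m`
  -- about the centre, so the total is `1 + n m`. This is not `0`, so the centre is in `Ω`, and `1 ≤
  -- D < n` forces `D = 1`.
  by_cases hc : centre n ∈ range (loopCurve n γ)
  · exfalso
    obtain ⟨s, hs⟩ := hc
    have hsk : ∀ k : ℕ, loopCurve n γ (s + k) = centre n := by
      intro k
      induction k with
      | zero => simpa using hs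
      | succ k ih =>
        rw [Nat.cast_succ, ← add_assoc, loopCurve_add_one (γ := γ), ih, sub_self, mul_zero,
          add_zero]
    have hzK := h.component_notMem hz
    have h1 := turn_sum (f := fun t => loopCurve n γ t - z) (a := fun k : ℕ => s + k)
      (fun i j hij => by simpa using hij) n (h.continuous.sub continuous_const).continuousOn
      fun t _ => sub_ne_zero_of_notMem hzK t
    have h2 : ∑ k ∈ Finset.range n, (1 : ℝ) ≤ ∑ k ∈ Finset.range n,
        turn (fun t => loopCurve n γ t - z) (s + k) (s + (k + 1 : ℕ)) :=
      Finset.sum_le_sum fun k _ => h.one_le_turn_loop (by push_cast; linarith)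
        (by rw [hsk, hsk]) hz
    rw [h1] at h2
    simp only [Nat.cast_zero, add_zero, Finset.sum_const, Finset.card_range, nsmul_eq_mul,
      mul_one, hΩ z hz s] at h2
    have : (n : ℤ) ≤ D := by exact_mod_cast h2
    omega
  · have hcont : ∀ S : Set ℝ, ContinuousOn (fun t => loopCurve n γ t - centre n) S := fun _ =>
      (h.continuous.sub continuous_const).continuousOn
    have hstep : ∀ k : ℕ, turn (fun t => loopCurve n γ t - centre n) k (k + 1 : ℕ) =
        turn (fun t => loopCurve n γ t - centre n) 0 1 := by
      intro k
      induction k with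
      | zero => norm_num
      | succ k ih =>
        rw [← ih]
        have h1 := turn_comp_affine (f := fun t => loopCurve n γ t - centre n) (m := 1) (k := 1)
          (a := k) (b := (k + 1 : ℕ)) one_pos (by simp) (hcont _)
          fun t _ => sub_ne_zero_of_notMem hc t
        have h2 := turn_const_mul (f := fun t => loopCurve n γ t - centre n) (unitRoot_ne_zero n)
          (a := k) (b := (k + 1 : ℕ)) (by simp) (hcont _)
          fun t _ => sub_ne_zero_of_notMem hc t
        rw [← h2]
        simp only [one_mul, loopCurve_add_one (γ := γ), add_sub_cancel_left] at h1
        rw [h1]; norm_num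
    have h1 := turn_sum (f := fun t => loopCurve n γ t - centre n) (a := fun k : ℕ => (k : ℝ))
      (fun i j hij => by simpa using hij) n (hcont _) fun t _ => sub_ne_zero_of_notMem hc t
    rw [Finset.sum_congr rfl fun k _ => hstep k] at h1
    obtain ⟨m, hm⟩ := exists_turn_eq_arg_add (f := fun t => loopCurve n γ t - centre n)
      zero_le_one (hcont _) fun t _ => sub_ne_zero_of_notMem hc t
    have h01 : loopCurve n γ 1 - centre n = unitRoot n * (loopCurve n γ 0 - centre n) := by
      have := loopCurve_add_one (n := n) (γ := γ) 0
      rw [zero_add] at this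
      rw [this]; ring
    have hpi := Real.pi_pos
    have hn0 : (n : ℝ) ≠ 0 := by have : n ≠ 0 := by omega
                                 exact_mod_cast this
    rw [h01, mul_div_cancel_right₀ _ (sub_ne_zero_of_notMem hc 0), arg_unitRoot hn,
      centralAngle] at hm
    have h2 : turn (fun t => loopCurve n γ t - centre n) 0 (0 + n) = 1 + n * m := by
      simp only [Nat.cast_zero, Finset.sum_const, Finset.card_range, nsmul_eq_mul] at h1
      rw [zero_add, ← h1, hm]
      field_simp
    by_cases hcΩ : centre n ∈ Ω
    · rw [hΩ _ hcΩ] at h2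
      have h3 : D = 1 + n * m := by exact_mod_cast h2
      have h4 : m = 0 := by
        have ha : m < 1 := by nlinarith
        have hb : -1 < m := by nlinarith
        omega
      rw [h3, h4]; simp
    · rw [hout _ hc hcΩ] at h2
      have h3 : (0 : ℤ) = 1 + n * m := by exact_mod_cast h2
      have h4 : (n : ℤ) ∣ 1 := ⟨-m, by linarith⟩
      have := Int.le_of_dvd one_pos h4
      omega

theorem turn_period_outside {z : ℂ} (hz : z ∉ range (loopCurve n γ)) (hzΩ : z ∉ Ω) (x : ℝ) :
    turn (fun t => loopCurve n γ t - z) x (x + n) = 0 := by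
  obtain ⟨D, -, -, -, hout⟩ := h.exists_turn_period
  exact hout z hz hzΩ x

/-- The loop is injective modulo its period. -/
theorem loop_inj {x x' : ℝ} (he : loopCurve n γ x = loopCurve n γ x') :
    ∃ k : ℤ, x' = x + k * n := by
  have hn0 : (0 : ℝ) < n := by have := h.three_le
                               exact_mod_cast (by omega : 0 < n)
  refine ⟨⌊(x' - x) / n⌋, ?_⟩
  set k := ⌊(x' - x) / n⌋ with hk
  have h1 := Int.floor_le ((x' - x) / n)
  have h2 := Int.lt_floor_add_one ((x' - x) / n)
  rw [le_div_iff₀ hn0] at h1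
  rw [div_lt_iff₀ hn0] at h2
  rw [← hk] at h1 h2
  by_contra hne
  set y := x + k * n with hy
  have hyx : y < x' := lt_of_le_of_ne (by linarith) (Ne.symm hne)
  have hyn : x' < y + n := by linarith
  have hey : loopCurve n γ y = loopCurve n γ x' := by rw [hy, h.loop_add_int_period, he]
  obtain ⟨z, hz⟩ := h.component.nonempty
  -- A double point splits the period into two closed loops, each turning at least once, while the
  -- total is one.
  have h3 := h.one_le_turn_loop hyx hey hz
  have h4 := h.one_le_turn_loop hyn (by rw [h.loop_add_period, hey]) hz
  have h5 := h.turn_add' (h.component_notMem hz) hyx.le hyn.le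
  rw [h.turn_period hz] at h5
  linarith

end IsKochLoop
end
end VonKoch

namespace VonKoch
noncomputable section

/-! ### Linear separation of a cell from the rest of the loop. -/

namespace IsKochLoop

variable {n : ℕ} {r : ℝ} {γ κ : ℝ → ℂ} {Ω : Set ℂ} (h : IsKochLoop n r γ κ Ω)
include h

/-- At each grid point the loop is self-similar with ratio `ℓ`. -/
theorem loop_scale (J : ℕ) (j : ℤ) {s : ℝ} (hs : |s| ≤ 1 / ((n + 1 : ℕ) : ℝ) ^ J) :
    loopCurve n γ (j / ((n + 1 : ℕ) : ℝ) ^ J + s / (n + 1 : ℕ)) - gridPoint n γ J j =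
      conjRatio r * (loopCurve n γ (j / ((n + 1 : ℕ) : ℝ) ^ J + s) - gridPoint n γ J j) := by
  have hn := h.three_le
  have hB0 := base_pos (n := n)
  set B := ((n + 1 : ℕ) : ℝ) with hB
  have hb : 0 < B ^ J := pow_pos hB0 J
  have hBn : B = n + 1 := by rw [hB]; push_cast; rfl
  rw [le_div_iff₀ hb] at hs
  have hs : -1 ≤ s * B ^ J ∧ s * B ^ J ≤ 1 := by
    rwa [← abs_le, abs_mul, abs_of_pos hb]
  -- Right of a grid point the loop starts the first piece of a cell, left of it the loop ends the
  -- last piece of the preceding cell. Both pieces have ratio `ℓ` and the direction of their cell.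
  rcases le_total 0 s with h0 | h0
  · have hx : s * B ^ J ∈ Icc (0 : ℝ) 1 := ⟨by positivity, hs.2⟩
    have hx' : s * B ^ J / B ∈ Icc (0 : ℝ) 1 := ⟨by positivity,
      (div_le_self hx.1 h.one_lt_base.le).trans hx.2⟩
    have h1 := h.cell_eq J j hx
    have h2 := h.cell_eq J j hx'
    rw [← hB] at h1 h2
    rw [show (j + s * B ^ J) / B ^ J = j / B ^ J + s by field_simp] at h1
    rw [show (j + s * B ^ J / B) / B ^ J = j / B ^ J + s / B by field_simp] at h2
    have h3 := h.curve.piece 0 (Nat.succ_pos n) _ hx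
    rw [Nat.cast_zero, zero_add, ← hB] at h3
    rw [h1, h2, h3, affineTo, affineTo, affineTo, koch_step_zero hn, koch_zero]
    ring
  · have hx : 1 + s * B ^ J ∈ Icc (0 : ℝ) 1 := ⟨by linarith, by nlinarith⟩
    have hx' : (n + (1 + s * B ^ J)) / B ∈ Icc (0 : ℝ) 1 := by
      have := hx.1
      refine ⟨by positivity, ?_⟩
      rw [div_le_one hB0]; linarith [hx.2]
    have h1 := h.cell_eq J (j - 1) hx
    have h2 := h.cell_eq J (j - 1) hx'
    rw [← hB] at h1 h2
    rw [show (((j - 1 : ℤ) : ℝ) + (1 + s * B ^ J)) / B ^ J = j / B ^ J + s by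
      push_cast; field_simp; ring] at h1
    rw [show (((j - 1 : ℤ) : ℝ) + (n + (1 + s * B ^ J)) / B) / B ^ J = j / B ^ J + s / B by
      have : (n : ℝ) = B - 1 := by rw [hBn]; ring
      rw [this]; push_cast; field_simp; ring] at h2
    have h3 := h.curve.piece n (Nat.lt_succ_self n) _ hx
    rw [← hB] at h3
    have h4 : (2 : ℂ) * conjRatio r + r = 1 := by exact_mod_cast two_mul_conjRatio_add r
    rw [h1, h2, h3, affineTo, affineTo, affineTo, koch_step_last hn, koch_pred_last hn,
      sub_add_cancel]
    linear_combination (gridPoint n γ J j - gridPoint n γ J (j - 1)) * h4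

/-- The two arcs of the loop meeting at a grid point are transversal. -/
theorem exists_transversal (J : ℕ) (j : ℤ) : ∃ c > 0, ∀ s s' : ℝ,
    s ∈ Icc 0 (1 / ((n + 1 : ℕ) : ℝ) ^ J) → s' ∈ Icc 0 (1 / ((n + 1 : ℕ) : ℝ) ^ J) →
    c * ‖loopCurve n γ (j / ((n + 1 : ℕ) : ℝ) ^ J + s) - gridPoint n γ J j‖ ≤
      ‖loopCurve n γ (j / ((n + 1 : ℕ) : ℝ) ^ J + s) -
        loopCurve n γ (j / ((n + 1 : ℕ) : ℝ) ^ J - s')‖ ∧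
    c * ‖loopCurve n γ (j / ((n + 1 : ℕ) : ℝ) ^ J - s') - gridPoint n γ J j‖ ≤
      ‖loopCurve n γ (j / ((n + 1 : ℕ) : ℝ) ^ J + s) -
        loopCurve n γ (j / ((n + 1 : ℕ) : ℝ) ^ J - s')‖ := by
  have hn := h.three_le
  have hB0 := base_pos (n := n)
  set B := ((n + 1 : ℕ) : ℝ) with hB
  have hb : 0 < B ^ J := pow_pos hB0 J
  set w := 1 / B ^ J with hw
  have hw0 : 0 < w := by positivity
  have hw1 : w ≤ 1 := by
    rw [hw, div_le_one hb]; exact one_le_pow₀ h.one_lt_base.le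
  set τ := (j : ℝ) / B ^ J with hτ
  set p := gridPoint n γ J j with hp
  have hpτ : p = loopCurve n γ τ := rfl
  have hΓ := h.continuous
  obtain ⟨M, hM⟩ := (isCompact_Icc (a := τ - w) (b := τ + w)).exists_bound_of_continuousOn
    (f := fun t => loopCurve n γ t - p) (hΓ.sub continuous_const).continuousOn
  have hMpos : 0 < M + 1 := by
    have := (norm_nonneg _).trans (hM τ ⟨by linarith, by linarith⟩); linarith
  -- On this compact fundamental domain for the scaling by `B` the two arcs are at positive
  -- distance. Every smaller pair of parameters is brought into it by iterating `loop_scale`, which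
  -- multiplies both sides of the inequality by the same factor.
  have hcpt : IsCompact ((Icc 0 w ×ˢ Icc 0 w) ∩ {q : ℝ × ℝ | w / B ≤ max q.1 q.2}) :=
    (isCompact_Icc.prod isCompact_Icc).inter_right
      (isClosed_le continuous_const (continuous_fst.max continuous_snd))
  have hne : ∀ q ∈ ((Icc 0 w ×ˢ Icc 0 w) ∩ {q : ℝ × ℝ | w / B ≤ max q.1 q.2}),
      0 < ‖loopCurve n γ (τ + q.1) - loopCurve n γ (τ - q.2)‖ := by
    rintro ⟨s, s'⟩ ⟨⟨hs, hs'⟩, hmax⟩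
    rw [norm_pos_iff, sub_ne_zero]
    intro he
    obtain ⟨k, hk⟩ := h.loop_inj he
    simp only [mem_ofPred_eq] at hmax hk hs hs'
    have hn3 : (3 : ℝ) ≤ n := by exact_mod_cast hn
    -- The parameters differ by at most `2 w ≤ 2`, less than the period `n ≥ 3`.
    have hk0 : k = 0 := by
      have h1 : (k : ℝ) * n ≤ 0 := by linarith [hs.1, hs'.1]
      have h2 : -3 < (k : ℝ) * n := by linarith [hs.2, hs'.2]
      have h3 : (k : ℝ) < 1 := by nlinarith
      have h4 : (-1 : ℝ) < k := by nlinarith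
      have h5 : k < 1 := by exact_mod_cast h3
      have h6 : -1 < k := by exact_mod_cast h4
      omega
    rw [hk0] at hk
    have h7 : 0 < w / B := by positivity
    have : s = 0 ∧ s' = 0 := by constructor <;> linarith [hs.1, hs'.1, (by simpa using hk : τ - s' = τ + s)]
    rw [this.1, this.2, max_self] at hmax
    linarith
  obtain ⟨d, hd0, hd⟩ := hcpt.exists_forall_le' (f := fun q : ℝ × ℝ =>
    ‖loopCurve n γ (τ + q.1) - loopCurve n γ (τ - q.2)‖) (by fun_prop) hne
  refine ⟨d / (M + 1), by positivity, ?_⟩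
  have key : ∀ (m : ℕ) (s s' : ℝ), s ∈ Icc 0 w → s' ∈ Icc 0 w → w / B ^ m ≤ max s s' →
      d / (M + 1) * ‖loopCurve n γ (τ + s) - p‖ ≤
        ‖loopCurve n γ (τ + s) - loopCurve n γ (τ - s')‖ ∧
      d / (M + 1) * ‖loopCurve n γ (τ - s') - p‖ ≤
        ‖loopCurve n γ (τ + s) - loopCurve n γ (τ - s')‖ := by
    have hbase : ∀ s s' : ℝ, s ∈ Icc 0 w → s' ∈ Icc 0 w → w / B ≤ max s s' →
      d / (M + 1) * ‖loopCurve n γ (τ + s) - p‖ ≤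
        ‖loopCurve n γ (τ + s) - loopCurve n γ (τ - s')‖ ∧
      d / (M + 1) * ‖loopCurve n γ (τ - s') - p‖ ≤
        ‖loopCurve n γ (τ + s) - loopCurve n γ (τ - s')‖ := by
      intro s s' hs hs' hmax
      have h1 := hd (s, s') ⟨⟨hs, hs'⟩, hmax⟩
      have h2 := hM (τ + s) ⟨by linarith [hs.1], by linarith [hs.2]⟩
      have h3 := hM (τ - s') ⟨by linarith [hs'.2], by linarith [hs'.1]⟩
      have h4 : ∀ v : ℝ, v ≤ M → d / (M + 1) * v ≤ d := fun v hv => by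
        rw [div_mul_eq_mul_div, div_le_iff₀ hMpos]
        exact mul_le_mul_of_nonneg_left (by linarith) hd0.le
      exact ⟨(h4 _ h2).trans h1, (h4 _ h3).trans h1⟩
    intro m
    induction m with
    | zero =>
      intro s s' hs hs' hmax
      refine hbase s s' hs hs' (le_trans ?_ hmax)
      rw [pow_zero, div_one]
      exact div_le_self hw0.le h.one_lt_base.le
    | succ m ih =>
      intro s s' hs hs' hmax
      by_cases hlt : w / B ≤ max s s'
      · exact hbase s s' hs hs' hlt
      · rw [not_le, max_lt_iff, lt_div_iff₀ hB0, lt_div_iff₀ hB0] at hlt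
        have h1 : s * B ∈ Icc 0 w := ⟨mul_nonneg hs.1 hB0.le, hlt.1.le⟩
        have h2 : s' * B ∈ Icc 0 w := ⟨mul_nonneg hs'.1 hB0.le, hlt.2.le⟩
        have h3 := ih (s * B) (s' * B) h1 h2 (by
          rw [← max_mul_of_nonneg _ _ hB0.le, ← div_le_iff₀ hB0, div_div, ← pow_succ]
          exact hmax)
        have e1 := h.loop_scale J j (s := s * B) (by rw [abs_of_nonneg h1.1]; exact h1.2)
        have e2 := h.loop_scale J j (s := -(s' * B))
          (by rw [abs_neg, abs_of_nonneg h2.1]; exact h2.2)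
        rw [← hB, ← hτ, ← hp, mul_div_cancel_right₀ _ hB0.ne'] at e1
        rw [← hB, ← hτ, ← hp, neg_div, mul_div_cancel_right₀ _ hB0.ne', ← sub_eq_add_neg,
          ← sub_eq_add_neg] at e2
        have e3 : loopCurve n γ (τ + s) - loopCurve n γ (τ - s') = conjRatio r *
            (loopCurve n γ (τ + s * B) - loopCurve n γ (τ - s' * B)) := by
          linear_combination e1 - e2
        have hℓ := conjRatio_pos h.lt_one
        rw [e1, e2, e3, norm_mul, norm_mul, norm_mul, Complex.norm_real, Real.norm_of_nonneg hℓ.le]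
        constructor
        · nlinarith [h3.1]
        · nlinarith [h3.2]
  intro s s' hs hs'
  by_cases h0 : max s s' = 0
  · have h1 : s = 0 := le_antisymm (h0 ▸ le_max_left _ _) hs.1
    have h2 : s' = 0 := le_antisymm (h0 ▸ le_max_right _ _) hs'.1
    rw [h1, h2, add_zero, sub_zero, hpτ]; simp
  · have hpos : 0 < max s s' := lt_of_le_of_ne (hs.1.trans (le_max_left _ _)) (Ne.symm h0)
    have h1 := tendsto_pow_atTop_nhds_zero_of_lt_one (inv_nonneg.mpr hB0.le)
      (inv_lt_one_of_one_lt₀ h.one_lt_base)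
    have h2 := h1.const_mul w
    rw [mul_zero] at h2
    obtain ⟨m, hm⟩ := (h2.eventually (gt_mem_nhds hpos)).exists
    refine key m s s' hs hs' ?_
    rw [div_eq_mul_inv, ← inv_pow]; exact hm.le

/-- Each cell is transversal to the rest of the loop at its two end points, and disjoint from it
otherwise. -/
theorem exists_separation (J : ℕ) (j : ℤ) : ∃ c > 0,
    ∀ s ∈ Icc (j / ((n + 1 : ℕ) : ℝ) ^ J) ((j + 1) / ((n + 1 : ℕ) : ℝ) ^ J),
    ∀ s' ∈ Icc ((j + 1) / ((n + 1 : ℕ) : ℝ) ^ J) (j / ((n + 1 : ℕ) : ℝ) ^ J + n),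
    c * min ‖loopCurve n γ s - gridPoint n γ J j‖ ‖loopCurve n γ s - gridPoint n γ J (j + 1)‖ ≤
      ‖loopCurve n γ s - loopCurve n γ s'‖ := by
  have hn := h.three_le
  obtain ⟨c₁, hc₁, ht₁⟩ := h.exists_transversal J j
  obtain ⟨c₂, hc₂, ht₂⟩ := h.exists_transversal J (j + 1)
  have hB0 := base_pos (n := n)
  have hn3 : (3 : ℝ) ≤ n := by exact_mod_cast hn
  push_cast at ht₂
  set B := ((n + 1 : ℕ) : ℝ) with hB
  have hb : 0 < B ^ J := pow_pos hB0 J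
  have hB1 : (n : ℝ) + 1 = B := by rw [hB]; push_cast; rfl
  rw [hB1] at ht₂
  rw [add_div] at ht₂ ⊢
  set w := 1 / B ^ J with hw
  have hw0 : 0 < w := by positivity
  have hw1 : w ≤ 1 := by
    rw [hw, div_le_one hb]; exact one_le_pow₀ h.one_lt_base.le
  set τ := (j : ℝ) / B ^ J with hτ
  set P := gridPoint n γ J j with hP
  set Q := gridPoint n γ J (j + 1) with hQ
  have hΓ := h.continuous
  obtain ⟨M, hM⟩ := (isCompact_Icc (a := τ) (b := τ + w)).exists_bound_of_continuousOn
    (f := fun t => loopCurve n γ t - P) (hΓ.sub continuous_const).continuousOn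
  have hMpos : 0 < M + 1 := by
    have := (norm_nonneg _).trans (hM τ ⟨by linarith, by linarith⟩); linarith
  -- Pairs of parameters that are not jointly close to either end point of the cell. On this compact
  -- set injectivity gives a positive minimum; close to an end point transversality takes over.
  set S : Set (ℝ × ℝ) := (Icc τ (τ + w) ×ˢ Icc (τ + w) (τ + n)) ∩
    ({q | w ≤ q.1 - τ + (τ + n - q.2)} ∩ {q | w ≤ τ + w - q.1 + (q.2 - (τ + w))}) with hS
  have hcpt : IsCompact S := (isCompact_Icc.prod isCompact_Icc).inter_right
    ((isClosed_le continuous_const (by fun_prop)).inter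
      (isClosed_le continuous_const (by fun_prop)))
  have hne : ∀ q ∈ S, 0 < ‖loopCurve n γ q.1 - loopCurve n γ q.2‖ := by
    rintro ⟨s, s'⟩ ⟨⟨hs, hs'⟩, h1, h2⟩
    rw [norm_pos_iff, sub_ne_zero]
    intro he
    obtain ⟨k, hk⟩ := h.loop_inj he
    simp only [mem_ofPred_eq] at h1 h2 hk hs hs'
    have h3 : 0 < (k : ℝ) * n := by linarith
    have h4 : (k : ℝ) * n < n := by linarith
    have h5 : 0 < (k : ℝ) := by
      by_contra! hc; nlinarith
    have h6 : (k : ℝ) < 1 := by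
      by_contra! hc; nlinarith
    have h7 : 0 < k := by exact_mod_cast h5
    have h8 : k < 1 := by exact_mod_cast h6
    omega
  obtain ⟨d, hd0, hd⟩ := hcpt.exists_forall_le' (f := fun q : ℝ × ℝ =>
    ‖loopCurve n γ q.1 - loopCurve n γ q.2‖) (by fun_prop) hne
  refine ⟨min (min c₁ c₂) (d / (M + 1)), by positivity, fun s hs s' hs' => ?_⟩
  by_cases h1 : w ≤ s - τ + (τ + n - s')
  · by_cases h2 : w ≤ τ + w - s + (s' - (τ + w))
    · refine le_trans ?_ (hd (s, s') ⟨⟨hs, hs'⟩, h1, h2⟩)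
      refine (mul_le_mul (min_le_right _ _) ((min_le_left _ _).trans (hM s hs))
        (by positivity) (by positivity)).trans ?_
      rw [div_mul_eq_mul_div, div_le_iff₀ hMpos]
      exact mul_le_mul_of_nonneg_left (by linarith) hd0.le
    · rw [not_le] at h2
      have h3 := (ht₂ (s' - (τ + w)) (τ + w - s) ⟨by linarith [hs'.1], by linarith [hs.2]⟩
        ⟨by linarith [hs.2], by linarith [hs'.1]⟩).2
      rw [add_sub_cancel, sub_sub_cancel, norm_sub_rev (loopCurve n γ s')] at h3
      refine le_trans ?_ h3
      exact mul_le_mul ((min_le_left _ _).trans (min_le_right _ _)) (min_le_right _ _)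
        (by positivity) hc₂.le
  · rw [not_le] at h1
    have h3 := (ht₁ (s - τ) (τ + n - s') ⟨by linarith [hs.1], by linarith [hs'.2]⟩
        ⟨by linarith [hs'.2], by linarith [hs.1]⟩).1
    rw [add_sub_cancel, show τ - (τ + n - s') = s' + (-1 : ℤ) * n by push_cast; ring,
      h.loop_add_int_period] at h3
    refine le_trans ?_ h3
    exact mul_le_mul ((min_le_left _ _).trans (min_le_left _ _)) (min_le_left _ _)
        (by positivity) hc₁.le

end IsKochLoop
end
end VonKoch

namespace VonKoch
noncomputable section

/-! ### Areas -/

theorem volume_preimage_affine {a : ℂ} (ha : a ≠ 0) (u v : ℂ) (E : Set ℂ) :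
    volume.real ((fun z => u + a * (z - v)) ⁻¹' E) = (‖a‖ ^ 2)⁻¹ * volume.real E := by
  have h1 : (fun z => u + a * (z - v)) ⁻¹' E =
      (fun z => z + -v) ⁻¹' ((LinearMap.mulLeft ℝ a) ⁻¹' ((fun z => u + z) ⁻¹' E)) := by
    ext z; simp [sub_eq_add_neg]
  have hdet : LinearMap.det (LinearMap.mulLeft ℝ a) = ‖a‖ ^ 2 := by
    have := Algebra.norm_apply ℝ a
    rw [Algebra.norm_complex_apply, Complex.normSq_eq_norm_sq] at this
    rw [this]; rfl
  have ha0 : ‖a‖ ≠ 0 := norm_ne_zero_iff.mpr ha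
  rw [h1, measureReal_def, measure_preimage_add_right,
    Measure.addHaar_preimage_linearMap _ (by rw [hdet]; positivity), measure_preimage_add, hdet,
    ENNReal.toReal_mul, ENNReal.toReal_ofReal (abs_nonneg _), abs_of_nonneg (by positivity),
    measureReal_def]

theorem volume_real_ball_le (p : ℂ) {s : ℝ} (hs : 0 ≤ s) :
    volume.real (Metric.ball p s) = Real.pi * s ^ 2 := by
  rw [measureReal_def, Complex.volume_ball, ENNReal.toReal_mul, ENNReal.toReal_pow,
    ENNReal.toReal_ofReal hs, mul_comm]
  rfl

theorem abs_volume_sub_le {E F B : Set ℂ} (hE : Bornology.IsBounded E)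
    (hF : Bornology.IsBounded F) (hB : Bornology.IsBounded B) (h1 : E ⊆ F ∪ B) (h2 : F ⊆ E ∪ B) :
    |volume.real E - volume.real F| ≤ volume.real B := by
  have h3 := measureReal_mono (μ := volume) h1 (hF.union hB).measure_lt_top.ne
  have h4 := measureReal_mono (μ := volume) h2 (hE.union hB).measure_lt_top.ne
  have h5 := measureReal_union_le (μ := volume) F B
  have h6 := measureReal_union_le (μ := volume) E B
  rw [abs_le]; constructor <;> linarith

/-- With the overlaps `B i` removed the sets become disjoint, so the union is at least the sum of
the `E i` minus that of the `B i`. -/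
theorem abs_volume_biUnion_sub_sum_le {ι : Type*} (s : Finset ι) (E B : ι → Set ℂ)
    (hE : ∀ i ∈ s, Bornology.IsBounded (E i)) (hB : ∀ i ∈ s, Bornology.IsBounded (B i))
    (hEm : ∀ i ∈ s, MeasurableSet (E i)) (hBm : ∀ i ∈ s, MeasurableSet (B i))
    (hEB : ∀ i ∈ s, ∀ j ∈ s, i ≠ j → E i ∩ E j ⊆ B i) :
    |volume.real (⋃ i ∈ s, E i) - ∑ i ∈ s, volume.real (E i)| ≤ ∑ i ∈ s, volume.real (B i) := by
  have hbd : Bornology.IsBounded (⋃ i ∈ s, E i) :=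
    (Bornology.isBounded_biUnion_finset s).mpr hE
  have h1 := measureReal_biUnion_finset_le (μ := volume) s E
  have h2 : ∑ i ∈ s, volume.real (E i \ B i) ≤ volume.real (⋃ i ∈ s, E i) := by
    rw [← measureReal_biUnion_finset (μ := volume) (f := fun i => E i \ B i)
      (fun i hi j hj hij => Set.disjoint_left.mpr fun z hz hz' =>
        hz.2 (hEB i hi j hj hij ⟨hz.1, hz'.1⟩))
      (fun i hi => (hEm i hi).diff (hBm i hi))
      (fun i hi => ((hE i hi).subset sdiff_subset).measure_lt_top.ne)]
    exact measureReal_mono (iUnion₂_mono fun i _ => sdiff_subset) hbd.measure_lt_top.ne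
  have h3 : ∑ i ∈ s, volume.real (E i) ≤ ∑ i ∈ s, (volume.real (E i \ B i) + volume.real (B i)) := by
    refine Finset.sum_le_sum fun i hi => ?_
    refine (measureReal_mono (s₂ := E i \ B i ∪ B i) (by simp) ?_).trans (measureReal_union_le _ _)
    exact (((hE i hi).subset sdiff_subset).union (hB i hi)).measure_lt_top.ne
  rw [Finset.sum_add_distrib] at h3
  have h4 : 0 ≤ ∑ i ∈ s, volume.real (B i) := Finset.sum_nonneg fun _ _ => measureReal_nonneg
  rw [abs_le]; constructor <;> linarith

/-- The `j`-th piece of the `J`-th subdivision. -/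
def cell (n : ℕ) (γ : ℝ → ℂ) (J : ℕ) (j : ℤ) : Set ℂ :=
  loopCurve n γ '' Icc (j / ((n + 1 : ℕ) : ℝ) ^ J) ((j + 1) / ((n + 1 : ℕ) : ℝ) ^ J)

/-- The part of the loop complementary to a cell. -/
def cellRest (n : ℕ) (γ : ℝ → ℂ) (J : ℕ) (j : ℤ) : Set ℂ :=
  loopCurve n γ '' Icc ((j + 1) / ((n + 1 : ℕ) : ℝ) ^ J) (j / ((n + 1 : ℕ) : ℝ) ^ J + n)

/-- The relative tubular neighbourhood of a cell. -/
def cellTube (n : ℕ) (γ : ℝ → ℂ) (Ω : Set ℂ) (J : ℕ) (j : ℤ) (t : ℝ) : Set ℂ :=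
  Metric.thickening t (cell n γ J j) ∩ Ω

/-- The similarity carrying the cell `(J', j')` to the cell `(J, j)`. -/
def cellMap (n : ℕ) (γ : ℝ → ℂ) (J' : ℕ) (j' : ℤ) (J : ℕ) (j : ℤ) (z : ℂ) : ℂ :=
  gridPoint n γ J j + chord n γ J j / chord n γ J' j' * (z - gridPoint n γ J' j')

/-- Two discs around the end points of a cell. -/
def endDiscs (n : ℕ) (γ : ℝ → ℂ) (J : ℕ) (j : ℤ) (s : ℝ) : Set ℂ :=
  Metric.ball (gridPoint n γ J j) s ∪ Metric.ball (gridPoint n γ J (j + 1)) s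

theorem volume_endDiscs_le (n : ℕ) (γ : ℝ → ℂ) (J : ℕ) (j : ℤ) {s : ℝ} (hs : 0 ≤ s) :
    volume.real (endDiscs n γ J j s) ≤ 2 * Real.pi * s ^ 2 := by
  refine (measureReal_union_le _ _).trans ?_
  rw [volume_real_ball_le _ hs, volume_real_ball_le _ hs]
  linarith

theorem isBounded_endDiscs (n : ℕ) (γ : ℝ → ℂ) (J : ℕ) (j : ℤ) (s : ℝ) :
    Bornology.IsBounded (endDiscs n γ J j s) := Metric.isBounded_ball.union Metric.isBounded_ball

theorem mem_endDiscs_of_min_lt {n : ℕ} {γ : ℝ → ℂ} {J : ℕ} {j : ℤ} {x z : ℂ} {s t : ℝ}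
    (h1 : min ‖x - gridPoint n γ J j‖ ‖x - gridPoint n γ J (j + 1)‖ < s) (h2 : dist z x < t) :
    z ∈ endDiscs n γ J j (t + s) := by
  rcases min_lt_iff.mp h1 with h3 | h3
  · left
    rw [← dist_eq_norm] at h3
    rw [Metric.mem_ball]
    linarith [dist_triangle z x (gridPoint n γ J j)]
  · right
    rw [← dist_eq_norm] at h3
    rw [Metric.mem_ball]
    linarith [dist_triangle z x (gridPoint n γ J (j + 1))]

/-! ### Similarities between cells and the sides of the loop. -/

namespace IsKochLoop

variable {n : ℕ} {r : ℝ} {γ κ : ℝ → ℂ} {Ω : Set ℂ} (h : IsKochLoop n r γ κ Ω)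
include h

theorem mem_cell_or_rest (J : ℕ) (j : ℤ) {z : ℂ} (hz : z ∈ range (loopCurve n γ)) :
    z ∈ cell n γ J j ∨ z ∈ cellRest n γ J j := by
  obtain ⟨t, rfl⟩ := hz
  have hn0 : (0 : ℝ) < n := by have := h.three_le
                               exact_mod_cast (by omega : 0 < n)
  obtain ⟨s, hs, hst⟩ := (show Function.Periodic (loopCurve n γ) n from
    h.loop_add_period).exists_mem_Ico hn0 t (j / ((n + 1 : ℕ) : ℝ) ^ J)
  rw [hst]
  rcases le_total s ((j + 1) / ((n + 1 : ℕ) : ℝ) ^ J) with hle | hle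
  · exact Or.inl (mem_image_of_mem _ ⟨hs.1, hle⟩)
  · exact Or.inr (mem_image_of_mem _ ⟨hle, hs.2.le⟩)

theorem mem_cell_iff (J : ℕ) (j : ℤ) {z : ℂ} :
    z ∈ cell n γ J j ↔ (z - gridPoint n γ J j) / chord n γ J j ∈ γ '' Icc 0 1 := by
  have hb : (0 : ℝ) < ((n + 1 : ℕ) : ℝ) ^ J := pow_pos (base_pos (n := n)) J
  have hc := h.chord_ne_zero J j
  constructor
  · rintro ⟨t, ht, rfl⟩
    have hx : t * ((n + 1 : ℕ) : ℝ) ^ J - j ∈ Icc (0 : ℝ) 1 := by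
      have h1 := ht.1
      have h2 := ht.2
      rw [div_le_iff₀ hb] at h1
      rw [le_div_iff₀ hb] at h2
      constructor <;> linarith
    refine ⟨_, hx, ?_⟩
    have := h.cell_eq J j hx
    rw [add_sub_cancel, mul_div_cancel_right₀ _ hb.ne'] at this
    rw [this, affineTo, ← chord, add_sub_cancel_left, mul_div_cancel_left₀ _ hc]
  · rintro ⟨x, hx, hxz⟩
    refine ⟨(j + x) / ((n + 1 : ℕ) : ℝ) ^ J, ⟨?_, ?_⟩, ?_⟩
    · gcongr; linarith [hx.1]
    · gcongr; exact hx.2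
    · rw [h.cell_eq J j hx, hxz, affineTo, ← chord, mul_div_cancel₀ _ hc]; ring

theorem cellMap_normalized (J' : ℕ) (j' : ℤ) (J : ℕ) (j : ℤ) (z : ℂ) :
    (cellMap n γ J' j' J j z - gridPoint n γ J j) / chord n γ J j =
      (z - gridPoint n γ J' j') / chord n γ J' j' := by
  have hc := h.chord_ne_zero J j
  have hc' := h.chord_ne_zero J' j'
  rw [cellMap]; field_simp; ring

theorem cellMap_mem_iff (J' : ℕ) (j' : ℤ) (J : ℕ) (j : ℤ) {z : ℂ} :
    cellMap n γ J' j' J j z ∈ cell n γ J j ↔ z ∈ cell n γ J' j' := by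
  rw [h.mem_cell_iff, h.mem_cell_iff, h.cellMap_normalized]

omit h in
theorem dist_cellMap (J' : ℕ) (j' : ℤ) (J : ℕ) (j : ℤ) (z w : ℂ) :
    dist (cellMap n γ J' j' J j z) (cellMap n γ J' j' J j w) =
      ‖chord n γ J j / chord n γ J' j'‖ * dist z w := by
  rw [dist_eq_norm, dist_eq_norm, ← norm_mul, cellMap, cellMap]
  congr 1; ring

theorem cellMap_cellMap (J' : ℕ) (j' : ℤ) (J : ℕ) (j : ℤ) (z : ℂ) :
    cellMap n γ J' j' J j (cellMap n γ J j J' j' z) = z := by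
  have hc := h.chord_ne_zero J j
  have hc' := h.chord_ne_zero J' j'
  rw [cellMap, cellMap]; field_simp; ring

/-- The right-hand side depends on `z` only through the normalized coordinate of the cell, so it is
unchanged by the similarities between cells. -/
theorem turn_single_cell (J : ℕ) (j : ℤ) {z : ℂ} (hz : z ∉ range (loopCurve n γ)) :
    turn (fun t => loopCurve n γ t - z) (j / ((n + 1 : ℕ) : ℝ) ^ J)
        ((j + 1) / ((n + 1 : ℕ) : ℝ) ^ J) =
      defect γ ((z - gridPoint n γ J j) / chord n γ J j) +
        (1 - 1 / ((z - gridPoint n γ J j) / chord n γ J j)).arg / (2 * Real.pi) := by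
  have h1 := h.turn_cells J j 1 hz
  simp only [Finset.sum_range_one, Nat.cast_zero, add_zero, Nat.cast_one, Int.cast_add,
    Int.cast_one] at h1
  rw [h1, cellDefect]
  congr 3
  have h2 : z - gridPoint n γ J j ≠ 0 := fun he => hz ⟨_, (sub_eq_zero.mp he).symm⟩
  have h3 : gridPoint n γ J j - z ≠ 0 := by rw [← neg_sub]; exact neg_ne_zero.mpr h2
  rw [one_div_div, chord, ← neg_sub (gridPoint n γ J j) z, div_neg]
  field_simp
  ring

theorem exists_turn_period_eq {z : ℂ} (hz : z ∉ range (loopCurve n γ)) (x : ℝ) :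
    (z ∈ Ω ∧ turn (fun t => loopCurve n γ t - z) x (x + n) = 1) ∨
      (z ∉ Ω ∧ turn (fun t => loopCurve n γ t - z) x (x + n) = 0) := by
  by_cases hΩ : z ∈ Ω
  · exact Or.inl ⟨hΩ, h.turn_period hΩ x⟩
  · exact Or.inr ⟨hΩ, h.turn_period_outside hz hΩ x⟩

/-- The similarities between cells match the sides of the cells. -/
theorem mem_iff_cellMap_mem (J' : ℕ) (j' : ℤ) (J : ℕ) (j : ℤ) {y : ℂ} (hy : y ∈ cell n γ J' j')
    {ρ : ℝ} (hρ' : ∀ x ∈ cellRest n γ J' j', ρ ≤ dist y x)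
    (hρ : ∀ x ∈ cellRest n γ J j, ‖chord n γ J j / chord n γ J' j'‖ * ρ ≤
      dist (cellMap n γ J' j' J j y) x) {z : ℂ} (hz : z ∈ Metric.ball y ρ) :
    z ∈ Ω ↔ cellMap n γ J' j' J j z ∈ Ω := by
  have hn0 : (0 : ℝ) < n := by have := h.three_le
                               exact_mod_cast (by omega : 0 < n)
  set T := cellMap n γ J' j' J j with hT
  have hρ0 : 0 < ρ := Metric.pos_of_mem_ball hz
  have hcc : 0 < ‖chord n γ J j / chord n γ J' j'‖ :=
    norm_pos_iff.mpr (div_ne_zero (h.chord_ne_zero J j) (h.chord_ne_zero J' j'))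
  have hTc : Continuous T := by
    rw [hT]; unfold cellMap; fun_prop
  have hrest' : ∀ w ∈ Metric.ball y ρ, w ∉ cellRest n γ J' j' := fun w hw hwr =>
    absurd (hρ' w hwr) (not_le.mpr (by rw [dist_comm]; exact hw))
  have hrest : ∀ w ∈ Metric.ball y ρ, T w ∉ cellRest n γ J j := fun w hw hwr => by
    refine absurd (hρ (T w) hwr) (not_le.mpr ?_)
    rw [hT, dist_cellMap, dist_comm]
    exact mul_lt_mul_of_pos_left hw hcc
  have hmem : ∀ w ∈ Metric.ball y ρ, w ∉ cell n γ J' j' →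
      w ∉ range (loopCurve n γ) ∧ T w ∉ range (loopCurve n γ) := by
    intro w hw hwc
    constructor
    · intro hr
      exact (h.mem_cell_or_rest J' j' hr).elim hwc (hrest' w hw)
    · intro hr
      refine (h.mem_cell_or_rest J j hr).elim (fun hc => hwc ?_) (hrest w hw)
      exact (h.cellMap_mem_iff J' j' J j).mp hc
  have hsub : ∀ J j, cell n γ J j ⊆ range (loopCurve n γ) := fun J j => image_subset_range _ _
  by_cases hzc : z ∈ cell n γ J' j'
  · refine iff_of_false (fun hΩ => h.component_notMem hΩ (hsub _ _ hzc))
      (fun hΩ => h.component_notMem hΩ (hsub J j ((h.cellMap_mem_iff J' j' J j).mpr hzc)))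
  have hbn : ∀ J : ℕ, 1 ≤ ((n + 1 : ℕ) : ℝ) ^ J := fun J => one_le_pow₀ h.one_lt_base.le
  have hn1 : (1 : ℝ) ≤ n := by have := h.three_le
                               exact_mod_cast (by omega : 1 ≤ n)
  have hint1 : ∀ (J : ℕ) (j : ℤ), (j : ℝ) / ((n + 1 : ℕ) : ℝ) ^ J ≤
      (j + 1) / ((n + 1 : ℕ) : ℝ) ^ J := fun J j => by
    have := hbn J
    gcongr; linarith
  have hint2 : ∀ (J : ℕ) (j : ℤ), ((j : ℝ) + 1) / ((n + 1 : ℕ) : ℝ) ^ J ≤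
      j / ((n + 1 : ℕ) : ℝ) ^ J + n := fun J j => by
    rw [add_div]
    have : 1 / ((n + 1 : ℕ) : ℝ) ^ J ≤ 1 := div_le_one_of_le₀ (hbn J) (by positivity)
    linarith
  -- The turns of the cells themselves agree at `w` and `T w`, so off the cell `H` is the indicator
  -- of `w ∈ Ω` minus that of `T w ∈ Ω`. Defined through the rests, which avoid the ball, `H` is
  -- continuous on the whole ball.
  set H : ℂ → ℝ := fun w =>
    turn (fun t => loopCurve n γ t - w) ((j' + 1) / ((n + 1 : ℕ) : ℝ) ^ J')
      (j' / ((n + 1 : ℕ) : ℝ) ^ J' + n) -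
    turn (fun t => loopCurve n γ t - T w) ((j + 1) / ((n + 1 : ℕ) : ℝ) ^ J)
      (j / ((n + 1 : ℕ) : ℝ) ^ J + n) with hH
  have hHc : ContinuousOn H (Metric.ball y ρ) := by
    refine ContinuousOn.sub ?_ ?_
    · exact (turn_sub_continuousOn (hint2 J' j') h.continuous.continuousOn).mono hrest'
    · exact (turn_sub_continuousOn (hint2 J j) h.continuous.continuousOn).comp
        hTc.continuousOn hrest
  have hHeq : ∀ w ∈ Metric.ball y ρ, w ∉ cell n γ J' j' → H w =
      turn (fun t => loopCurve n γ t - w) (j' / ((n + 1 : ℕ) : ℝ) ^ J')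
        (j' / ((n + 1 : ℕ) : ℝ) ^ J' + n) -
      turn (fun t => loopCurve n γ t - T w) (j / ((n + 1 : ℕ) : ℝ) ^ J)
        (j / ((n + 1 : ℕ) : ℝ) ^ J + n) := by
    intro w hw hwc
    obtain ⟨hw1, hw2⟩ := hmem w hw hwc
    rw [← h.turn_add' hw1 (hint1 J' j') (hint2 J' j'), ← h.turn_add' hw2 (hint1 J j) (hint2 J j),
      h.turn_single_cell J' j' hw1, h.turn_single_cell J j hw2, hT, h.cellMap_normalized]
    simp only [hH, hT]
    ring
  have hHint : ∀ w ∈ Metric.ball y ρ, w ∉ cell n γ J' j' → ∃ k : ℤ, H w = k := by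
    intro w hw hwc
    obtain ⟨hw1, hw2⟩ := hmem w hw hwc
    rw [hHeq w hw hwc]
    rcases h.exists_turn_period_eq hw1 (j' / ((n + 1 : ℕ) : ℝ) ^ J') with ⟨-, e1⟩ | ⟨-, e1⟩ <;>
    rcases h.exists_turn_period_eq hw2 (j / ((n + 1 : ℕ) : ℝ) ^ J) with ⟨-, e2⟩ | ⟨-, e2⟩ <;>
    rw [e1, e2]
    · exact ⟨0, by simp⟩
    · exact ⟨1, by simp⟩
    · exact ⟨-1, by simp⟩
    · exact ⟨0, by simp⟩
  -- Integrality passes from the dense complement of the loop to all of the ball, because the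
  -- integers are closed in the reals; hence `H` is constant.
  have hHint' : ∀ w ∈ Metric.ball y ρ, ∃ k : ℤ, H w = k := by
    intro w hw
    have h1 : w ∈ closure (Metric.ball y ρ ∩ (range (loopCurve n γ))ᶜ) := by
      exact h.dense_compl_range.open_subset_closure_inter Metric.isOpen_ball hw
    have h2 := ContinuousWithinAt.mem_closure (t := range ((↑) : ℤ → ℝ))
      ((hHc w hw).mono (inter_subset_left (t := (range (loopCurve n γ))ᶜ))) h1
      (fun v hv => by
        obtain ⟨k, hk⟩ := hHint v hv.1 fun hc => hv.2 (hsub _ _ hc)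
        exact ⟨k, hk.symm⟩)
    rw [Int.isClosedEmbedding_coe_real.isClosed_range.closure_eq] at h2
    obtain ⟨k, hk⟩ := h2
    exact ⟨k, hk.symm⟩
  have hconst : ∀ w ∈ Metric.ball y ρ, H z = H w := fun w hw =>
    eq_of_isPreconnected_of_int (convex_ball y ρ).isPreconnected hHc hHint' hz hw
  have hyK := hsub _ _ hy
  obtain ⟨hz1, hz2⟩ := hmem z hz hzc
  have hzH := hHeq z hz hzc
  constructor
  · intro hzΩ
    by_contra hTΩ
    -- Here `H = 1`, but at a point outside `Ω` its value is `0` or `-1`. The converse uses a point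
    -- inside `Ω`.
    obtain ⟨w, hw, hwK, hwΩ⟩ := h.exists_outside hyK hρ0
    obtain ⟨hw1, hw2⟩ := hmem w hw fun hc => hwK (hsub _ _ hc)
    have hwH := hHeq w hw fun hc => hwK (hsub _ _ hc)
    rw [h.turn_period hzΩ, h.turn_period_outside hz2 hTΩ] at hzH
    rw [← hconst w hw, hzH, h.turn_period_outside hw1 hwΩ] at hwH
    rcases h.exists_turn_period_eq hw2 (j / ((n + 1 : ℕ) : ℝ) ^ J) with ⟨-, e2⟩ | ⟨-, e2⟩ <;>
      · rw [e2] at hwH; norm_num at hwH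
  · intro hTΩ
    by_contra hzΩ
    obtain ⟨w, hw, hwΩ⟩ := h.exists_inside hyK hρ0
    have hwK := h.component_notMem hwΩ
    obtain ⟨hw1, hw2⟩ := hmem w hw fun hc => hwK (hsub _ _ hc)
    have hwH := hHeq w hw fun hc => hwK (hsub _ _ hc)
    rw [h.turn_period hTΩ, h.turn_period_outside hz1 hzΩ] at hzH
    rw [← hconst w hw, hzH, h.turn_period hwΩ] at hwH
    rcases h.exists_turn_period_eq hw2 (j / ((n + 1 : ℕ) : ℝ) ^ J) with ⟨-, e2⟩ | ⟨-, e2⟩ <;>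
      · rw [e2] at hwH; norm_num at hwH

end IsKochLoop
end
end VonKoch

namespace VonKoch
noncomputable section

/-! ### Tube functions of cells and the order of the remainder. -/

namespace IsKochLoop

variable {n : ℕ} {r : ℝ} {γ κ : ℝ → ℂ} {Ω : Set ℂ} (h : IsKochLoop n r γ κ Ω)
include h

/-- Each cell moves away linearly from the rest of the loop. -/
theorem exists_cell_separation (J : ℕ) (j : ℤ) : ∃ c > 0, ∀ x ∈ cell n γ J j,
    ∀ y ∈ cellRest n γ J j,
    c * min ‖x - gridPoint n γ J j‖ ‖x - gridPoint n γ J (j + 1)‖ ≤ dist x y := by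
  obtain ⟨c, hc, hsep⟩ := h.exists_separation J j
  refine ⟨c, hc, ?_⟩
  rintro _ ⟨s, hs, rfl⟩ _ ⟨s', hs', rfl⟩
  rw [dist_eq_norm]
  exact hsep s hs s' hs'

theorem isOpen_component : IsOpen Ω := h.component.isOpen h.isClosed_range

theorem isBounded_cellTube (J : ℕ) (j : ℤ) (t : ℝ) : Bornology.IsBounded (cellTube n γ Ω J j t) :=
  h.component.isBounded.subset inter_subset_right

theorem isOpen_cellTube (J : ℕ) (j : ℤ) (t : ℝ) : IsOpen (cellTube n γ Ω J j t) :=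
  Metric.isOpen_thickening.inter h.isOpen_component

theorem cell_subset_cellRest (J : ℕ) {i j : ℕ} (hi : i < n * (n + 1) ^ J) (hj : j < n * (n + 1) ^ J)
    (hij : i ≠ j) : cell n γ J j ⊆ cellRest n γ J i := by
  rintro _ ⟨s, hs, rfl⟩
  have hb : (0 : ℝ) < ((n + 1 : ℕ) : ℝ) ^ J := pow_pos (base_pos (n := n)) J
  have hi' : (i : ℝ) + 1 ≤ n * ((n + 1 : ℕ) : ℝ) ^ J := by exact_mod_cast hi
  have hj' : (j : ℝ) + 1 ≤ n * ((n + 1 : ℕ) : ℝ) ^ J := by exact_mod_cast hj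
  have h1 := hs.1
  have h2 := hs.2
  rw [div_le_iff₀ hb] at h1
  rw [le_div_iff₀ hb] at h2
  have hi0 : (0 : ℝ) ≤ i := i.cast_nonneg
  have hj0 : (0 : ℝ) ≤ j := j.cast_nonneg
  push_cast at h1 h2 hi' hj'
  rcases lt_or_gt_of_ne hij with hlt | hlt
  · have hlt' : (i : ℝ) + 1 ≤ j := by exact_mod_cast hlt
    refine ⟨s, ⟨?_, ?_⟩, rfl⟩
    · rw [div_le_iff₀ hb]; push_cast; linarith
    · rw [← sub_le_iff_le_add, le_div_iff₀ hb]; push_cast; linarith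
  · have hlt' : (j : ℝ) + 1 ≤ i := by exact_mod_cast hlt
    -- A cell preceding cell `i` appears in its rest only after one period.
    refine ⟨s + n, ⟨?_, ?_⟩, h.loop_add_period s⟩
    · rw [div_le_iff₀ hb]; push_cast; linarith
    · have : s ≤ i / ((n + 1 : ℕ) : ℝ) ^ J := by
        rw [le_div_iff₀ hb]; push_cast; linarith
      push_cast at this ⊢
      linarith

theorem range_eq_iUnion_cell (J : ℕ) :
    range (loopCurve n γ) = ⋃ i ∈ Finset.range (n * (n + 1) ^ J), cell n γ J (i : ℕ) := by
  refine Subset.antisymm ?_ (iUnion₂_subset fun i _ => image_subset_range _ _)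
  rintro _ ⟨t, rfl⟩
  have hb : (0 : ℝ) < ((n + 1 : ℕ) : ℝ) ^ J := pow_pos (base_pos (n := n)) J
  have hn0 : (0 : ℝ) < n := by have := h.three_le
                               exact_mod_cast (by omega : 0 < n)
  obtain ⟨s, hs, hst⟩ := (show Function.Periodic (loopCurve n γ) n from
    h.loop_add_period).exists_mem_Ico hn0 t 0
  rw [hst, zero_add] at *
  have h0 : 0 ≤ s * ((n + 1 : ℕ) : ℝ) ^ J := mul_nonneg hs.1 hb.le
  refine mem_iUnion₂.mpr ⟨⌊s * ((n + 1 : ℕ) : ℝ) ^ J⌋₊, ?_, s, ⟨?_, ?_⟩, rfl⟩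
  · rw [Finset.mem_range, Nat.floor_lt h0]
    push_cast
    have := hs.2
    push_cast at hb
    exact mul_lt_mul_of_pos_right this hb
  · rw [div_le_iff₀ hb, Int.cast_natCast]; exact Nat.floor_le h0
  · rw [le_div_iff₀ hb, Int.cast_natCast]; exact (Nat.lt_floor_add_one _).le

/-- Up to an error of order `t²`, the tube function is the sum of the tube functions of the
cells. -/
theorem exists_tube_decomposition (J : ℕ) : ∃ C : ℝ, ∀ t > 0,
    |volume.real (Metric.thickening t (range (loopCurve n γ)) ∩ Ω) -
      ∑ i ∈ Finset.range (n * (n + 1) ^ J), volume.real (cellTube n γ Ω J (i : ℕ) t)| ≤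
      C * t ^ 2 := by
  choose c hc hsep using fun i : ℕ => h.exists_cell_separation J i
  -- A point within `t` of two cells comes from points less than `2 t` apart, so by separation the
  -- first is within `3 t / c i` of an end point (the `3` leaves room). The overlap lies in two
  -- discs of radius `t + 3 t / c i`.
  refine ⟨∑ i ∈ Finset.range (n * (n + 1) ^ J), 2 * Real.pi * (1 + 3 / c i) ^ 2,
    fun t ht => ?_⟩
  have hU : Metric.thickening t (range (loopCurve n γ)) ∩ Ω =
      ⋃ i ∈ Finset.range (n * (n + 1) ^ J), cellTube n γ Ω J (i : ℕ) t := by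
    rw [h.range_eq_iUnion_cell J]
    simp only [Metric.thickening_iUnion, cellTube, iUnion_inter]
  rw [hU]
  refine (abs_volume_biUnion_sub_sum_le _ _
    (fun i : ℕ => endDiscs n γ J i (t + 3 * t / c i)) (fun i _ => h.isBounded_cellTube J i t)
    (fun i _ => isBounded_endDiscs _ _ _ _ _) (fun i _ => (h.isOpen_cellTube J i t).measurableSet)
    (fun i _ => (Metric.isOpen_ball.union Metric.isOpen_ball).measurableSet) ?_).trans ?_
  · rintro i hi j hj hij z ⟨⟨hz1, -⟩, hz2, -⟩
    obtain ⟨x, hx, hzx⟩ := Metric.mem_thickening_iff.mp hz1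
    obtain ⟨y, hy, hzy⟩ := Metric.mem_thickening_iff.mp hz2
    have hyr := h.cell_subset_cellRest J (Finset.mem_range.mp hi) (Finset.mem_range.mp hj) hij hy
    have h1 := hsep i x hx y hyr
    refine mem_endDiscs_of_min_lt ?_ hzx
    rw [lt_div_iff₀ (hc i), mul_comm]
    linarith [dist_triangle_left x y z]
  · rw [Finset.sum_mul]
    refine Finset.sum_le_sum fun i _ => ?_
    have := hc i
    refine (volume_endDiscs_le n γ J i (by positivity)).trans (le_of_eq ?_)
    field_simp

/-- Up to an error of order `t²`, the tube functions of the cells are related by scaling. -/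
theorem exists_cellTube_scaling (J' : ℕ) (j' : ℤ) (J : ℕ) (j : ℤ) {q : ℝ}
    (hq : q = ‖chord n γ J' j'‖ / ‖chord n γ J j‖) : ∃ C : ℝ, ∀ t > 0,
    |volume.real (cellTube n γ Ω J' j' t) - q ^ 2 * volume.real (cellTube n γ Ω J j (t / q))| ≤
      C * t ^ 2 := by
  obtain ⟨c', hc', hsep'⟩ := h.exists_cell_separation J' j'
  obtain ⟨c, hc, hsep⟩ := h.exists_cell_separation J j
  have hd := norm_pos_iff.mpr (h.chord_ne_zero J j)
  have hd' := norm_pos_iff.mpr (h.chord_ne_zero J' j')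
  have hq0 : 0 < q := by rw [hq]; positivity
  have hqinv : ‖chord n γ J j / chord n γ J' j'‖ = q⁻¹ := by rw [hq, norm_div, inv_div]
  set e := min c' c with he
  have he0 : 0 < e := lt_min hc' hc
  refine ⟨2 * Real.pi * (1 + 2 / e) ^ 2, fun t ht => ?_⟩
  set T := cellMap n γ J' j' J j with hT
  have hvol : volume.real (T ⁻¹' cellTube n γ Ω J j (t / q)) =
      q ^ 2 * volume.real (cellTube n γ Ω J j (t / q)) := by
    have := volume_preimage_affine (div_ne_zero (h.chord_ne_zero J j) (h.chord_ne_zero J' j'))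
      (gridPoint n γ J j) (gridPoint n γ J' j') (cellTube n γ Ω J j (t / q))
    rw [hqinv, inv_pow, inv_inv] at this
    exact this
  have hthick : ∀ z, T z ∈ Metric.thickening (t / q) (cell n γ J j) ↔
      z ∈ Metric.thickening t (cell n γ J' j') := by
    intro z
    simp only [Metric.mem_thickening_iff]
    constructor
    · rintro ⟨w, hw, hzw⟩
      refine ⟨cellMap n γ J j J' j' w, (h.cellMap_mem_iff J j J' j').mpr hw, ?_⟩
      rw [← h.cellMap_cellMap J' j' J j w, hT, dist_cellMap, hqinv, lt_div_iff₀ hq0] at hzw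
      calc _ = q⁻¹ * dist z (cellMap n γ J j J' j' w) * q := by field_simp
        _ < t := hzw
    · rintro ⟨w, hw, hzw⟩
      refine ⟨T w, (h.cellMap_mem_iff J' j' J j).mpr hw, ?_⟩
      rw [hT, dist_cellMap, hqinv, div_eq_inv_mul]
      exact mul_lt_mul_of_pos_left hzw (by positivity)
  -- Away from the end discs the nearby cell point `y` is at least `t` from the rest of its cell,
  -- and its image at least `t / q` from the other rest, so the similarity respects `Ω` there. The
  -- constant `e` serves both cells.
  have hB : ∀ z ∈ Metric.thickening t (cell n γ J' j'),
      z ∉ endDiscs n γ J' j' (t + 2 * t / e) → (z ∈ Ω ↔ T z ∈ Ω) := by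
    intro z hz hzB
    obtain ⟨y, hy, hzy⟩ := Metric.mem_thickening_iff.mp hz
    have hmin : t ≤ e * min ‖y - gridPoint n γ J' j'‖ ‖y - gridPoint n γ J' (j' + 1)‖ := by
      by_contra! hcon
      refine hzB (mem_endDiscs_of_min_lt ?_ hzy)
      rw [lt_div_iff₀ he0, mul_comm]; linarith
    refine h.mem_iff_cellMap_mem J' j' J j hy (ρ := t) (fun x hx => ?_) (fun x hx => ?_)
      (Metric.mem_ball.mpr hzy)
    · refine hmin.trans (le_trans ?_ (hsep' y hy x hx))
      gcongr
      exact min_le_left _ _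
    · refine le_trans ?_ (hsep (T y) ((h.cellMap_mem_iff J' j' J j).mpr hy) x hx)
      have e1 : ‖T y - gridPoint n γ J j‖ = q⁻¹ * ‖y - gridPoint n γ J' j'‖ := by
        rw [← hqinv, ← norm_mul, hT, cellMap, add_sub_cancel_left]
      have e2 : ‖T y - gridPoint n γ J (j + 1)‖ = q⁻¹ * ‖y - gridPoint n γ J' (j' + 1)‖ := by
        rw [← hqinv, ← norm_mul, hT, cellMap]
        congr 1
        have h1 : gridPoint n γ J (j + 1) = gridPoint n γ J j + chord n γ J j := by
          rw [chord]; ring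
        have h2 : gridPoint n γ J' (j' + 1) = gridPoint n γ J' j' + chord n γ J' j' := by
          rw [chord]; ring
        have := h.chord_ne_zero J' j'
        rw [h1, h2]; field_simp; ring
      rw [e1, e2, hqinv, ← mul_min_of_nonneg _ _ (inv_nonneg.mpr hq0.le), mul_left_comm]
      refine mul_le_mul_of_nonneg_left (hmin.trans ?_) (by positivity)
      gcongr
      exact min_le_right _ _
  have hbd : Bornology.IsBounded (T ⁻¹' cellTube n γ Ω J j (t / q)) := by
    refine (Metric.isBounded_iff_subset_closedBall (gridPoint n γ J' j')).mpr ?_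
    obtain ⟨M, hM⟩ := ((Metric.isBounded_iff_subset_closedBall (gridPoint n γ J j)).mp
      (h.isBounded_cellTube J j (t / q)))
    refine ⟨q * M, fun z hz => ?_⟩
    have h1 := hM hz
    rw [Metric.mem_closedBall] at h1 ⊢
    have h2 : T (gridPoint n γ J' j') = gridPoint n γ J j := by
      rw [hT, cellMap, sub_self, mul_zero, add_zero]
    rw [← h2, hT, dist_cellMap, hqinv, inv_mul_le_iff₀ hq0] at h1
    exact h1
  rw [← hvol]
  refine (abs_volume_sub_le (h.isBounded_cellTube J' j' t) hbd
    (isBounded_endDiscs n γ J' j' (t + 2 * t / e)) ?_ ?_).trans ?_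
  · rintro z ⟨hz1, hz2⟩
    by_cases hzB : z ∈ endDiscs n γ J' j' (t + 2 * t / e)
    · exact Or.inr hzB
    · exact Or.inl ⟨(hthick z).mpr hz1, (hB z hz1 hzB).mp hz2⟩
  · rintro z ⟨hz1, hz2⟩
    by_cases hzB : z ∈ endDiscs n γ J' j' (t + 2 * t / e)
    · exact Or.inr hzB
    · have := (hthick z).mp hz1
      exact Or.inl ⟨this, (hB z this hzB).mpr hz2⟩
  · refine (volume_endDiscs_le n γ J' j' (by positivity)).trans (le_of_eq ?_)
    field_simp

theorem norm_chord_zero (k : ℤ) : ‖chord n γ 0 k‖ = 1 := by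
  rw [h.chord_zero, norm_zpow, norm_unitRoot, one_zpow]

theorem norm_chord_one (k : ℤ) {i : ℕ} (hi : i < n + 1) :
    ‖chord n γ 1 ((n + 1 : ℕ) * k + i)‖ = if i = 0 ∨ i = n then conjRatio r else r := by
  have := h.chord_refine 0 k hi
  rw [zero_add] at this
  rw [this, norm_mul, h.norm_chord_zero, one_mul, norm_koch_step h.three_le h.pos h.lt_one hi]

omit h in
theorem sum_ratio (hn : 3 ≤ n) (f : ℝ → ℝ) :
    ∑ i ∈ Finset.range (n + 1), f (if i = 0 ∨ i = n then conjRatio r else r) =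
      2 * f (conjRatio r) + (n - 1) * f r := by
  obtain ⟨m, rfl⟩ : ∃ m, n = m + 1 := ⟨n - 1, by omega⟩
  rw [Finset.sum_range_succ, Finset.sum_range_succ']
  have : ∀ i ∈ Finset.range m, f (if i + 1 = 0 ∨ i + 1 = m + 1 then conjRatio r else r) = f r := by
    intro i hi
    have := Finset.mem_range.mp hi
    rw [if_neg (by omega)]
  rw [Finset.sum_congr rfl this]
  simp
  ring

omit h in
theorem sum_range_mul (f : ℕ → ℝ) (m b : ℕ) : ∑ i ∈ Finset.range (m * b), f i =
    ∑ k ∈ Finset.range m, ∑ i ∈ Finset.range b, f (b * k + i) := by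
  induction m with
  | zero => simp
  | succ m ih =>
    rw [Finset.sum_range_succ, ← ih, add_mul, one_mul, Finset.sum_range_add, mul_comm b]

/-- The remainder in the scaling functional equation of the tube function is of order `t²`. -/
theorem exists_remainder_le : ∃ C : ℝ, ∀ t > 0,
    |volume.real (Metric.thickening t (range (loopCurve n γ)) ∩ Ω) -
      (2 * (conjRatio r ^ 2 * volume.real
        (Metric.thickening (t / conjRatio r) (range (loopCurve n γ)) ∩ Ω)) +
      (n - 1) * (r ^ 2 * volume.real
        (Metric.thickening (t / r) (range (loopCurve n γ)) ∩ Ω)))| ≤ C * t ^ 2 := by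
  have hn := h.three_le
  obtain ⟨C₀, hC₀⟩ := h.exists_tube_decomposition 0
  obtain ⟨C₁, hC₁⟩ := h.exists_tube_decomposition 1
  set q : ℕ → ℝ := fun i => if i = 0 ∨ i = n then conjRatio r else r with hq
  have hq0 : ∀ i, 0 < q i := by
    intro i
    simp only [hq]
    split_ifs
    · exact conjRatio_pos h.lt_one
    · exact h.pos
  have hscale : ∀ k i : ℕ, ∃ C : ℝ, i < n + 1 → ∀ t > 0,
      |volume.real (cellTube n γ Ω 1 ((n + 1 : ℕ) * (k : ℤ) + i) t) -
        q i ^ 2 * volume.real (cellTube n γ Ω 0 k (t / q i))| ≤ C * t ^ 2 := by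
    intro k i
    by_cases hi : i < n + 1
    · obtain ⟨C, hC⟩ := h.exists_cellTube_scaling 1 ((n + 1 : ℕ) * (k : ℤ) + i) 0 k (q := q i)
        (by rw [h.norm_chord_one _ hi, h.norm_chord_zero, div_one])
      exact ⟨C, fun _ => hC⟩
    · exact ⟨0, fun hi' => absurd hi' hi⟩
  choose C hC using hscale
  set V : ℝ → ℝ := fun t => volume.real (Metric.thickening t (range (loopCurve n γ)) ∩ Ω) with hV
  set v : ℕ → ℤ → ℝ → ℝ := fun J j t => volume.real (cellTube n γ Ω J j t) with hv
  refine ⟨C₁ + ∑ k ∈ Finset.range n, ∑ i ∈ Finset.range (n + 1), C k i +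
    ∑ i ∈ Finset.range (n + 1), C₀, fun t ht => ?_⟩
  -- The chain of comparisons: tube of the loop, level-1 cells (`e1`), rescaled level-0 cells
  -- (`e2`), rescaled tubes of the loop (`e3`, which uses `e0` at scale `t / q i`).
  have e0 : ∀ s > 0, |V s - ∑ k ∈ Finset.range n, v 0 k s| ≤ C₀ * s ^ 2 := by
    intro s hs
    have := hC₀ s hs
    rwa [pow_zero, mul_one] at this
  have e1 : |V t - ∑ k ∈ Finset.range n, ∑ i ∈ Finset.range (n + 1),
      v 1 ((n + 1 : ℕ) * (k : ℤ) + i) t| ≤ C₁ * t ^ 2 := by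
    have := hC₁ t ht
    rw [pow_one, sum_range_mul] at this
    push_cast at this ⊢
    exact this
  have e2 : |∑ k ∈ Finset.range n, ∑ i ∈ Finset.range (n + 1),
      v 1 ((n + 1 : ℕ) * (k : ℤ) + i) t -
      ∑ k ∈ Finset.range n, ∑ i ∈ Finset.range (n + 1), q i ^ 2 * v 0 k (t / q i)| ≤
      (∑ k ∈ Finset.range n, ∑ i ∈ Finset.range (n + 1), C k i) * t ^ 2 := by
    simp only [← Finset.sum_sub_distrib, Finset.sum_mul]
    refine (Finset.abs_sum_le_sum_abs _ _).trans (Finset.sum_le_sum fun k _ => ?_)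
    refine (Finset.abs_sum_le_sum_abs _ _).trans (Finset.sum_le_sum fun i hi => ?_)
    exact hC k i (Finset.mem_range.mp hi) t ht
  have e3 : |∑ i ∈ Finset.range (n + 1), q i ^ 2 * V (t / q i) -
      ∑ k ∈ Finset.range n, ∑ i ∈ Finset.range (n + 1), q i ^ 2 * v 0 k (t / q i)| ≤
      (∑ i ∈ Finset.range (n + 1), C₀) * t ^ 2 := by
    rw [Finset.sum_comm, ← Finset.sum_sub_distrib, Finset.sum_mul]
    refine (Finset.abs_sum_le_sum_abs _ _).trans (Finset.sum_le_sum fun i _ => ?_)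
    rw [← Finset.mul_sum, ← mul_sub, abs_mul, abs_of_nonneg (sq_nonneg _)]
    have := hq0 i
    refine (mul_le_mul_of_nonneg_left (e0 (t / q i) (by positivity)) (sq_nonneg _)).trans
      (le_of_eq ?_)
    field_simp
  have e4 := sum_ratio (r := r) hn fun x => x ^ 2 * V (t / x)
  change ∑ i ∈ Finset.range (n + 1), q i ^ 2 * V (t / q i) = _ at e4
  change |V t - (2 * (conjRatio r ^ 2 * V (t / conjRatio r)) + (n - 1) * (r ^ 2 * V (t / r)))| ≤ _
  rw [← e4, add_mul, add_mul]
  rw [abs_le] at *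
  constructor <;> linarith [e1.1, e1.2, e2.1, e2.2, e3.1, e3.2]

/-- The tube function is at least of order `t²`. -/
theorem eventually_le_tube : ∀ᶠ t in 𝓝[>] (0 : ℝ),
    ENNReal.ofReal (t ^ 2 / 4) ≤
      volume (Metric.thickening t (range (loopCurve n γ)) ∩ Ω) := by
  obtain ⟨z₀, hz₀⟩ := h.component.nonempty
  have hcl := h.isClosed_range
  have hne : (range (loopCurve n γ)).Nonempty := range_nonempty _
  obtain ⟨y, hy, hyd⟩ := hcl.exists_infDist_eq_dist hne z₀
  set d := dist z₀ y with hd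
  have hd0 : 0 < d := dist_pos.mpr fun he => h.component_notMem hz₀ (he ▸ hy)
  have hball : Metric.ball z₀ d ⊆ Ω := by
    obtain ⟨⟨x, hx, hxΩ⟩, -⟩ := h.component
    rw [hxΩ] at hz₀ ⊢
    rw [connectedComponentIn_eq hz₀]
    refine (convex_ball z₀ d).isPreconnected.subset_connectedComponentIn
      (Metric.mem_ball_self hd0) fun w hw hwK => ?_
    have := Metric.infDist_le_dist_of_mem (x := z₀) hwK
    rw [hyd, dist_comm] at this
    exact absurd hw (not_lt.mpr this)
  filter_upwards [Ioo_mem_nhdsGT hd0] with t ht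
  -- The disc of radius `t / 2` about the point at distance `t / 2` from `y` towards `z₀` lies in
  -- the tube and in the inscribed disc of `Ω`.
  set w := AffineMap.lineMap y z₀ (t / 2 / d) with hw
  have ht2 : 0 ≤ t / 2 / d := by have := ht.1; positivity
  have hwy : dist w y = t / 2 := by
    rw [hw, dist_lineMap_left, Real.norm_of_nonneg ht2, dist_comm y, ← hd,
      div_mul_cancel₀ _ hd0.ne']
  have hwz : dist w z₀ = d - t / 2 := by
    rw [hw, dist_lineMap_right, dist_comm y, ← hd, Real.norm_of_nonneg, sub_mul, one_mul,
      div_mul_cancel₀ _ hd0.ne']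
    rw [sub_nonneg, div_le_one hd0]; linarith [ht.1, ht.2]
  have hsub : Metric.ball w (t / 2) ⊆ Metric.thickening t (range (loopCurve n γ)) ∩ Ω := by
    intro v hv
    rw [Metric.mem_ball] at hv
    refine ⟨Metric.mem_thickening_iff.mpr ⟨y, hy, ?_⟩, hball ?_⟩
    · linarith [dist_triangle v w y]
    · rw [Metric.mem_ball]; linarith [dist_triangle v w z₀]
  refine le_trans ?_ (measure_mono hsub)
  rw [Complex.volume_ball, ← ENNReal.ofReal_pow (by linarith [ht.1])]
  have h1 : (1 : ENNReal) ≤ NNReal.pi := by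
    have : (1 : ℝ) ≤ Real.pi := by linarith [Real.pi_gt_three]
    exact_mod_cast this
  calc ENNReal.ofReal (t ^ 2 / 4) = ENNReal.ofReal ((t / 2) ^ 2) * 1 := by
        rw [mul_one]; congr 1; ring
    _ ≤ _ := mul_le_mul_right h1 _

end IsKochLoop
end
end VonKoch

namespace VonKoch
noncomputable section

/-! ### Tube zeta functions -/

/-- As `s - 3 = (s - 2) - 1`, the integral is a Mellin transform at `s - 2`, so convergence and
holomorphy follow from growth at `0` alone. -/
theorem zetaIntegral_eq_mellin (f : ℝ → ℝ) {a b : ℝ} (ha : 0 ≤ a) (hab : a ≤ b) (s : ℂ) :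
    zetaIntegral f a b s = mellin ((Ioc a b).indicator fun t => (f t : ℂ)) (s - 2) := by
  rw [zetaIntegral, intervalIntegral.integral_of_le hab, mellin,
    ← integral_indicator measurableSet_Ioc, ← integral_indicator measurableSet_Ioi]
  congr 1
  ext t
  by_cases ht : t ∈ Ioc a b
  · simp [ht, (ha.trans_lt ht.1)]
  · by_cases ht0 : t ∈ Ioi (0 : ℝ) <;> simp [ht, ht0]

theorem isBigO_indicator_atTop (f : ℝ → ℝ) (a b p : ℝ) :
    ((Ioc a b).indicator fun t => (f t : ℂ)) =O[atTop] fun t : ℝ => t ^ p := by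
  refine (Asymptotics.isBigO_zero _ _).congr' ?_ EventuallyEq.rfl
  filter_upwards [eventually_gt_atTop b] with t ht
  rw [indicator_of_notMem fun h => absurd h.2 (not_le.mpr ht)]

theorem locallyIntegrableOn_indicator {f : ℝ → ℝ} (hf : LocallyIntegrable f) (a b : ℝ) :
    LocallyIntegrableOn ((Ioc a b).indicator fun t => (f t : ℂ)) (Ioi 0) := by
  have h1 : LocallyIntegrable fun t => (f t : ℂ) := by
    intro x
    obtain ⟨U, hU, hi⟩ := hf x
    exact ⟨U, hU, hi.ofReal⟩
  refine LocallyIntegrable.locallyIntegrableOn ?_ _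
  intro x
  obtain ⟨U, hU, hi⟩ := h1 x
  exact ⟨U, hU, hi.indicator measurableSet_Ioc⟩

/-- Partial tube zeta functions away from zero are entire. -/
theorem differentiable_zetaIntegral {f : ℝ → ℝ} (hf : LocallyIntegrable f) {a b : ℝ} (ha : 0 < a)
    (hab : a ≤ b) : Differentiable ℂ (zetaIntegral f a b) := by
  intro s
  rw [show zetaIntegral f a b = fun s => mellin ((Ioc a b).indicator fun t => (f t : ℂ)) (s - 2)
    from funext (zetaIntegral_eq_mellin f ha.le hab)]
  have h0 : ((Ioc a b).indicator fun t => (f t : ℂ)) =O[𝓝[>] 0]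
      fun t : ℝ => t ^ (-((s - 2).re - 1)) := by
    refine (Asymptotics.isBigO_zero _ _).congr' ?_ EventuallyEq.rfl
    filter_upwards [mem_nhdsWithin_of_mem_nhds (gt_mem_nhds ha)] with t ht
    rw [indicator_of_notMem fun h => absurd h.1 (not_lt.mpr (le_of_lt ht))]
  have := mellin_differentiableAt_of_isBigO_rpow (s := s - 2) (a := (s - 2).re + 1)
    (locallyIntegrableOn_indicator hf a b) (isBigO_indicator_atTop f a b _) (by linarith) h0
    (by linarith)
  exact DifferentiableAt.comp (f := fun s : ℂ => s - 2) s this (by fun_prop)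

theorem isBigO_indicator_zero {f : ℝ → ℝ} {p : ℝ} (hO : f =O[𝓝[>] 0] fun t : ℝ => t ^ p) (δ : ℝ) :
    ((Ioc 0 δ).indicator fun t => (f t : ℂ)) =O[𝓝[>] 0] fun t : ℝ => t ^ (-(-p)) := by
  rw [neg_neg]
  refine Asymptotics.IsBigO.trans (Asymptotics.isBigO_of_le _ fun t => ?_) hO
  rw [← Complex.norm_real]
  exact norm_indicator_le_norm_self _ _

theorem zetaConverges_of_isBigO {f : ℝ → ℝ} (hf : LocallyIntegrable f) {p : ℝ}
    (hO : f =O[𝓝[>] 0] fun t : ℝ => t ^ p) {δ : ℝ} (hδ : 0 < δ) {s : ℂ} (hs : 2 - p < s.re) :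
    ZetaConverges f 0 δ s := by
  have hs2 : (s - 2).re = s.re - 2 := by simp
  have h1 := mellinConvergent_of_isBigO_rpow (s := s - 2) (a := (s - 2).re + 1)
    (locallyIntegrableOn_indicator hf 0 δ) (isBigO_indicator_atTop f 0 δ _) (by linarith)
    (isBigO_indicator_zero hO δ) (by rw [hs2]; linarith)
  rw [ZetaConverges, intervalIntegrable_iff_integrableOn_Ioc_of_le hδ.le]
  refine (h1.mono_set (Ioc_subset_Ioi_self (a := δ) (b := (0 : ℝ)))).congr_fun (fun t ht => ?_) measurableSet_Ioc
  simp [ht.1, ht.2]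

theorem differentiableAt_zetaIntegral_of_isBigO {f : ℝ → ℝ} (hf : LocallyIntegrable f) {p : ℝ}
    (hO : f =O[𝓝[>] 0] fun t : ℝ => t ^ p) {δ : ℝ} (hδ : 0 < δ) {s : ℂ} (hs : 2 - p < s.re) :
    DifferentiableAt ℂ (zetaIntegral f 0 δ) s := by
  have hs2 : (s - 2).re = s.re - 2 := by simp
  have h1 := mellin_differentiableAt_of_isBigO_rpow (s := s - 2) (a := (s - 2).re + 1)
    (locallyIntegrableOn_indicator hf 0 δ) (isBigO_indicator_atTop f 0 δ _) (by linarith)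
    (isBigO_indicator_zero hO δ) (by rw [hs2]; linarith)
  rw [show zetaIntegral f 0 δ = fun s => mellin ((Ioc 0 δ).indicator fun t => (f t : ℂ)) (s - 2)
    from funext (zetaIntegral_eq_mellin f le_rfl hδ.le)]
  exact DifferentiableAt.comp (f := fun s : ℂ => s - 2) s h1 (by fun_prop)

theorem isOpen_halfPlane (σ : ℝ) : IsOpen (halfPlane σ) :=
  isOpen_lt continuous_const Complex.continuous_re

theorem isConnected_halfPlane (σ : ℝ) : IsConnected (halfPlane σ) :=
  ⟨⟨(σ + 1 : ℝ), by simp [halfPlane]⟩, (convex_halfSpace_re_gt σ).isPreconnected⟩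

theorem halfPlane_anti {σ σ' : ℝ} (hσ : σ ≤ σ') : halfPlane σ' ⊆ halfPlane σ := fun _ hs =>
  hσ.trans_lt hs

/-- The integral of a rescaled function. -/
theorem zetaIntegral_comp_div (f : ℝ → ℝ) {q δ : ℝ} (hq : 0 < q) (hδ : 0 < δ) (s : ℂ) :
    (q : ℂ) ^ 2 * zetaIntegral (fun t => f (t / q)) 0 δ s =
      (q : ℂ) ^ s * zetaIntegral f 0 (δ / q) s := by
  have hqc : (q : ℂ) ≠ 0 := by exact_mod_cast hq.ne'
  have h1 := intervalIntegral.integral_comp_div (a := 0) (b := δ) (c := q)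
    (fun u : ℝ => ((q * u : ℝ) : ℂ) ^ (s - 2 - 1) * (f u : ℂ)) hq.ne'
  rw [zero_div] at h1
  have h2 : zetaIntegral (fun t => f (t / q)) 0 δ s =
      ∫ t in (0 : ℝ)..δ, ((q * (t / q) : ℝ) : ℂ) ^ (s - 2 - 1) * (f (t / q) : ℂ) := by
    rw [zetaIntegral]
    congr 1
    ext t
    rw [mul_div_cancel₀ _ hq.ne']
  have h3 : ∫ u in (0 : ℝ)..(δ / q), ((q * u : ℝ) : ℂ) ^ (s - 2 - 1) * (f u : ℂ) =
      (q : ℂ) ^ (s - 2 - 1) * zetaIntegral f 0 (δ / q) s := by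
    rw [zetaIntegral, ← intervalIntegral.integral_const_mul]
    refine intervalIntegral.integral_congr fun u hu => ?_
    rw [uIcc_of_le (by positivity)] at hu
    change ((q * u : ℝ) : ℂ) ^ (s - 2 - 1) * (f u : ℂ) =
      (q : ℂ) ^ (s - 2 - 1) * ((u : ℂ) ^ (s - 2 - 1) * (f u : ℂ))
    rw [Complex.ofReal_mul, Complex.mul_cpow_ofReal_nonneg hq.le hu.1, mul_assoc]
  rw [h2, h1, h3, Complex.real_smul, Complex.cpow_sub _ _ hqc, Complex.cpow_sub _ _ hqc,
    Complex.cpow_one, show (2 : ℂ) = ((2 : ℕ) : ℂ) by norm_num, Complex.cpow_natCast]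
  field_simp

theorem zetaIntegral_add {f : ℝ → ℝ} {a b c : ℝ} {s : ℂ} (h1 : ZetaConverges f a b s)
    (h2 : ZetaConverges f b c s) :
    zetaIntegral f a b s + zetaIntegral f b c s = zetaIntegral f a c s :=
  intervalIntegral.integral_add_adjacent_intervals h1 h2

/-- The difference has infinite order at one point far to the right, hence everywhere in the
connected half-plane. -/
theorem eventuallyEq_nhdsNE_of_meromorphicOn {f g : ℂ → ℂ} {σ σ' : ℝ}
    (hf : MeromorphicOn f (halfPlane σ)) (hg : MeromorphicOn g (halfPlane σ))
    (he : ∀ s ∈ halfPlane σ', f s = g s) {s : ℂ} (hs : s ∈ halfPlane σ) : f =ᶠ[𝓝[≠] s] g := by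
  set m := max σ σ' + 1 with hm
  have hm1 : (m : ℂ) ∈ halfPlane σ := by
    simp only [halfPlane, mem_ofPred_eq, Complex.ofReal_re]; linarith [le_max_left σ σ']
  have hm2 : (m : ℂ) ∈ halfPlane σ' := by
    simp only [halfPlane, mem_ofPred_eq, Complex.ofReal_re]; linarith [le_max_right σ σ']
  have h1 : meromorphicOrderAt (f - g) m = ⊤ := by
    rw [meromorphicOrderAt_eq_top_iff]
    refine Filter.Eventually.filter_mono nhdsWithin_le_nhds ?_
    filter_upwards [(isOpen_halfPlane σ').mem_nhds hm2] with z hz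
    simp [he z hz]
  have h2 : meromorphicOrderAt (f - g) s = ⊤ := by
    by_contra hne
    exact (hf.sub hg).exists_meromorphicOrderAt_ne_top_iff_forall (isConnected_halfPlane σ) |>.mp
      ⟨⟨s, hs⟩, hne⟩ ⟨m, hm1⟩ h1
  rw [meromorphicOrderAt_eq_top_iff] at h2
  filter_upwards [h2] with z hz
  exact sub_eq_zero.mp hz

theorem IsTubeZeta.eventuallyEq {X Ω : Set ℂ} {δ σ₀ σ : ℝ} {Z M : ℂ → ℂ}
    (hZ : IsTubeZeta X Ω δ σ₀ Z) (hM : MeromorphicOn M (halfPlane σ₀))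
    (he : ∀ s ∈ halfPlane σ, M s = zetaIntegral (tubeFunction X Ω) 0 δ s) {s : ℂ}
    (hs : s ∈ halfPlane σ₀) : Z =ᶠ[𝓝[≠] s] M := by
  obtain ⟨hZm, σ', hσ'⟩ := hZ
  refine eventuallyEq_nhdsNE_of_meromorphicOn (σ' := max σ σ') hZm.meromorphicOn hM
    (fun w hw => ?_) hs
  rw [(hσ' w ((le_max_right _ _).trans_lt hw)).2, he w (halfPlane_anti (le_max_left _ _) hw)]

/-- Normal form is what upgrades equality on a punctured neighbourhood to equality at the point
itself. -/
theorem IsTubeZeta.eventuallyEq_nhds {X Ω : Set ℂ} {δ σ₀ : ℝ} {Z M : ℂ → ℂ}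
    (hZ : IsTubeZeta X Ω δ σ₀ Z) {s : ℂ} (hs : s ∈ halfPlane σ₀) (he : Z =ᶠ[𝓝[≠] s] M)
    (hM : AnalyticAt ℂ M s) : Z =ᶠ[𝓝 s] M :=
  ((hZ.1 hs).eventuallyEq_nhdsNE_iff_eventuallyEq_nhds hM.meromorphicNFAt).mp he

theorem tubeFunction_nonneg (X Ω : Set ℂ) (t : ℝ) : 0 ≤ tubeFunction X Ω t :=
  ENNReal.toReal_nonneg

section bounded

variable {X Ω : Set ℂ} (hΩ : volume Ω ≠ ⊤)
include hΩ

theorem tubeFunction_le (t : ℝ) : tubeFunction X Ω t ≤ volume.real Ω :=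
  measureReal_mono inter_subset_right hΩ

theorem monotone_tubeFunction : Monotone (tubeFunction X Ω) := fun _ _ hst =>
  measureReal_mono (inter_subset_inter_left _ (Metric.thickening_mono hst X))
    (measure_ne_top_of_subset inter_subset_right hΩ)

theorem locallyIntegrable_tubeFunction : LocallyIntegrable (tubeFunction X Ω) :=
  (monotone_tubeFunction hΩ).locallyIntegrable

theorem isBigO_tubeFunction : tubeFunction X Ω =O[𝓝[>] 0] fun t : ℝ => t ^ (0 : ℝ) := by
  simp only [Real.rpow_zero]
  refine Asymptotics.IsBigO.of_bound (volume.real Ω) (Eventually.of_forall fun t => ?_)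
  rw [Real.norm_of_nonneg (tubeFunction_nonneg X Ω t), norm_one, mul_one]
  exact tubeFunction_le hΩ t

theorem zetaConverges_tubeFunction_pos {a b : ℝ} (ha : 0 < a) (hab : a ≤ b) (s : ℂ) :
    ZetaConverges (tubeFunction X Ω) a b s := by
  rw [ZetaConverges]
  have h1 : IntervalIntegrable (fun t => (tubeFunction X Ω t : ℂ)) volume a b :=
    ⟨(monotone_tubeFunction hΩ).intervalIntegrable.1.ofReal,
      (monotone_tubeFunction hΩ).intervalIntegrable.2.ofReal⟩
  refine h1.continuousOn_mul fun t ht => ?_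
  rw [uIcc_of_le hab] at ht
  exact (Complex.continuousAt_ofReal_cpow_const t _ (Or.inr (ha.trans_le ht.1).ne')).continuousWithinAt

/-- The tube zeta functions for two values of `δ` differ by an entire function, so that they have
the same poles. -/
theorem IsTubeZeta.poles_subset {δ δ' σ₀ : ℝ} (hδ : 0 < δ) (hδ' : 0 < δ') {Z Z' : ℂ → ℂ}
    (hZ : IsTubeZeta X Ω δ σ₀ Z) (hZ' : IsTubeZeta X Ω δ' σ₀ Z') : poles σ₀ Z' ⊆ poles σ₀ Z := by
  rintro s ⟨hs, hpole⟩
  refine ⟨hs, ?_⟩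
  by_contra hnn
  rw [not_lt] at hnn
  obtain ⟨G, hG, hGeq⟩ : ∃ G : ℂ → ℂ, Differentiable ℂ G ∧ ∀ w ∈ halfPlane 2,
      zetaIntegral (tubeFunction X Ω) 0 δ' w = zetaIntegral (tubeFunction X Ω) 0 δ w + G w := by
    have hcv : ∀ d > 0, ∀ w ∈ halfPlane 2, ZetaConverges (tubeFunction X Ω) 0 d w :=
      fun d hd w hw => zetaConverges_of_isBigO (locallyIntegrable_tubeFunction hΩ)
        (isBigO_tubeFunction hΩ) hd (by simpa [halfPlane] using hw)
    rcases le_total δ δ' with hle | hle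
    · refine ⟨zetaIntegral (tubeFunction X Ω) δ δ',
        differentiable_zetaIntegral (locallyIntegrable_tubeFunction hΩ) hδ hle, fun w hw => ?_⟩
      rw [zetaIntegral_add (hcv δ hδ w hw) (zetaConverges_tubeFunction_pos hΩ hδ hle w)]
    · refine ⟨fun w => -zetaIntegral (tubeFunction X Ω) δ' δ w,
        (differentiable_zetaIntegral (locallyIntegrable_tubeFunction hΩ) hδ' hle).neg,
        fun w hw => ?_⟩
      rw [← zetaIntegral_add (hcv δ' hδ' w hw) (zetaConverges_tubeFunction_pos hΩ hδ' hle w)]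
      ring
  have hGan : ∀ w, AnalyticAt ℂ G w := fun w => hG.analyticAt w
  have hZm := hZ.1.meromorphicOn
  obtain ⟨σ, hσ⟩ := hZ.2
  have hev := hZ'.eventuallyEq (M := Z + G) (σ := max σ 2)
    (hZm.add fun w _ => (hGan w).meromorphicAt) (fun w hw => by
      rw [Pi.add_apply, (hσ w ((le_max_left _ _).trans_lt hw)).2,
        hGeq w (halfPlane_anti (le_max_right _ _) hw)]) hs
  rw [meromorphicOrderAt_congr hev] at hpole
  have := meromorphicOrderAt_add (hZm s hs) (hGan s).meromorphicAt
  exact absurd hpole (not_lt.mpr ((le_min hnn (hGan s).meromorphicOrderAt_nonneg).trans this))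

end bounded
end
end VonKoch

namespace VonKoch
noncomputable section

/-! ### The tube zeta function from the scaling functional equation -/

section scaling

variable {n : ℕ} {r : ℝ} (hr0 : 0 < r) (hr1 : r < 1)
include hr0 hr1

theorem differentiable_moran : Differentiable ℂ (moran n r) := by
  have h1 : (conjRatio r : ℂ) ≠ 0 := by exact_mod_cast (conjRatio_pos hr1).ne'
  have h2 : (r : ℂ) ≠ 0 := by exact_mod_cast hr0.ne'
  unfold moran
  exact fun s => ((differentiableAt_const _).sub
    ((differentiableAt_id.const_cpow (Or.inl h1)).const_mul _)).sub
    ((differentiableAt_id.const_cpow (Or.inl h2)).const_mul _)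

omit hr0 hr1 in
theorem moran_ne_zero_iff {s : ℂ} : moran n r s ≠ 0 ↔ s ∉ scalingDimensions n r := by
  rw [scalingDimensions, mem_ofPred_eq, moran]
  exact not_congr ⟨fun h => by linear_combination h, fun h => by linear_combination h⟩

/-- Both ratios are less than one, so the two powers tend to zero as the real part grows. -/
theorem exists_moran_ne_zero : ∃ σ : ℝ, ∀ s ∈ halfPlane σ, moran n r s ≠ 0 := by
  have h1 : Tendsto (fun x : ℝ => 2 * conjRatio r ^ x + |(n : ℝ) - 1| * r ^ x) atTop (𝓝 0) := by
    have e1 := (tendsto_rpow_atTop_of_base_lt_one (conjRatio r)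
      (by linarith [conjRatio_pos hr1]) (conjRatio_lt_one hr0)).const_mul 2
    have e2 := (tendsto_rpow_atTop_of_base_lt_one r (by linarith) hr1).const_mul |(n : ℝ) - 1|
    simpa using e1.add e2
  obtain ⟨σ, hσ⟩ := eventually_atTop.mp (h1.eventually (gt_mem_nhds one_pos))
  refine ⟨σ, fun s hs he => ?_⟩
  have h2 := hσ s.re (le_of_lt hs)
  have h3 : (1 : ℂ) = 2 * (conjRatio r : ℂ) ^ s + ((n : ℂ) - 1) * (r : ℂ) ^ s := by
    rw [moran] at he; linear_combination he
  have h4 := congrArg norm h3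
  rw [norm_one] at h4
  have h5 := norm_add_le (2 * (conjRatio r : ℂ) ^ s) (((n : ℂ) - 1) * (r : ℂ) ^ s)
  rw [norm_mul, norm_mul, Complex.norm_cpow_eq_rpow_re_of_pos (conjRatio_pos hr1),
    Complex.norm_cpow_eq_rpow_re_of_pos hr0,
    show (n : ℂ) - 1 = (((n : ℝ) - 1 : ℝ) : ℂ) by push_cast; rfl, Complex.norm_real,
    Real.norm_eq_abs, Complex.norm_ofNat] at h5
  push_cast at h4 h5
  linarith

variable {X Ω : Set ℂ} (hΩ : volume Ω ≠ ⊤)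
include hΩ

theorem differentiable_entireE {δ : ℝ} (hδ : 0 < δ) : Differentiable ℂ (entireE n r X Ω δ) := by
  have h1 : (conjRatio r : ℂ) ≠ 0 := by exact_mod_cast (conjRatio_pos hr1).ne'
  have h2 : (r : ℂ) ≠ 0 := by exact_mod_cast hr0.ne'
  have hloc := locallyIntegrable_tubeFunction (X := X) hΩ
  have h3 := differentiable_zetaIntegral hloc hδ
    (le_div_self hδ.le (conjRatio_pos hr1) (conjRatio_lt_one hr0).le)
  have h4 := differentiable_zetaIntegral hloc hδ (le_div_self hδ.le hr0 hr1.le)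
  unfold entireE
  exact fun s => (((differentiableAt_id.const_cpow (Or.inl h1)).const_mul _).mul (h3 s)).add
    (((differentiableAt_id.const_cpow (Or.inl h2)).const_mul _).mul (h4 s))

theorem locallyIntegrable_remainder : LocallyIntegrable (remainder n r X Ω) := by
  have hmono : ∀ q > 0, LocallyIntegrable fun t => tubeFunction X Ω (t / q) := fun q hq =>
    ((monotone_tubeFunction (X := X) hΩ).comp fun _ _ hst =>
      div_le_div_of_nonneg_right hst (le_of_lt hq)).locallyIntegrable
  have h1 := hmono _ (conjRatio_pos hr1)
  have h2 := hmono r hr0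
  have h3 := (((locallyIntegrable_tubeFunction (X := X) hΩ).smul ((n : ℝ)⁻¹)).sub
    ((h1.smul (2 * conjRatio r ^ 2 * (n : ℝ)⁻¹)).add
    (h2.smul (((n : ℝ) - 1) * r ^ 2 * (n : ℝ)⁻¹))))
  convert h3 using 1
  ext t
  simp only [remainder, sectorTube, Pi.sub_apply, Pi.add_apply, Pi.smul_apply, smul_eq_mul]
  ring

/-- The functional equation of the tube zeta function, in the half-plane of convergence. -/
theorem moran_mul_zetaIntegral (hn : n ≠ 0) {δ : ℝ} (hδ : 0 < δ) {s : ℂ} (hs : s ∈ halfPlane 2) :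
    moran n r s * zetaIntegral (tubeFunction X Ω) 0 δ s =
      entireE n r X Ω δ s + zetaR n r X Ω δ s := by
  have hs' : 2 - 0 < s.re := by simpa [halfPlane] using hs
  have hloc := locallyIntegrable_tubeFunction (X := X) hΩ
  have hcv : ∀ d > 0, ZetaConverges (tubeFunction X Ω) 0 d s := fun d hd =>
    zetaConverges_of_isBigO hloc (isBigO_tubeFunction hΩ) hd hs'
  have hcvq : ∀ q > 0, ZetaConverges (fun t => tubeFunction X Ω (t / q)) 0 δ s := by
    intro q hq
    have hmono : Monotone fun t => tubeFunction X Ω (t / q) :=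
      (monotone_tubeFunction (X := X) hΩ).comp fun _ _ hst =>
        div_le_div_of_nonneg_right hst (le_of_lt hq)
    refine zetaConverges_of_isBigO (p := 0) hmono.locallyIntegrable ?_ hδ hs'
    simp only [Real.rpow_zero]
    refine Asymptotics.IsBigO.of_bound (volume.real Ω) (Eventually.of_forall fun t => ?_)
    rw [Real.norm_of_nonneg (tubeFunction_nonneg X Ω _), norm_one, mul_one]
    exact tubeFunction_le hΩ _
  -- Rescaling moves the upper limit to `δ / q`; the piece from `δ` to `δ / q` is what `entireE`
  -- collects.
  have hq : ∀ q : ℝ, 0 < q → q ≤ 1 →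
      (q : ℂ) ^ 2 * zetaIntegral (fun t => tubeFunction X Ω (t / q)) 0 δ s =
      (q : ℂ) ^ s * (zetaIntegral (tubeFunction X Ω) 0 δ s +
        zetaIntegral (tubeFunction X Ω) δ (δ / q) s) := by
    intro q hq0 hq1
    rw [zetaIntegral_comp_div _ hq0 hδ, zetaIntegral_add (hcv δ hδ)
      (zetaConverges_tubeFunction_pos hΩ hδ (le_div_self hδ.le hq0 hq1) s)]
  have hR : zetaR n r X Ω δ s = zetaIntegral (tubeFunction X Ω) 0 δ s -
      (2 * ((conjRatio r : ℂ) ^ 2 *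
        zetaIntegral (fun t => tubeFunction X Ω (t / conjRatio r)) 0 δ s) +
      ((n : ℂ) - 1) * ((r : ℂ) ^ 2 *
        zetaIntegral (fun t => tubeFunction X Ω (t / r)) 0 δ s)) := by
    have i1 := hcv δ hδ
    have i2 := hcvq _ (conjRatio_pos hr1)
    have i3 := hcvq r hr0
    rw [ZetaConverges] at i1 i2 i3
    have hn' : (n : ℂ) ≠ 0 := by exact_mod_cast hn
    simp only [zetaR, zetaIntegral]
    rw [← mul_assoc, ← mul_assoc, ← intervalIntegral.integral_const_mul,
      ← intervalIntegral.integral_const_mul, ← intervalIntegral.integral_const_mul,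
      ← intervalIntegral.integral_add (i2.const_mul _) (i3.const_mul _),
      ← intervalIntegral.integral_sub i1 ((i2.const_mul _).add (i3.const_mul _))]
    congr 1
    ext t
    simp only [remainder, sectorTube]
    push_cast
    field_simp
  rw [hR, hq _ (conjRatio_pos hr1) (conjRatio_lt_one hr0).le, hq r hr0 hr1.le, entireE, moran]
  ring

variable {C : ℝ} (hR : ∀ t > 0, |tubeFunction X Ω t -
      (2 * (conjRatio r ^ 2 * tubeFunction X Ω (t / conjRatio r)) +
      (n - 1) * (r ^ 2 * tubeFunction X Ω (t / r)))| ≤ C * t ^ 2)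
include hR

omit hr0 hr1 hΩ in
theorem isBigO_remainder : remainder n r X Ω =O[𝓝[>] 0] fun t : ℝ => t ^ (2 : ℝ) := by
  refine Asymptotics.IsBigO.of_bound ((n : ℝ)⁻¹ * C) ?_
  filter_upwards [self_mem_nhdsWithin] with t ht
  have h1 : remainder n r X Ω t = (n : ℝ)⁻¹ * (tubeFunction X Ω t -
      (2 * (conjRatio r ^ 2 * tubeFunction X Ω (t / conjRatio r)) +
      (n - 1) * (r ^ 2 * tubeFunction X Ω (t / r)))) := by
    simp only [remainder, sectorTube]; ring
  rw [h1, Real.norm_eq_abs, abs_mul, abs_of_nonneg (by positivity), Real.rpow_two,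
    Real.norm_of_nonneg (sq_nonneg t), mul_assoc]
  exact mul_le_mul_of_nonneg_left (hR t ht) (by positivity)

theorem zetaConverges_remainder {δ : ℝ} (hδ : 0 < δ) {s : ℂ} (hs : s ∈ halfPlane 0) :
    ZetaConverges (remainder n r X Ω) 0 δ s :=
  zetaConverges_of_isBigO (locallyIntegrable_remainder hr0 hr1 hΩ) (isBigO_remainder hR) hδ
    (by simpa [halfPlane] using hs)

theorem differentiableAt_zetaR {δ : ℝ} (hδ : 0 < δ) {s : ℂ} (hs : s ∈ halfPlane 0) :
    DifferentiableAt ℂ (zetaR n r X Ω δ) s :=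
  (differentiableAt_zetaIntegral_of_isBigO (locallyIntegrable_remainder hr0 hr1 hΩ)
    (isBigO_remainder hR) hδ (by simpa [halfPlane] using hs)).const_mul _

/-- The meromorphic extension of the tube zeta function. -/
theorem meromorphicOn_quotient {δ : ℝ} (hδ : 0 < δ) :
    MeromorphicOn (fun s => 1 / moran n r s * (entireE n r X Ω δ s + zetaR n r X Ω δ s))
      (halfPlane 0) := by
  intro s hs
  have h1 : AnalyticAt ℂ (moran n r) s := (differentiable_moran hr0 hr1).analyticAt s
  have h2 : AnalyticAt ℂ (entireE n r X Ω δ) s :=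
    (differentiable_entireE hr0 hr1 hΩ hδ).analyticAt s
  have h3 : AnalyticAt ℂ (zetaR n r X Ω δ) s := DifferentiableOn.analyticAt
    (fun w hw => (differentiableAt_zetaR hr0 hr1 hΩ hR hδ hw).differentiableWithinAt)
    ((isOpen_halfPlane 0).mem_nhds hs)
  exact ((MeromorphicAt.const 1 s).div h1.meromorphicAt).mul (h2.add h3).meromorphicAt

theorem analyticAt_quotient {δ : ℝ} (hδ : 0 < δ) {s : ℂ} (hs : s ∈ halfPlane 0)
    (hm : moran n r s ≠ 0) :
    AnalyticAt ℂ (fun s => 1 / moran n r s * (entireE n r X Ω δ s + zetaR n r X Ω δ s)) s := by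
  have h1 : AnalyticAt ℂ (moran n r) s := (differentiable_moran hr0 hr1).analyticAt s
  have h2 : AnalyticAt ℂ (entireE n r X Ω δ) s :=
    (differentiable_entireE hr0 hr1 hΩ hδ).analyticAt s
  have h3 : AnalyticAt ℂ (zetaR n r X Ω δ) s := DifferentiableOn.analyticAt
    (fun w hw => (differentiableAt_zetaR hr0 hr1 hΩ hR hδ hw).differentiableWithinAt)
    ((isOpen_halfPlane 0).mem_nhds hs)
  exact (analyticAt_const.div h1 hm).mul (h2.add h3)

omit hR in
theorem exists_quotient_eq (hn : n ≠ 0) {δ : ℝ} (hδ : 0 < δ) :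
    ∃ σ : ℝ, 2 ≤ σ ∧ ∀ s ∈ halfPlane σ, moran n r s ≠ 0 ∧
      1 / moran n r s * (entireE n r X Ω δ s + zetaR n r X Ω δ s) =
        zetaIntegral (tubeFunction X Ω) 0 δ s := by
  obtain ⟨σ, hσ⟩ := exists_moran_ne_zero (n := n) hr0 hr1
  refine ⟨max 2 σ, le_max_left _ _, fun s hs => ?_⟩
  have h1 := hσ s (halfPlane_anti (le_max_right _ _) hs)
  refine ⟨h1, ?_⟩
  rw [← moran_mul_zetaIntegral hr0 hr1 hΩ hn hδ (halfPlane_anti (le_max_left _ _) hs)]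
  field_simp

theorem exists_isTubeZeta (hn : n ≠ 0) {δ : ℝ} (hδ : 0 < δ) :
    ∃ Z : ℂ → ℂ, IsTubeZeta X Ω δ 0 Z := by
  have hM := meromorphicOn_quotient hr0 hr1 hΩ hR hδ
  set M := fun s => 1 / moran n r s * (entireE n r X Ω δ s + zetaR n r X Ω δ s) with hMdef
  refine ⟨toMeromorphicNFOn M (halfPlane 0), meromorphicNFOn_toMeromorphicNFOn _ _, ?_⟩
  obtain ⟨σ, hσ2, hσ⟩ := exists_quotient_eq hr0 hr1 hΩ hn hδ
  refine ⟨σ, fun s hs => ⟨?_, ?_⟩⟩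
  · exact zetaConverges_of_isBigO (p := 0) (locallyIntegrable_tubeFunction hΩ)
      (isBigO_tubeFunction hΩ) hδ (by linarith)
  · have hs0 : s ∈ halfPlane 0 := halfPlane_anti (by linarith) hs
    obtain ⟨hm, he⟩ := hσ s hs
    have han := analyticAt_quotient hr0 hr1 hΩ hR hδ hs0 hm
    -- Passing to normal form changes no value where the quotient is analytic.
    rw [toMeromorphicNFOn_eq_toMeromorphicNFAt hM hs0,
      toMeromorphicNFAt_eq_self.mpr han.meromorphicNFAt]
    exact he

theorem IsTubeZeta.eq_quotient (hn : n ≠ 0) {δ : ℝ} (hδ : 0 < δ) {Z : ℂ → ℂ}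
    (hZ : IsTubeZeta X Ω δ 0 Z) {s : ℂ} (hs : s ∈ halfPlane 0) (hm : moran n r s ≠ 0) :
    Z =ᶠ[𝓝 s] fun s => 1 / moran n r s * (entireE n r X Ω δ s + zetaR n r X Ω δ s) := by
  obtain ⟨σ, hσ2, hσ⟩ := exists_quotient_eq hr0 hr1 hΩ hn hδ
  exact hZ.eventuallyEq_nhds hs (hZ.eventuallyEq (meromorphicOn_quotient hr0 hr1 hΩ hR hδ)
    (fun s hs => (hσ s hs).2) hs) (analyticAt_quotient hr0 hr1 hΩ hR hδ hs hm)

theorem IsTubeZeta.poles_subset_scalingDimensions (hn : n ≠ 0) {δ : ℝ} (hδ : 0 < δ) {Z : ℂ → ℂ}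
    (hZ : IsTubeZeta X Ω δ 0 Z) : poles 0 Z ⊆ scalingDimensions n r := by
  rintro s ⟨hs, hpole⟩
  by_contra hD
  have hm := moran_ne_zero_iff.mpr hD
  have he := hZ.eq_quotient hr0 hr1 hΩ hR hn hδ hs hm
  rw [meromorphicOrderAt_congr (he.filter_mono nhdsWithin_le_nhds)] at hpole
  exact absurd hpole (not_lt.mpr
    (analyticAt_quotient hr0 hr1 hΩ hR hδ hs hm).meromorphicOrderAt_nonneg)

end scaling

/-! ### Holomorphy to the right of the Minkowski dimension. -/

section dimension

variable {X Ω : Set ℂ} (hΩ : volume Ω ≠ ⊤)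
include hΩ

omit hΩ in
theorem isBigO_of_content_eq_zero {d : ℝ} (hd : upperMinkowskiContent X Ω d = 0) :
    tubeFunction X Ω =O[𝓝[>] 0] fun t : ℝ => t ^ (2 - d) := by
  have h1 := eventually_lt_of_limsup_lt (f := 𝓝[>] (0 : ℝ))
    (u := fun t : ℝ => volume (Metric.thickening t X ∩ Ω) / ENNReal.ofReal (t ^ (2 - d)))
    (b := 1) (by rw [upperMinkowskiContent] at hd; rw [hd]; exact one_pos)
  refine Asymptotics.IsBigO.of_bound 1 ?_
  filter_upwards [h1, self_mem_nhdsWithin] with t ht ht0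
  have hpos : 0 < t ^ (2 - d) := Real.rpow_pos_of_pos ht0 _
  rw [ENNReal.div_lt_iff (Or.inl (ENNReal.ofReal_pos.mpr hpos).ne')
    (Or.inl ENNReal.ofReal_ne_top), one_mul] at ht
  rw [Real.norm_of_nonneg (tubeFunction_nonneg X Ω t), Real.norm_of_nonneg hpos.le, one_mul]
  exact ENNReal.toReal_le_of_le_ofReal hpos.le ht.le

omit hΩ in
-- For `d ≤ 0` the lower bound `t² / 4` keeps the content positive. Consequently the half-plane to
-- the right of the dimension lies in `Re s > 0`, where the extension is known to be meromorphic.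
theorem pos_of_content_eq_zero (hlow : ∀ᶠ t in 𝓝[>] (0 : ℝ),
    ENNReal.ofReal (t ^ 2 / 4) ≤ volume (Metric.thickening t X ∩ Ω)) {d : ℝ}
    (hd : upperMinkowskiContent X Ω d = 0) : 0 < d := by
  by_contra! hd0
  have h1 := eventually_lt_of_limsup_lt (f := 𝓝[>] (0 : ℝ))
    (u := fun t : ℝ => volume (Metric.thickening t X ∩ Ω) / ENNReal.ofReal (t ^ (2 - d)))
    (b := ENNReal.ofReal (1 / 4))
    (by rw [upperMinkowskiContent] at hd; rw [hd]; exact ENNReal.ofReal_pos.mpr (by norm_num))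
  obtain ⟨t, ht, hl, ht0, ht1⟩ :=
    (h1.and (hlow.and (Ioo_mem_nhdsGT (one_pos (α := ℝ))))).exists
  have hpos : 0 < t ^ (2 - d) := Real.rpow_pos_of_pos ht0 _
  rw [ENNReal.div_lt_iff (Or.inl (ENNReal.ofReal_pos.mpr hpos).ne')
    (Or.inl ENNReal.ofReal_ne_top), ← ENNReal.ofReal_mul (by norm_num)] at ht
  have h2 := hl.trans_lt ht
  rw [ENNReal.ofReal_lt_ofReal_iff (by positivity)] at h2
  have h3 : t ^ (2 - d) ≤ t ^ (2 : ℝ) :=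
    Real.rpow_le_rpow_of_exponent_ge ht0 ht1.le (by linarith)
  rw [Real.rpow_two] at h3
  linarith

/-- The tube zeta function is holomorphic to the right of the Minkowski dimension. -/
theorem IsTubeZeta.differentiableOn (hlow : ∀ᶠ t in 𝓝[>] (0 : ℝ),
    ENNReal.ofReal (t ^ 2 / 4) ≤ volume (Metric.thickening t X ∩ Ω)) {δ : ℝ} (hδ : 0 < δ)
    {Z : ℂ → ℂ} (hZ : IsTubeZeta X Ω δ 0 Z) :
    DifferentiableOn ℂ Z {s : ℂ | upperMinkowskiDim X Ω < (s.re : EReal)} := by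
  intro s hs
  obtain ⟨_, ⟨d, hd, rfl⟩, hds⟩ := sInf_lt_iff.mp (show sInf _ < (s.re : EReal) from hs)
  have hd0 := pos_of_content_eq_zero hlow hd
  have hds' : s ∈ halfPlane d := by
    simpa [halfPlane] using hds
  have hdiff : ∀ w ∈ halfPlane d, DifferentiableAt ℂ (zetaIntegral (tubeFunction X Ω) 0 δ) w :=
    fun w hw => differentiableAt_zetaIntegral_of_isBigO (locallyIntegrable_tubeFunction hΩ)
      (isBigO_of_content_eq_zero hd) hδ (by rw [sub_sub_cancel]; exact hw)
  have han : ∀ w ∈ halfPlane d, AnalyticAt ℂ (zetaIntegral (tubeFunction X Ω) 0 δ) w :=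
    fun w hw => DifferentiableOn.analyticAt (fun v hv => (hdiff v hv).differentiableWithinAt)
      ((isOpen_halfPlane d).mem_nhds hw)
  obtain ⟨σ, hσ⟩ := hZ.2
  have hsub := halfPlane_anti hd0.le
  have he := hZ.eventuallyEq_nhds (hsub hds') (eventuallyEq_nhdsNE_of_meromorphicOn
    (hZ.1.meromorphicOn.mono_set hsub) (fun w hw => (han w hw).meromorphicAt)
    (fun w hw => (hσ w hw).2) hds') (han s hds')
  exact (he.differentiableAt_iff.mpr (hdiff s hds')).differentiableWithinAt

end dimension
end
end VonKoch

namespace VonKoch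
noncomputable section

/-! ### Snowflakes up to isometry -/

/-- By Mazur–Ulam the isometry is a real linear isometry followed by a translation. -/
theorem volume_image_isometryEquiv (F : ℂ ≃ᵢ ℂ) (S : Set ℂ) : volume (F '' S) = volume S := by
  have h1 : F '' S = (fun z => z + F 0) '' (F.toRealLinearIsometryEquiv '' S) := by
    rw [image_image]
    simp
  rw [h1, image_add_right, measure_preimage_add_right,
    LinearIsometryEquiv.image_eq_preimage_symm]
  exact F.toRealLinearIsometryEquiv.symm.measurePreserving.measure_preimage_emb
    F.toRealLinearIsometryEquiv.symm.toHomeomorph.measurableEmbedding S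

theorem image_thickening_inter (F : ℂ ≃ᵢ ℂ) (X Ω : Set ℂ) (t : ℝ) :
    Metric.thickening t (F '' X) ∩ F '' Ω = F '' (Metric.thickening t X ∩ Ω) := by
  rw [image_inter F.injective]
  congr 1
  ext z
  simp only [Metric.mem_thickening_iff, mem_image, exists_exists_and_eq_and]
  constructor
  · rintro ⟨x, hx, hzx⟩
    refine ⟨F.symm z, ⟨x, hx, ?_⟩, F.apply_symm_apply z⟩
    rw [← F.dist_eq, F.apply_symm_apply]; exact hzx
  · rintro ⟨w, ⟨x, hx, hwx⟩, rfl⟩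
    exact ⟨x, hx, by rwa [F.dist_eq]⟩

theorem IsSimpleClosedCurve.image {K : Set ℂ} (hK : IsSimpleClosedCurve K) (F : ℂ ≃ᵢ ℂ) :
    IsSimpleClosedCurve (F '' K) := by
  obtain ⟨γ, hγ, hinj, rfl⟩ := hK
  exact ⟨F ∘ γ, F.continuous.comp hγ, F.injective.comp hinj, range_comp _ _⟩

theorem IsBoundedComponent.image {K Ω : Set ℂ} (hΩ : IsBoundedComponent K Ω) (F : ℂ ≃ᵢ ℂ) :
    IsBoundedComponent (F '' K) (F '' Ω) := by
  obtain ⟨⟨x, hx, rfl⟩, hb⟩ := hΩ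
  refine ⟨⟨F x, ?_, ?_⟩, F.isometry.lipschitz.isBounded_image hb⟩
  · rw [← image_compl_eq F.bijective]; exact mem_image_of_mem F hx
  · rw [← image_compl_eq F.bijective]
    exact F.toHomeomorph.image_connectedComponentIn hx

/-- A simple snowflake with a bounded complementary component is isometric to a loop with a
self-similar parametrization. -/
theorem IsSnowflake.exists_loop {n : ℕ} (hn : 3 ≤ n) {r : ℝ} (hr0 : 0 < r) (hr1 : r < 1)
    {K Ω : Set ℂ} (hK : IsSnowflake n r K) (hsimple : IsSimpleClosedCurve K)
    (hΩ : IsBoundedComponent K Ω) :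
    ∃ (γ κ : ℝ → ℂ) (Ω₀ : Set ℂ) (F : ℂ ≃ᵢ ℂ), IsKochLoop n r γ κ Ω₀ ∧
      K = F '' range (loopCurve n γ) ∧ Ω = F '' Ω₀ := by
  obtain ⟨C, hC, F, hF⟩ := hK
  have hg := isGenerator_koch hn hr0 hr1
  obtain ⟨γ, hγ⟩ := hg.exists_curve
  have hA := hγ.eq_attractor hg (hC.isCompact.image Complex.continuous_conj)
    (hC.nonempty.image _) (hC.conj_eq hn)
  have hrange := range_loopCurve hn hγ
  rw [hA] at hrange
  rw [← hrange] at hF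
  have hsymm : ∀ S : Set ℂ, F '' (F.symm '' S) = S := fun S => by
    rw [image_image]; simp
  have hK0 : F.symm '' K = range (loopCurve n γ) := by
    rw [hF, image_image]; simp
  have hs := hsimple.image F.symm
  rw [hK0] at hs
  obtain ⟨κ, hκ, hκr⟩ := hs.exists_param
  have hc := hΩ.image F.symm
  rw [hK0] at hc
  exact ⟨γ, κ, F.symm '' Ω, F, ⟨hn, hr0, hr1, hγ, hκ, hκr, hc⟩, hF, (hsymm Ω).symm⟩

end
end VonKoch

theorem mainTheorem1 (n : ℕ) (hn : 3 ≤ n) (r : ℝ) (hr0 : 0 < r) (hr1 : r < 1)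
    (K Ω : Set ℂ) (hK : VonKoch.IsSnowflake n r K) (hsimple : VonKoch.IsSimpleClosedCurve K)
    (hΩ : VonKoch.IsBoundedComponent K Ω) (δ : ℝ) (hδ : 0 < δ) :
    Differentiable ℂ (VonKoch.entireE n r K Ω δ) ∧
    (∀ s ∈ VonKoch.halfPlane 0, VonKoch.ZetaConverges (VonKoch.remainder n r K Ω) 0 δ s) ∧
    DifferentiableOn ℂ (VonKoch.zetaR n r K Ω δ) (VonKoch.halfPlane 0) ∧
    (∃ Z : ℂ → ℂ, VonKoch.IsTubeZeta K Ω δ 0 Z) ∧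
    (∀ Z : ℂ → ℂ, VonKoch.IsTubeZeta K Ω δ 0 Z →
      (∀ s ∈ VonKoch.halfPlane 0 \ VonKoch.scalingDimensions n r,
        Z s = 1 / VonKoch.moran n r s *
          (VonKoch.entireE n r K Ω δ s + VonKoch.zetaR n r K Ω δ s)) ∧
      VonKoch.poles 0 Z = VonKoch.complexDimensions K Ω 0 ∧
      DifferentiableOn ℂ Z {s : ℂ | VonKoch.upperMinkowskiDim K Ω < (s.re : EReal)}) ∧
    VonKoch.complexDimensions K Ω 0 ⊆ VonKoch.scalingDimensions n r := by
  -- Tube volumes are invariant under isometries, so the estimates for the loop in standard position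
  -- apply to `K` and `Ω`.
  obtain ⟨γ, κ, Ω₀, F, h, rfl, rfl⟩ := hK.exists_loop hn hr0 hr1 hsimple hΩ
  have hvol : ∀ t, volume (Metric.thickening t (F '' range (VonKoch.loopCurve n γ)) ∩ F '' Ω₀) =
      volume (Metric.thickening t (range (VonKoch.loopCurve n γ)) ∩ Ω₀) := fun t => by
    rw [VonKoch.image_thickening_inter, VonKoch.volume_image_isometryEquiv]
  have hfin : volume (F '' Ω₀) ≠ ⊤ := hΩ.isBounded.measure_lt_top.ne
  have hlow : ∀ᶠ t in 𝓝[>] (0 : ℝ), ENNReal.ofReal (t ^ 2 / 4) ≤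
      volume (Metric.thickening t (F '' range (VonKoch.loopCurve n γ)) ∩ F '' Ω₀) := by
    simpa only [hvol] using h.eventually_le_tube
  have htube : ∀ t, VonKoch.tubeFunction (F '' range (VonKoch.loopCurve n γ)) (F '' Ω₀) t =
      volume.real (Metric.thickening t (range (VonKoch.loopCurve n γ)) ∩ Ω₀) := fun t => by
    rw [VonKoch.tubeFunction, hvol, measureReal_def]
  obtain ⟨C, hC⟩ := h.exists_remainder_le
  simp only [← htube] at hC
  have hn0 : n ≠ 0 := by omega
  refine ⟨VonKoch.differentiable_entireE hr0 hr1 hfin hδ,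
    fun s hs => VonKoch.zetaConverges_remainder hr0 hr1 hfin hC hδ hs,
    fun s hs => (VonKoch.differentiableAt_zetaR hr0 hr1 hfin hC hδ hs).differentiableWithinAt,
    VonKoch.exists_isTubeZeta hr0 hr1 hfin hC hn0 hδ, fun Z hZ => ⟨?_, ?_, ?_⟩, ?_⟩
  · rintro s ⟨hs, hD⟩
    exact (hZ.eq_quotient hr0 hr1 hfin hC hn0 hδ hs
      (VonKoch.moran_ne_zero_iff.mpr hD)).eq_of_nhds
  · refine Subset.antisymm (fun ω hω => ⟨δ, hδ, Z, hZ, hω⟩) ?_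
    rintro ω ⟨δ', hδ', Z', hZ', hω⟩
    exact hZ.poles_subset hfin hδ hδ' hZ' hω
  · exact hZ.differentiableOn hfin hlow hδ
  · rintro ω ⟨δ', hδ', Z', hZ', hω⟩
    exact hZ'.poles_subset_scalingDimensions hr0 hr1 hfin hC hn0 hδ' hω
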